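/- Let $G=(V,E)$ be a finite simple graph, $n=|V|$, and let $E^c$ be the set of its non-edges, with an arbitrary total order. A set $F\subseteq E^c$ is a \emph{chordal completion} of $G$ if $G_F=(V,E\cup F)$ has no induced cycle of length at least $4$; let $\mathcal F$ be the set of chordal completions and $\mathcal F_{\min}$ the set of inclusion-wise minimal ones. Write $\bar F=E^c\setminus F$. For $F\in\mathcal F$ and $X\subseteq E^c$, let $c(F,X)$ be the smallest $e\in X\cap F$ with $F\setminus\{e\}\in\mathcal F$, if there is one. $\mathrm{Del}(F,X)$ is the result of removing $c(F,X)$ from $F$ repeatedly for as long as it exists; $\mathrm{Del}(F)=\mathrm{Del}(F,F)$, and $F_0=\mathrm{Del}(E^c)$. For $F\in\mathcal F_{\min}$, $\mathrm{Can}(\bar F)=f_1,\dots,f_\ell$ is the sequence of elements removed by $\mathrm{Del}(E^c,\bar F)$, in the order of removal, and for $F'\in\mathcal F_{\min}$, $\mathrm{prox}(F',F)$ is the largest $i\le\ell$ with $\{f_1,\dots,f_i\}\subseteq\bar F'$. For $e=xy\in F$, $\mathrm{Flip}(F,e)$ is the set of edges, among those in $E^c$, of the graph obtained from $G_F$ by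 removing $e$ and turning the common neighbourhood of $x$ and $y$ in $G_F$ into a clique. Put $\mathrm{Succ}(F,e)=\mathrm{Del}(\mathrm{Flip}(F,e))$ and $\mathrm{Neighbours}(F)=\{\mathrm{Succ}(F,e): e\in F\}$. The \emph{canonical path} of $F\in\mathcal F_{\min}$ is the sequence $F_0,\dots,F_k=F$ in $\mathcal F_{\min}$ with $F_i=\mathrm{Succ}(F_{i-1},f_{\mathrm{prox}(F_{i-1},F)+1})$ for $1\le i\le k$. For $F\neq F_0$, $\mathrm{Parent}(F)=F_{k-1}$, and $\mathrm{Children}(F)=\{F'\in\mathrm{Neighbours}(F):\mathrm{Parent}(F')=F\}$. The algorithm calls $\mathrm{enum}(F_0)$ at recursion depth $0$, where $\mathrm{enum}(F)$ outputs $F$ first if the recursion depth is even, then calls $\mathrm{enum}(F')$ at the next depth for each $F'\in\mathrm{Children}(F)$, in any order, and outputs $F$ last if the depth is odd. Then: (1) Every $F\in\mathcal F_{\min}$ has exactly one canonical path, and every $F\in\mathcal F_{\min}$ with $F\ne F_0$ has exactly one parent. The arcs $(F,F')$ with $F'\in\mathrm{Children}(F)$ form a spanning arborescence of $\mathcal F_{\min}$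 rooted at $F_0$: for every $F\in\mathcal F_{\min}$ there is exactly one directed walk from $F_0$ to $F$. The algorithm has a terminating execution, and each of its outputs, whatever the order in which children are processed, contains every minimal chordal completion of $G$ exactly once and nothing else. (2) The algorithm runs with polynomial delay and in polynomial space: there are a program and polynomials $p,q$ such that for every $n$, every graph $G$ on $n$ vertices and every total order on the pairs of vertices (which also orders $E^c$), the program, given $n$ and the adjacency table of $G$ listed in that order, halts having output a sequence that the algorithm outputs for $G$; the time before the first output, between two consecutive outputs, and from the last output to halting is at most $p(n)$ each, and the space used is at most $q(n)$. Programs are while programs with finitely many variables whose values are finite binary trees; space is the total size of the values of the variables (the output device is write-only), and each elementary step costs time equal to the current space. -/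

import Mathlib

namespace ChordalEnum

/-! ### Chordal completions -/

section Graph

variable {V : Type*}

/-- A graph is chordal if it has no induced cycle of length at least four. -/
def IsChordal (H : SimpleGraph V) : Prop :=
  ∀ k : ℕ, 4 ≤ k → IsEmpty (SimpleGraph.cycleGraph k ↪g H)

/-- The flip of the edge `e = {x, y}` in `H`: remove `e` and turn `N(x) ∩ N(y)` into a clique.
(`SimpleGraph.fromEdgeSet` ignores degenerate pairs.) -/
def flipGraph (H : SimpleGraph V) (e : Sym2 V) : SimpleGraph V :=
  H.deleteEdges {e} ⊔ SimpleGraph.fromEdgeSet {s | ∀ u ∈ s, ∀ x ∈ e, H.Adj x u}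

/-- `L` lists all two-element subsets of `V`, each exactly once. Such a list is the same thing as
a total order on these subsets (smaller elements come first); in particular it orders the
non-edges of every graph on `V`, and every order of the non-edges arises in this way. -/
def IsPairOrder (L : List (Sym2 V)) : Prop :=
  L.Nodup ∧ ∀ e : Sym2 V, e ∈ L ↔ ¬ e.IsDiag

variable [Fintype V] [DecidableEq V] (G : SimpleGraph V) (L : List (Sym2 V))

open scoped Classical in
/-- The set `E^c` of non-edges of `G`. -/
noncomputable def nonEdges : Finset (Sym2 V) :=
  {e : Sym2 V | e ∈ Gᶜ.edgeSet}

/-- The graph `G_F = (V, E ∪ F)`. -/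
def fillGraph (F : Finset (Sym2 V)) : SimpleGraph V :=
  G ⊔ SimpleGraph.fromEdgeSet (F : Set (Sym2 V))

/-- `F ⊆ E^c` is a chordal completion of `G`. -/
def IsCompletion (F : Finset (Sym2 V)) : Prop :=
  F ⊆ nonEdges G ∧ IsChordal (fillGraph G F)

/-- `F` is an inclusion-wise minimal chordal completion of `G`. -/
def IsMinCompletion (F : Finset (Sym2 V)) : Prop :=
  Minimal (IsCompletion G) F

/-- The complement of `F` in `E^c`. -/
noncomputable def bar (F : Finset (Sym2 V)) : Finset (Sym2 V) :=
  nonEdges G \ F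

open scoped Classical in
/-- The elements of `X ∩ F` whose removal from `F` leaves a chordal completion. -/
noncomputable def candidates (F X : Finset (Sym2 V)) : Finset (Sym2 V) :=
  {e ∈ X ∩ F | IsCompletion G (F.erase e)}

/-- The smallest candidate in the order `L`, if there is one. -/
noncomputable def minCand (F X : Finset (Sym2 V)) : Option (Sym2 V) :=
  L.find? fun e => decide (e ∈ candidates G F X)

theorem mem_of_minCand {F X : Finset (Sym2 V)} {e : Sym2 V} (h : minCand G L F X = some e) :
    e ∈ F := by
  have h1 := List.find?_some h
  replace h1 : e ∈ candidates G F X := by simpa using h1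
  simp only [candidates, Finset.mem_filter, Finset.mem_inter] at h1
  exact h1.1.2

/-- `Del(F, X)`: as long as there is a candidate, remove the smallest one from `F`. -/
noncomputable def del (F X : Finset (Sym2 V)) : Finset (Sym2 V) :=
  match _h : minCand G L F X with
  | none => F
  | some e => del (F.erase e) X
termination_by F.card
decreasing_by exact Finset.card_erase_lt_of_mem (mem_of_minCand G L _h)

/-- The elements removed by `Del(F, X)`, in the order of their removal. -/
noncomputable def removed (F X : Finset (Sym2 V)) : List (Sym2 V) :=
  match _h : minCand G L F X with
  | none => []
  | some e => e :: removed (F.erase e) X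
termination_by F.card
decreasing_by exact Finset.card_erase_lt_of_mem (mem_of_minCand G L _h)

/-- The canonical ordering `Can(E^c \ F)`. -/
noncomputable def can (F : Finset (Sym2 V)) : List (Sym2 V) :=
  removed G L (nonEdges G) (bar G F)

/-- The proximity of `E^c \ F₁` to `E^c \ F₂`: the length of the longest prefix of
`Can(E^c \ F₂)` whose elements all lie in `E^c \ F₁`. -/
noncomputable def prox (F₁ F₂ : Finset (Sym2 V)) : ℕ :=
  ((can G L F₂).takeWhile fun e => decide (e ∈ bar G F₁)).length

open scoped Classical in
/-- `Flip(F, e)`: the fill edges of the flip of `e` in `G_F`. -/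
noncomputable def flip (F : Finset (Sym2 V)) (e : Sym2 V) : Finset (Sym2 V) :=
  {s ∈ nonEdges G | s ∈ (flipGraph (fillGraph G F) e).edgeSet}

/-- `Succ(F, e) = Del(Flip(F, e))`. -/
noncomputable def succ (F : Finset (Sym2 V)) (e : Sym2 V) : Finset (Sym2 V) :=
  del G L (flip G F e) (flip G F e)

/-- `Neighbours(F) = {Succ(F, e) | e ∈ F}`. -/
noncomputable def neighbours (F : Finset (Sym2 V)) : Finset (Finset (Sym2 V)) :=
  F.image (succ G L F)

/-- The reference solution `F₀ = Del(E^c)`. -/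
noncomputable def root : Finset (Sym2 V) :=
  del G L (nonEdges G) (nonEdges G)

/-- One step towards `F` from `C`: with `f₁, …, f_ℓ = Can(E^c \ F)` and `i` the proximity of `C`
to `F`, it is `Succ(C, f_{i+1})`, and it is undefined if `i = ℓ`. (List indices start at `0`.) -/
noncomputable def nextStep (F C : Finset (Sym2 V)) : Option (Finset (Sym2 V)) :=
  ((can G L F)[prox G L C F]?).map (succ G L C)

/-- `p` is the canonical path `F₀, …, F_k = F` of `F`. -/
def IsCanonicalPath (F : Finset (Sym2 V)) (p : List (Finset (Sym2 V))) : Prop :=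
  p.head? = some (root G L) ∧ p.getLast? = some F ∧ (∀ C ∈ p, IsMinCompletion G C) ∧
    p.IsChain fun C C' => nextStep G L F C = some C'

/-- `P = Parent(F)`: the last completion before `F` on the canonical path of `F`. -/
def IsParent (P F : Finset (Sym2 V)) : Prop :=
  ∃ q : List (Finset (Sym2 V)), IsCanonicalPath G L F (q ++ [P, F])

open scoped Classical in
/-- `Children(F) = {F' ∈ Neighbours(F) | Parent(F') = F}`. -/
noncomputable def children (F : Finset (Sym2 V)) : Finset (Finset (Sym2 V)) :=
  {F' ∈ neighbours G L F | IsParent G L F F'}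

/-- `EnumOutput d Fs out`: calling the recursive procedure `enum` of the enumeration algorithm at
recursion depth `d` on the members of `Fs`, one after the other, can output the sequence `out`.
The procedure `enum`, called on `F`, outputs `F` first if the depth is even, then calls itself on
the children of `F`, in an arbitrary order, and outputs `F` last if the depth is odd. -/
inductive EnumOutput : ℕ → List (Finset (Sym2 V)) → List (Finset (Sym2 V)) → Prop
  | nil (d : ℕ) : EnumOutput d [] []
  | cons (d : ℕ) (F : Finset (Sym2 V)) (Fs kids out out' : List (Finset (Sym2 V))) :
      kids.Nodup → (∀ F', F' ∈ kids ↔ F' ∈ children G L F) →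
      EnumOutput (d + 1) kids out → EnumOutput d Fs out' →
      EnumOutput d (F :: Fs) ((if Even d then F :: out else out ++ [F]) ++ out')

/-- The enumeration algorithm, i.e. `enum(F₀)` at depth `0`, can output the sequence `out`. -/
def IsAlgorithmOutput (out : List (Finset (Sym2 V))) : Prop :=
  EnumOutput G L 0 [root G L] out

end Graph

/-- The arcs `arc` form a spanning arborescence of the vertex set `S` rooted at `r`: they stay in
`S` and from `r` there is exactly one directed walk to every vertex in `S`. -/
def IsSpanningArborescence {α : Type*} (S : Set α) (arc : α → α → Prop) (r : α) : Prop :=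
  r ∈ S ∧ (∀ a b, arc a b → a ∈ S → b ∈ S) ∧
    ∀ v ∈ S, ∃! p : List α, p.head? = some r ∧ p.getLast? = some v ∧ p.IsChain arc

/-! ### The machine model: while programs on binary trees with an output device -/

/-- The values that programs work on: finite binary trees. -/
inductive Data : Type
  | nil : Data
  | cons : Data → Data → Data
deriving DecidableEq

namespace Data

/-- The number of nodes and leaves of a tree. -/
def size : Data → ℕ
  | nil => 1
  | cons a b => size a + size b + 1

def hd : Data → Data
  | nil => nil
  | cons a _ => a

def tl : Data → Data
  | nil => nil
  | cons _ b => b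

/-- Truth values: `nil` is false. -/
def ofBool (b : Bool) : Data :=
  if b then cons nil nil else nil

/-- Natural numbers in unary. -/
def ofNat : ℕ → Data
  | 0 => nil
  | k + 1 => cons nil (ofNat k)

def ofList : List Data → Data
  | [] => nil
  | a :: l => cons a (ofList l)

end Data

/-- Expressions over variables in `ι`. -/
inductive Expr (ι : Type) : Type
  | var : ι → Expr ι
  | nil : Expr ι
  | cons : Expr ι → Expr ι → Expr ι
  | hd : Expr ι → Expr ι
  | tl : Expr ι → Expr ι
  | eq : Expr ι → Expr ι → Expr ι

/-- Programs. `emit a` writes the value of `a` to the output device, which is write-only. -/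
inductive Prog (ι : Type) : Type
  | assign : ι → Expr ι → Prog ι
  | emit : Expr ι → Prog ι
  | seq : Prog ι → Prog ι → Prog ι
  | cond : Expr ι → Prog ι → Prog ι → Prog ι
  | loop : Expr ι → Prog ι → Prog ι

section Machine

variable {ι : Type}

/-- The value of an expression in a store. -/
def Expr.eval (s : ι → Data) : Expr ι → Data
  | .var i => s i
  | .nil => .nil
  | .cons a b => .cons (a.eval s) (b.eval s)
  | .hd a => (a.eval s).hd
  | .tl a => (a.eval s).tl
  | .eq a b => Data.ofBool (decide (a.eval s = b.eval s))

/-- An elementary step of a run: the size of the store when it is made, and the value it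
outputs, if any. -/
structure Step : Type where
  size : ℕ
  out : Option Data

variable [Fintype ι] [DecidableEq ι]

/-- The size of a store: the total size of the values of all variables. -/
def storeSize (s : ι → Data) : ℕ :=
  ∑ i, (s i).size

/-- `Run c s tr t`: started in the store `s`, the program `c` makes the steps `tr` and halts in
the store `t`. Assignments, outputs and the evaluations of tests are the elementary steps. -/
inductive Run : Prog ι → (ι → Data) → List Step → (ι → Data) → Prop
  | assign (i : ι) (a : Expr ι) (s : ι → Data) :
      Run (.assign i a) s [⟨storeSize s, none⟩] (Function.update s i (a.eval s))
  | emit (a : Expr ι) (s : ι → Data) :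
      Run (.emit a) s [⟨storeSize s, some (a.eval s)⟩] s
  | seq (c d : Prog ι) (s t u : ι → Data) (tr tr' : List Step) :
      Run c s tr t → Run d t tr' u → Run (.seq c d) s (tr ++ tr') u
  | cond_true (a : Expr ι) (c d : Prog ι) (s t : ι → Data) (tr : List Step) :
      a.eval s ≠ .nil → Run c s tr t → Run (.cond a c d) s (⟨storeSize s, none⟩ :: tr) t
  | cond_false (a : Expr ι) (c d : Prog ι) (s t : ι → Data) (tr : List Step) :
      a.eval s = .nil → Run d s tr t → Run (.cond a c d) s (⟨storeSize s, none⟩ :: tr) t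
  | loop_true (a : Expr ι) (c : Prog ι) (s t u : ι → Data) (tr tr' : List Step) :
      a.eval s ≠ .nil → Run c s tr t → Run (.loop a c) t tr' u →
      Run (.loop a c) s (⟨storeSize s, none⟩ :: (tr ++ tr')) u
  | loop_false (a : Expr ι) (c : Prog ι) (s : ι → Data) :
      a.eval s = .nil → Run (.loop a c) s [⟨storeSize s, none⟩] s

end Machine

/-- The values output during a run, in the order of output. -/
def outputs (tr : List Step) : List Data :=
  tr.filterMap Step.out

/-- The running time of a sequence of steps. A step is charged the size of the store, which up to
a constant depending on the program bounds the work of evaluating its expression. -/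
def time (tr : List Step) : ℕ :=
  (tr.map Step.size).sum

/-- The run `tr` has delay at most `D`: from the start, and from after any output, it takes time
at most `D` up to and including the next output, or up to halting. Equivalently, every
contiguous block of steps in which only the last one may output takes time at most `D`. -/
def DelayLE (tr : List Step) (D : ℕ) : Prop :=
  ∀ (u : List Step) (x : Step), (u ++ [x]) <:+: tr → (∀ y ∈ u, y.out = none) →
    time (u ++ [x]) ≤ D

/-- Throughout the run `tr`, which halts in the store `t`, the store has size at most `S`. -/
def SpaceLE {ι : Type} [Fintype ι] (tr : List Step) (t : ι → Data) (S : ℕ) : Prop :=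
  (∀ x ∈ tr, x.size ≤ S) ∧ storeSize t ≤ S

/-- The initial store: the input is in variable `0`, the other variables are `nil`. -/
def initStore (k : ℕ) (input : Data) : Fin (k + 1) → Data :=
  Function.update (fun _ => .nil) 0 input

/-! ### Inputs and outputs -/

/-- A pair of vertices, the smaller one first. -/
def encodePair {n : ℕ} (e : Sym2 (Fin n)) : Data :=
  .cons (.ofNat e.inf) (.ofNat e.sup)

open scoped Classical in
/-- A graph on `n` vertices is given by `n` and its adjacency table: the list of all pairs of
vertices, in the order `L`, each with a bit that tells whether it is an edge. -/
noncomputable def encodeGraph {n : ℕ} (G : SimpleGraph (Fin n)) (L : List (Sym2 (Fin n))) : Data :=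
  .cons (.ofNat n)
    (.ofList (L.map fun e => .cons (encodePair e) (.ofBool (decide (e ∈ G.edgeSet)))))

/-- A completion is output as the list of its fill edges, in the order `L`. -/
def encodeCompletion {n : ℕ} (L : List (Sym2 (Fin n))) (F : Finset (Sym2 (Fin n))) : Data :=
  .ofList ((L.filter fun e => decide (e ∈ F)).map encodePair)

end ChordalEnum

/-! Chordality is replaced by `HoleFree`, a condition on walks instead of induced cycles, which is
easier to follow through changes of edges. It yields two facts. An edge xy of a chordal graph can be
deleted without losing chordality exactly when the common neighbours of x and y form a clique
(`HoleFree.deleteEdge`, `HoleFree.commonClique`). Between two nested distinct chordal graphs some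
edge of the difference can be deleted from the larger one (`HoleFree.exists_removable`). So
minimality is a matter of single deletions, `Del` produces minimal completions, and Can(bar F) is an
ordering of all of bar F.

Let f be the first element of Can(bar F) that a minimal completion C still contains, and let A be
E^c without the earlier elements. Then C lies in A, and f is deletable from A, so the common
neighbourhood of the ends of f is already a clique in G_A. Hence flipping f in C adds only members
of A and does not restore f. The successor therefore misses f as well as all earlier elements
(`succ_mem_bar`): proximity strictly increases. So canonical paths exist, and they are unique
because each step is determined.

That the root reaches every F by parent arcs is less direct: a prefix of the canonical path of F
need not be the canonical path of its last member P. Compare the canonical orderings at their first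
difference. If that of F is smaller there, the prefix is the canonical path of P
(`isCanonicalPath_of_lt`), and the last arc of the prefix is a parent arc. Otherwise P has a
lexicographically smaller ordering and is reached by induction (`reach_root`). Since parents are
unique, the arcs form an arborescence.

For the complexity, the functions computable in polynomial time on trees (`Comp`) are closed under
composition, branching, folds and size-bounded iteration, and the clique criterion replaces any test
of chordality. The traversal keeps only the current completion, the parity of its depth and whether
it is being entered or left; parent and siblings are recomputed, so no stack is stored. Output by
parity ensures that after a silent state the next one outputs or the traversal ends, which bounds
the delay by a constant number of polynomial steps. -/

namespace ChordalEnum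

/-! ### Chordality in terms of walks. -/

section HoleFree

open Relation

variable {V : Type*}

/-- One step of a walk in `H` to a vertex outside the closed neighbourhood of `x`. -/
def OffStep (H : SimpleGraph V) (x u v : V) : Prop :=
  H.Adj u v ∧ ¬ H.Adj x v ∧ v ≠ x

/-- Any two neighbours of `x` joined by a walk whose interior avoids the closed neighbourhood
of `x` are equal or adjacent. -/
def HoleFree (H : SimpleGraph V) : Prop :=
  ∀ x a b c : V, H.Adj x a → H.Adj x b → ReflTransGen (OffStep H x) a c → H.Adj c b →
    a = b ∨ H.Adj a b

theorem cycleGraph_adj_of_lt {k : ℕ} {u v : Fin k} (h : u < v) :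
    (SimpleGraph.cycleGraph k).Adj u v ↔
      (v : ℕ) = u + 1 ∨ ((u : ℕ) = 0 ∧ (v : ℕ) + 1 = k ∧ 1 < k) := by
  rw [SimpleGraph.cycleGraph_adj', Fin.sub_val_of_le h.le, Fin.coe_sub_iff_lt.2 h]
  have hu := u.2
  have hv := v.2
  have h' : (u : ℕ) < v := h
  omega

/-- With x = f 0 on an induced cycle f, the rest of the cycle leads from f 1 to f (k - 1) and its
interior avoids the closed neighbourhood of x. For k ≥ 4 these two ends are neither equal nor
adjacent. -/
theorem HoleFree.isChordal {H : SimpleGraph V} (hH : HoleFree H) : IsChordal H := by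
  intro k hk
  refine ⟨fun f => ?_⟩
  have hadj : ∀ i j (hi : i < j) (hj : j < k), H.Adj (f ⟨i, hi.trans hj⟩) (f ⟨j, hj⟩) ↔
      j = i + 1 ∨ (i = 0 ∧ j + 1 = k) := by
    intro i j hi hj
    rw [f.map_adj_iff, cycleGraph_adj_of_lt (by simpa using hi)]
    simp only
    omega
  have hne : ∀ i j (hi : i < j) (hj : j < k), f ⟨i, hi.trans hj⟩ ≠ f ⟨j, hj⟩ := by
    intro i j hi hj h
    have := f.injective h
    simp only [Fin.mk.injEq] at this
    omega
  have hchain : ∀ i (hi : i + 3 ≤ k), ReflTransGen (OffStep H (f ⟨0, by omega⟩))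
      (f ⟨1, by omega⟩) (f ⟨i + 1, by omega⟩) := by
    intro i
    induction i with
    | zero => intro _; exact .refl
    | succ i ih =>
      intro hi
      refine (ih (by omega)).tail ⟨?_, ?_, ?_⟩
      · rw [hadj (i + 1) (i + 1 + 1) (by omega)]; omega
      · rw [hadj 0 (i + 1 + 1) (by omega)]; omega
      · exact (hne 0 (i + 1 + 1) (by omega) (by omega)).symm
  obtain ⟨m, rfl⟩ : ∃ m, k = m + 4 := ⟨k - 4, by omega⟩
  rcases hH (f ⟨0, by omega⟩) (f ⟨1, by omega⟩) (f ⟨m + 3, by omega⟩) (f ⟨m + 1 + 1, by omega⟩)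
    ((hadj 0 1 (by omega) (by omega)).2 (by omega))
    ((hadj 0 (m + 3) (by omega) (by omega)).2 (by omega))
    (hchain (m + 1) (by omega)) ((hadj (m + 1 + 1) (m + 3) (by omega) (by omega)).2 (by omega))
    with h | h
  · exact hne 1 (m + 3) (by omega) (by omega) h
  · rw [hadj 1 (m + 3) (by omega) (by omega)] at h
    omega

/-- A walk of length `m` from `a` to `b` whose interior avoids the closed neighbourhood of `x`. -/
def IsOffWalk (H : SimpleGraph V) (x a b : V) (m : ℕ) (p : ℕ → V) : Prop :=
  p 0 = a ∧ p m = b ∧ (∀ i < m, H.Adj (p i) (p (i + 1))) ∧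
    ∀ i, 0 < i → i < m → ¬ H.Adj x (p i) ∧ p i ≠ x

theorem exists_isOffWalk {H : SimpleGraph V} {x a b c : V}
    (h : ReflTransGen (OffStep H x) a c) (hb : H.Adj c b) : ∃ m p, IsOffWalk H x a b m p := by
  induction h generalizing b with
  | refl =>
    refine ⟨1, fun i => if i = 0 then a else b, rfl, rfl, fun i hi => ?_, fun i _ _ => by omega⟩
    obtain rfl : i = 0 := by omega
    simpa using hb
  | @tail c d h1 h2 ih =>
    obtain ⟨m, p, h0, hm, hadj, hoff⟩ := ih h2.1
    refine ⟨m + 1, fun i => if i ≤ m then p i else b, by simpa using h0, by simp, fun i hi => ?_,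
      fun i hi him => ?_⟩
    · rcases Nat.lt_or_ge i m with h | h
      · simpa [h.le, Nat.succ_le_of_lt h] using hadj i h
      · obtain rfl : i = m := by omega
        simpa [hm] using hb
    · rcases Nat.lt_or_ge i m with h | h
      · simpa [h.le] using hoff i hi h
      · obtain rfl : i = m := by omega
        simpa [hm] using h2.2

/-- If a and b are distinct and non-adjacent, take a shortest walk between them off x. A chord or a
repeated vertex would shorten it, so together with x it is an induced cycle; it has length m + 2
with m ≥ 2. -/
theorem IsChordal.holeFree {H : SimpleGraph V} (hH : IsChordal H) : HoleFree H := by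
  classical
  intro x a b c hxa hxb hac hcb
  by_contra hcon
  push Not at hcon
  obtain ⟨hab, hnab⟩ := hcon
  have hex := exists_isOffWalk hac hcb
  set m := Nat.find hex with hm
  obtain ⟨p, h0, hmb, hadj, hoff⟩ := Nat.find_spec hex
  rw [← hm] at hmb hadj hoff
  have hmin : ∀ k q, IsOffWalk H x a b k q → m ≤ k := fun k q h => Nat.find_min' hex ⟨q, h⟩
  have hm2 : 2 ≤ m := by
    rcases Nat.lt_or_ge m 2 with h | h
    · interval_cases m
      · exact absurd (h0.symm.trans hmb) hab
      · have := hadj 0 (by omega)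
        rw [h0, zero_add, hmb] at this
        exact absurd this hnab
    · exact h
  have hshort : ∀ i j, i + 2 ≤ j → j ≤ m → ¬ H.Adj (p i) (p j) := by
    intro i j hij hj h
    have := hmin (m - (j - i - 1)) (fun t => if t ≤ i then p t else p (t + (j - i - 1)))
      ⟨by simpa using h0, ?_, fun t ht => ?_, fun t ht0 ht => ?_⟩
    · omega
    · simp only [show ¬ (m - (j - i - 1) ≤ i) by omega, if_false]
      rw [show m - (j - i - 1) + (j - i - 1) = m by omega, hmb]
    · rcases lt_trichotomy t i with h' | h' | h'
      · simpa [h'.le, Nat.succ_le_of_lt h'] using hadj t (by omega)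
      · subst h'
        simpa [show t + 1 + (j - t - 1) = j by omega] using h
      · simp only [show ¬ (t ≤ i) by omega, show ¬ (t + 1 ≤ i) by omega, if_false]
        rw [show t + 1 + (j - i - 1) = t + (j - i - 1) + 1 by omega]
        exact hadj _ (by omega)
    · dsimp only
      split_ifs
      · exact hoff t ht0 (by omega)
      · exact hoff _ (by omega) (by omega)
  have hinj : ∀ i j, i < j → j ≤ m → p i ≠ p j := by
    intro i j hij hj h
    have := hmin (m - (j - i)) (fun t => if t ≤ i then p t else p (t + (j - i)))
      ⟨by simpa using h0, ?_, fun t ht => ?_, fun t ht0 ht => ?_⟩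
    · omega
    · dsimp only
      split_ifs with h'
      · rw [show m - (j - i) = i by omega, h, show j = m by omega, hmb]
      · rw [show m - (j - i) + (j - i) = m by omega, hmb]
    · rcases lt_trichotomy t i with h' | h' | h'
      · simpa [h'.le, Nat.succ_le_of_lt h'] using hadj t (by omega)
      · subst h'
        simp only [le_refl, if_true, show ¬ (t + 1 ≤ t) by omega, if_false]
        rw [show t + 1 + (j - t) = j + 1 by omega, h]
        exact hadj _ (by omega)
      · simp only [show ¬ (t ≤ i) by omega, show ¬ (t + 1 ≤ i) by omega, if_false]
        rw [show t + 1 + (j - i) = t + (j - i) + 1 by omega]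
        exact hadj _ (by omega)
    · dsimp only
      split_ifs
      · exact hoff t ht0 (by omega)
      · exact hoff _ (by omega) (by omega)
  have hpx : ∀ i ≤ m, p i ≠ x := by
    intro i hi
    rcases Nat.eq_zero_or_pos i with h | h
    · subst h; rw [h0]; exact hxa.ne'
    · rcases hi.eq_or_lt with h' | h'
      · rw [h', hmb]; exact hxb.ne'
      · exact (hoff i h h').2
  -- Position 0 of the cycle is x, and position i ≥ 1 is the vertex p (i - 1) of the walk, which has
  -- m + 1 vertices.
  let f : Fin (m + 2) → V := fun i => if (i : ℕ) = 0 then x else p (i - 1)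
  have hf0 : ∀ i : Fin (m + 2), (i : ℕ) = 0 → f i = x := fun i hi => if_pos hi
  have hf1 : ∀ i : Fin (m + 2), (i : ℕ) ≠ 0 → f i = p (i - 1) := fun i hi => if_neg hi
  have hlt : ∀ u v : Fin (m + 2), u < v → f u ≠ f v ∧
      (H.Adj (f u) (f v) ↔ (SimpleGraph.cycleGraph (m + 2)).Adj u v) := by
    intro u v huv
    have huv' : (u : ℕ) < v := huv
    have hv := v.2
    rw [cycleGraph_adj_of_lt huv, hf1 v (by omega)]
    by_cases hu : (u : ℕ) = 0
    · rw [hf0 u hu]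
      refine ⟨(hpx _ (by omega)).symm, ?_⟩
      rcases Nat.lt_or_ge 1 (v : ℕ) with h1 | h1
      · rcases Nat.lt_or_ge (v : ℕ) (m + 1) with h2 | h2
        · have := (hoff (v - 1) (by omega) (by omega)).1
          simp only [this, false_iff]
          omega
        · rw [show (v : ℕ) - 1 = m by omega, hmb]
          simp only [hxb, true_iff]
          omega
      · rw [show (v : ℕ) - 1 = 0 by omega, h0]
        simp only [hxa, true_iff]
        omega
    · rw [hf1 u hu]
      refine ⟨hinj _ _ (by omega) (by omega), ?_⟩
      rcases Nat.lt_or_ge ((u : ℕ) + 1) v with h1 | h1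
      · have := hshort (u - 1) (v - 1) (by omega) (by omega)
        simp only [this, false_iff]
        omega
      · have := hadj (u - 1) (by omega)
        rw [show (u : ℕ) - 1 + 1 = v - 1 by omega] at this
        simp only [this, true_iff]
        omega
  refine (hH (m + 2) (by omega)).false ⟨⟨f, fun u v huv => ?_⟩, fun {u v} => ?_⟩
  · rcases lt_trichotomy u v with h | h | h
    · exact absurd huv (hlt u v h).1
    · exact h
    · exact absurd huv.symm (hlt v u h).1
  · change H.Adj (f u) (f v) ↔ _
    rcases lt_trichotomy u v with h | h | h
    · exact (hlt u v h).2
    · subst h; simp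
    · rw [H.adj_comm, (SimpleGraph.cycleGraph (m + 2)).adj_comm]
      exact (hlt v u h).2

theorem isChordal_iff_holeFree {H : SimpleGraph V} : IsChordal H ↔ HoleFree H :=
  ⟨IsChordal.holeFree, HoleFree.isChordal⟩

/-- Cut the walk at its last vertex w adjacent to p. As r never enters p, the remainder avoids the
closed neighbourhood of p, so `HoleFree` can be applied with centre p. Unless w = a, an r-step
enters w, so w inherits whatever r demands of the vertices it enters. -/
theorem exists_last_nbr {H : SimpleGraph V} {r : V → V → Prop} (hr : ∀ u v, r u v → H.Adj u v)
    {p a c : V} (hrp : ∀ u, ¬ r u p) (hpa : H.Adj p a) (h : ReflTransGen r a c) :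
    ∃ w, (w = a ∨ ∃ u, r u w) ∧ H.Adj p w ∧ ReflTransGen (OffStep H p) w c := by
  induction h with
  | refl => exact ⟨a, .inl rfl, hpa, .refl⟩
  | @tail c d _ h2 ih =>
    by_cases hd : H.Adj p d
    · exact ⟨d, .inr ⟨c, h2⟩, hd, .refl⟩
    · obtain ⟨w, h, h', h''⟩ := ih
      exact ⟨w, h, h', h''.tail ⟨hr _ _ h2, hd, fun h => hrp c (h ▸ h2)⟩⟩

theorem exists_reverse_walk {H : SimpleGraph V} {z a b c : V}
    (h : ReflTransGen (OffStep H z) a c) (hcb : H.Adj c b) :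
    ∃ c', ReflTransGen (OffStep H z) b c' ∧ H.Adj c' a := by
  induction h generalizing b with
  | refl => exact ⟨b, .refl, hcb.symm⟩
  | tail _ h2 ih =>
    obtain ⟨c', h, h'⟩ := ih h2.1
    exact ⟨c', h.head ⟨hcb.symm, h2.2⟩, h'⟩

/-! ### Deleting an edge. -/

/-- The common neighbours of `x` and `y` are pairwise adjacent. -/
def CommonClique (H : SimpleGraph V) (x y : V) : Prop :=
  ∀ u v, H.Adj x u → H.Adj y u → H.Adj x v → H.Adj y v → u ≠ v → H.Adj u v

theorem CommonClique.symm {H : SimpleGraph V} {x y : V} (h : CommonClique H x y) :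
    CommonClique H y x :=
  fun _ _ h1 h2 h3 h4 => h _ _ h2 h1 h4 h3

/-- The centre is an end of the deleted edge. Since y is no longer a neighbour of x, the walk may
pass through y. If it does, hole-freeness of H at x makes y adjacent to both a and b, so these are
common neighbours of x and y and the clique condition applies. -/
theorem HoleFree.delete_aux₁ {H : SimpleGraph V} (hH : HoleFree H) {x y : V} (hxy : H.Adj x y)
    (hc : CommonClique H x y) {a b c : V} (hxa : (H.deleteEdges {s(x, y)}).Adj x a)
    (hxb : (H.deleteEdges {s(x, y)}).Adj x b)
    (hac : ReflTransGen (OffStep (H.deleteEdges {s(x, y)}) x) a c)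
    (hcb : (H.deleteEdges {s(x, y)}).Adj c b) :
    a = b ∨ (H.deleteEdges {s(x, y)}).Adj a b := by
  have hdel : ∀ u v, (H.deleteEdges {s(x, y)}).Adj u v ↔ H.Adj u v ∧ s(u, v) ≠ s(x, y) := by
    intro u v; simp [SimpleGraph.deleteEdges_adj]
  -- The second alternative keeps only the part of the walk after its last visit to y.
  have key : ReflTransGen (OffStep H x) a c ∨ (H.Adj a y ∧ ReflTransGen (OffStep H x) y c) := by
    clear hcb
    induction hac with
    | refl => exact .inl .refl
    | @tail c d _ h2 ih =>
      obtain ⟨hcd, hxd, hdx⟩ := h2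
      by_cases hdy : d = y
      · subst hdy
        refine .inr ⟨?_, .refl⟩
        rcases ih with ih | ih
        · rcases hH x a d c ((hdel _ _).1 hxa).1 hxy ih ((hdel _ _).1 hcd).1 with h | h
          · subst h; exact absurd rfl ((hdel _ _).1 hxa).2
          · exact h
        · exact ih.1
      · have hxd' : ¬ H.Adj x d := fun h => hxd ((hdel _ _).2 ⟨h, by simp [hdy, hdx]⟩)
        rcases ih with ih | ih
        · exact .inl (ih.tail ⟨((hdel _ _).1 hcd).1, hxd', hdx⟩)
        · exact .inr ⟨ih.1, ih.2.tail ⟨((hdel _ _).1 hcd).1, hxd', hdx⟩⟩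
  have hax := hxa.ne'
  have hbx := hxb.ne'
  rw [hdel] at hxa hxb hcb
  have hfin : a = b ∨ H.Adj a b := by
    rcases key with h | ⟨hay, h⟩
    · exact hH x a b c hxa.1 hxb.1 h hcb.1
    · rcases hH x y b c hxy hxb.1 h hcb.1 with h | h
      · subst h; exact absurd rfl hxb.2
      · by_cases hab : a = b
        · exact .inl hab
        · exact .inr (hc a b hxa.1 hay.symm hxb.1 h hab)
  refine hfin.imp_right fun h => (hdel _ _).2 ⟨h, ?_⟩
  simp [hax, hbx]

/-- The deleted edge joins the two neighbours a and b of the centre z. On a remaining walk off z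
take the last neighbour w of a. Hole-freeness at a gives w = b or w adjacent to b. The first is
impossible because w is off z; in the second, z and w are common neighbours of a and b, hence
adjacent, again a contradiction. -/
theorem HoleFree.delete_aux₂ {H : SimpleGraph V} (hH : HoleFree H) {a b z c : V}
    (hab : H.Adj a b) (hc : CommonClique H a b) (hza : H.Adj z a) (hzb : H.Adj z b)
    (hac : ReflTransGen (OffStep (H.deleteEdges {s(a, b)}) z) a c)
    (hcb : (H.deleteEdges {s(a, b)}).Adj c b) : False := by
  have hdel : ∀ u v, (H.deleteEdges {s(a, b)}).Adj u v ↔ H.Adj u v ∧ s(u, v) ≠ s(a, b) := by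
    intro u v; simp [SimpleGraph.deleteEdges_adj]
  rcases ReflTransGen.cases_head hac with h | ⟨d, had, hdc⟩
  · subst h; exact ((hdel _ _).1 hcb).2 rfl
  · have hzdel : ∀ v, H.Adj z v → (H.deleteEdges {s(a, b)}).Adj z v := by
      intro v h
      refine (hdel _ _).2 ⟨h, ?_⟩
      simp [hza.ne, hzb.ne]
    obtain ⟨w, hw, haw, hwc⟩ := exists_last_nbr (H := H) (p := a)
      (fun u v h => ((hdel u v).1 h.1).1) (fun u h => h.2.1 (hzdel a hza))
      ((hdel _ _).1 had.1).1 hdc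
    have hwz : ¬ H.Adj z w ∧ w ≠ z := by
      rcases hw with rfl | ⟨u, hu⟩
      · exact ⟨fun h => had.2.1 (hzdel _ h), had.2.2⟩
      · exact ⟨fun h => hu.2.1 (hzdel _ h), hu.2.2⟩
    rcases hH a w b c haw hab hwc ((hdel _ _).1 hcb).1 with h | h
    · subst h; exact hwz.1 hzb
    · exact hwz.1 (hc z w hza.symm hzb.symm haw h.symm hwz.2.symm)

/-- A centre other than x and y keeps its neighbours, so its walks are already walks off it in H.
Only the resulting edge ab can be lost, namely when it is the deleted one, and then
`HoleFree.delete_aux₂` excludes the walk. -/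
theorem HoleFree.deleteEdge {H : SimpleGraph V} (hH : HoleFree H) {x y : V} (hxy : H.Adj x y)
    (hc : CommonClique H x y) : HoleFree (H.deleteEdges {s(x, y)}) := by
  intro z a b c hza hzb hac hcb
  by_cases hzx : z = x
  · subst hzx; exact hH.delete_aux₁ hxy hc hza hzb hac hcb
  by_cases hzy : z = y
  · subst hzy
    rw [Sym2.eq_swap] at *
    exact hH.delete_aux₁ hxy.symm hc.symm hza hzb hac hcb
  have hdel : ∀ u v, (H.deleteEdges {s(x, y)}).Adj u v ↔ H.Adj u v ∧ s(u, v) ≠ s(x, y) := by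
    intro u v; simp [SimpleGraph.deleteEdges_adj]
  have hz : ∀ v, (H.deleteEdges {s(x, y)}).Adj z v ↔ H.Adj z v := by
    intro v; rw [hdel]; simp [hzx, hzy]
  have hac' : ReflTransGen (OffStep H z) a c :=
    ReflTransGen.mono (fun u v h => ⟨((hdel u v).1 h.1).1, by rw [← hz]; exact h.2.1, h.2.2⟩) _ _ hac
  rw [hz] at hza hzb
  rcases hH z a b c hza hzb hac' ((hdel _ _).1 hcb).1 with h | h
  · exact .inl h
  · by_cases he : s(a, b) = s(x, y)
    · exfalso
      rw [← he] at hac hcb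
      refine hH.delete_aux₂ h ?_ hza hzb hac hcb
      rcases Sym2.eq_iff.1 he with ⟨rfl, rfl⟩ | ⟨rfl, rfl⟩
      · exact hc
      · exact hc.symm
    · exact .inr ((hdel _ _).2 ⟨h, he⟩)

/-- Once xy is deleted, y is off x, so non-adjacent u and v would leave the chordless four-cycle x,
u, y, v. -/
theorem HoleFree.commonClique {H : SimpleGraph V} {x y : V} (hxy : H.Adj x y)
    (hH : HoleFree (H.deleteEdges {s(x, y)})) : CommonClique H x y := by
  intro u v hxu hyu hxv hyv huv
  have hdel : ∀ u v, (H.deleteEdges {s(x, y)}).Adj u v ↔ H.Adj u v ∧ s(u, v) ≠ s(x, y) := by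
    intro u v; simp [SimpleGraph.deleteEdges_adj]
  have h1 : ∀ w, H.Adj x w → H.Adj y w → (H.deleteEdges {s(x, y)}).Adj x w ∧
      (H.deleteEdges {s(x, y)}).Adj y w := by
    intro w hx hy
    rw [hdel, hdel]
    simp [hx, hy, hx.ne', hy.ne']
  rcases hH x u v y (h1 u hxu hyu).1 (h1 v hxv hyv).1
    (.single ⟨(h1 u hxu hyu).2.symm, by simp, hxy.ne'⟩) (h1 v hxv hyv).2 with h | h
  · exact absurd h huv
  · exact ((hdel _ _).1 h).1

/-! ### Filling the common neighbourhood, and flips. -/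

/-- Turning the common neighbourhood of `x` and `y` into a clique. -/
def fillCommon (H : SimpleGraph V) (x y : V) : SimpleGraph V where
  Adj u v := H.Adj u v ∨ (u ≠ v ∧ (H.Adj x u ∧ H.Adj y u) ∧ H.Adj x v ∧ H.Adj y v)
  symm := ⟨fun _ _ h => h.imp (fun h => h.symm) fun h => ⟨h.1.symm, h.2.2, h.2.1⟩⟩
  loopless := ⟨fun _ h => h.elim (fun h => h.ne rfl) fun h => h.1 rfl⟩

/-- Here a and z are non-adjacent common neighbours of x and y, and a walk off z leads from a to a
neighbour b of z. For p = x or p = y, if b were neither p nor adjacent to p, then from the last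
neighbour of p on the walk one could continue through b to z, and hole-freeness at p would make that
vertex equal or adjacent to z. So b is itself a common neighbour, or is x or y, and the filled graph
has the edge ab unless a = b. -/
theorem HoleFree.fillCommon_aux {H : SimpleGraph V} (hH : HoleFree H) {x y z a b c : V}
    (hxa : H.Adj x a) (hya : H.Adj y a) (hxz : H.Adj x z) (hyz : H.Adj y z) (hza : ¬ H.Adj z a)
    (haz : a ≠ z) (hzb : H.Adj z b) (hac : ReflTransGen (OffStep H z) a c) (hcb : H.Adj c b) :
    a = b ∨ (fillCommon H x y).Adj a b := by
  have key : ∀ p, H.Adj p a → H.Adj p z → b ≠ p → H.Adj p b := by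
    intro p hpa hpz hbp
    by_contra hpb
    obtain ⟨w, hw, hpw, hwc⟩ := exists_last_nbr (H := H) (r := OffStep H z) (p := p)
      (fun _ _ h => h.1) (fun _ h => h.2.1 hpz.symm) hpa hac
    have hwz : ¬ H.Adj z w ∧ w ≠ z := by
      rcases hw with rfl | ⟨u, hu⟩
      · exact ⟨hza, haz⟩
      · exact hu.2
    rcases hH p w z b hpw hpz (hwc.tail ⟨hcb, hpb, hbp⟩) hzb.symm with h | h
    · exact hwz.2 h
    · exact hwz.1 h.symm
  by_cases hbx : b = x
  · subst hbx; exact .inr (.inl hxa.symm)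
  by_cases hby : b = y
  · subst hby; exact .inr (.inl hya.symm)
  by_cases hab : a = b
  · exact .inl hab
  · exact .inr (.inr ⟨hab, ⟨hxa, hya⟩, key x hxa hxz hbx, key y hya hyz hby⟩)

/-- Let D be the common neighbourhood of x and y. If the centre z is in D or is x or y, all of D
lies in its new closed neighbourhood, so walks off z use no new edge. For any other z the walks may
use new edges, and these are replaced by detours in H. -/
theorem HoleFree.fillCommon {H : SimpleGraph V} (hH : HoleFree H) (x y : V) :
    HoleFree (fillCommon H x y) := by
  intro z a b c hza hzb hac hcb
  by_cases hca : c = a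
  · subst hca; exact .inr hcb
  have hcz : ¬ (ChordalEnum.fillCommon H x y).Adj z c ∧ c ≠ z := by
    rcases ReflTransGen.cases_tail hac with h | ⟨d, _, h⟩
    · exact absurd h hca
    · exact h.2
  have hstepz : (∀ v, H.Adj x v → H.Adj y v → (ChordalEnum.fillCommon H x y).Adj z v ∨ v = z) →
      ReflTransGen (OffStep H z) a c ∧ H.Adj c b := by
    intro hD
    have hout : ∀ v, ¬ (ChordalEnum.fillCommon H x y).Adj z v ∧ v ≠ z →
        ¬ (H.Adj x v ∧ H.Adj y v) :=
      fun v hv h => (hD v h.1 h.2).elim hv.1 hv.2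
    exact ⟨ReflTransGen.mono (fun u v h => ⟨h.1.resolve_right fun h' => hout v h.2 h'.2.2,
      fun h' => h.2.1 (.inl h'), h.2.2⟩) _ _ hac, hcb.resolve_right fun h' => hout c hcz h'.2.1⟩
  by_cases hzD : H.Adj x z ∧ H.Adj y z
  · obtain ⟨hac', hcb'⟩ := hstepz fun v hx hy => by
      by_cases hvz : v = z
      · exact .inr hvz
      · exact .inl (.inr ⟨fun h => hvz h.symm, hzD, hx, hy⟩)
    by_cases hza' : H.Adj z a
    · by_cases hzb' : H.Adj z b
      · exact (hH z a b c hza' hzb' hac' hcb').imp_right .inl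
      · obtain ⟨_, _, hb1, hb2⟩ := hzb.resolve_left hzb'
        obtain ⟨c', h1, h2⟩ := exists_reverse_walk hac' hcb'
        exact (hH.fillCommon_aux hb1 hb2 hzD.1 hzD.2 hzb' hzb.ne' hza' h1 h2).imp Eq.symm
          fun h => h.symm
    · obtain ⟨_, _, ha1, ha2⟩ := hza.resolve_left hza'
      by_cases hzb' : H.Adj z b
      · exact hH.fillCommon_aux ha1 ha2 hzD.1 hzD.2 hza' hza.ne' hzb' hac' hcb'
      · obtain ⟨_, _, hb1, hb2⟩ := hzb.resolve_left hzb'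
        by_cases hab : a = b
        · exact .inl hab
        · exact .inr (.inr ⟨hab, ⟨ha1, ha2⟩, hb1, hb2⟩)
  · have hzN : ∀ v, (ChordalEnum.fillCommon H x y).Adj z v ↔ H.Adj z v :=
      fun v => ⟨fun h => h.resolve_right fun h => hzD h.2.1, .inl⟩
    rw [hzN] at hza hzb
    by_cases hzxy : z = x ∨ z = y
    · obtain ⟨hac', hcb'⟩ := hstepz fun v hx hy => by
        rcases hzxy with rfl | rfl
        · exact .inl (.inl hx)
        · exact .inl (.inl hy)
      exact (hH z a b c hza hzb hac' hcb').imp_right .inl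
    -- As z is not in D, it misses x or y; call this vertex p. A new edge uv of the walk becomes the
    -- detour u, p, v, whose middle vertex is off z.
    · obtain ⟨p, hp, hpz, hpz'⟩ : ∃ p, (∀ v, H.Adj x v → H.Adj y v → H.Adj p v) ∧
          ¬ H.Adj z p ∧ p ≠ z := by
        push Not at hzxy
        by_cases hx : H.Adj x z
        · exact ⟨y, fun v _ h => h, fun h => hzD ⟨hx, h.symm⟩, hzxy.2.symm⟩
        · exact ⟨x, fun v h _ => h, fun h => hx h.symm, hzxy.1.symm⟩
      have hac' : ReflTransGen (OffStep H z) a c := by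
        refine ReflTransGen.lift' id (fun u v h => ?_) _ _ hac
        have h2 : ¬ H.Adj z v ∧ v ≠ z := ⟨fun h' => h.2.1 (.inl h'), h.2.2⟩
        rcases h.1 with h1 | ⟨_, hu, hv⟩
        · exact .single ⟨h1, h2⟩
        · exact .head (b := p) ⟨(hp u hu.1 hu.2).symm, hpz, hpz'⟩
            (.single ⟨hp v hv.1 hv.2, h2⟩)
      rcases hcb with h | ⟨_, hu, hv⟩
      · exact (hH z a b c hza hzb hac' h).imp_right .inl
      · exact (hH z a b p hza hzb (hac'.tail ⟨(hp c hu.1 hu.2).symm, hpz, hpz'⟩)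
          (hp b hv.1 hv.2)).imp_right .inl

/-- A flip is a fill followed by a deletion. The fill adds no edge at x that leads to a common
neighbour, because neither x nor y is its own neighbour; so the common neighbourhood stays the same,
is now a clique, and the edge may be deleted. -/
theorem HoleFree.flipGraph {H : SimpleGraph V} (hH : HoleFree H) {x y : V} (hxy : H.Adj x y) :
    HoleFree (flipGraph H s(x, y)) := by
  have hN : ∀ u, (ChordalEnum.fillCommon H x y).Adj x u →
      (ChordalEnum.fillCommon H x y).Adj y u → H.Adj x u ∧ H.Adj y u := by
    intro u h1 h2
    exact ⟨h1.resolve_right fun h => h.2.1.1.ne rfl, h2.resolve_right fun h => h.2.1.2.ne rfl⟩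
  have h := (hH.fillCommon x y).deleteEdge (x := x) (y := y) (.inl hxy)
    (fun u v h1 h2 h3 h4 h5 => .inr ⟨h5, hN u h1 h2, hN v h3 h4⟩)
  convert h using 1
  ext u v
  simp only [ChordalEnum.flipGraph, SimpleGraph.sup_adj, SimpleGraph.deleteEdges_adj,
    SimpleGraph.fromEdgeSet_adj, Set.mem_ofPred_eq, Sym2.mem_iff, Set.mem_singleton_iff,
    forall_eq_or_imp, forall_eq, ChordalEnum.fillCommon]
  constructor
  · rintro (⟨h1, h2⟩ | ⟨h1, h2⟩)
    · exact ⟨.inl h1, h2⟩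
    · refine ⟨.inr ⟨h2, h1.1, h1.2⟩, fun h => ?_⟩
      rcases Sym2.eq_iff.1 h with ⟨rfl, rfl⟩ | ⟨rfl, rfl⟩
      · exact h1.1.1.ne rfl
      · exact h1.2.1.ne rfl
  · rintro ⟨h1 | h1, h2⟩
    · exact .inl ⟨h1, h2⟩
    · exact .inr ⟨h1.2, h1.1⟩

theorem holeFree_top : HoleFree (⊤ : SimpleGraph V) := by
  intro x a b c _ _ _ _
  by_cases h : a = b
  · exact .inl h
  · exact .inr h

/-! ### Simplicial vertices and removable edges. -/

/-- Every clique other than the whole of `U` misses a vertex that is simplicial in `H[U]`. -/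
theorem HoleFree.exists_simplicial {H : SimpleGraph V} (hH : HoleFree H) (U : Finset V) :
    ∀ K ⊆ U, K ≠ U → (∀ u ∈ K, ∀ v ∈ K, u ≠ v → H.Adj u v) →
      ∃ v ∈ U, v ∉ K ∧ ∀ a ∈ U, ∀ b ∈ U, H.Adj v a → H.Adj v b → a ≠ b → H.Adj a b := by
  classical
  induction U using Finset.strongInduction with
  | H U ih =>
  intro K hKU hK hclique
  obtain ⟨w₀, hw₀, hw₀K⟩ := Finset.exists_of_ssubset (hKU.ssubset_of_ne hK)
  -- The condition on v says that v is in K unless K is empty. If such a v misses some w, split off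
  -- the component C of w outside the closed neighbourhood of v. Otherwise K is joined to everything
  -- in U, or K is empty and U is a clique.
  by_cases hcase : ∃ v ∈ U, (∀ k ∈ K, v ∈ K) ∧ ∃ w ∈ U, w ≠ v ∧ ¬ H.Adj v w
  · obtain ⟨v, hv, hvK, w, hw, hwv, hvw⟩ := hcase
    let r : V → V → Prop := fun s t => OffStep H v s t ∧ t ∈ U
    have hoff : ∀ c, ReflTransGen r w c → (¬ H.Adj v c ∧ c ≠ v) ∧ c ∈ U ∧ ReflTransGen r c w := by
      intro c hc
      induction hc with
      | refl => exact ⟨⟨hvw, hwv⟩, hw, .refl⟩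
      | tail _ h ih => exact ⟨h.1.2, h.2, ih.2.2.head ⟨⟨h.1.1.symm, ih.1⟩, ih.2.1⟩⟩
    have hr : ∀ {s t}, ReflTransGen r s t → ReflTransGen (OffStep H v) s t :=
      fun h => ReflTransGen.mono (fun _ _ h => h.1) _ _ h
    let C := U.filter fun c => ReflTransGen r w c
    let S := U.filter fun s => s ∉ C ∧ ∃ c ∈ C, H.Adj c s
    have hC : ∀ c, c ∈ C ↔ ReflTransGen r w c :=
      fun c => ⟨fun h => (Finset.mem_filter.1 h).2,
        fun h => Finset.mem_filter.2 ⟨(hoff c h).2.1, h⟩⟩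
    have hS : ∀ s, s ∈ S ↔ s ∈ U ∧ s ∉ C ∧ ∃ c ∈ C, H.Adj c s := fun s => Finset.mem_filter
    have hSv : ∀ s ∈ S, H.Adj v s := by
      intro s hs
      obtain ⟨hsU, hsC, c, hc, hcs⟩ := (hS s).1 hs
      by_contra hvs
      refine hsC ((hC s).2 (((hC c).1 hc).tail ⟨⟨hcs, hvs, ?_⟩, hsU⟩))
      rintro rfl
      exact (hoff c ((hC c).1 hc)).1.1 hcs.symm
    have hvC : v ∉ C := fun h => (hoff v ((hC v).1 h)).1.2 rfl
    -- The boundary S of C consists of neighbours of v, and any two of them are joined through C, so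
    -- S is a clique by hole-freeness at v. A simplicial vertex of C ∪ S outside S lies in C, has
    -- all its neighbours from U in C ∪ S, and is not adjacent to v.
    obtain ⟨z, hz, hzS, hzs⟩ := ih (C ∪ S) (by
        refine Finset.ssubset_iff_subset_ne.2 ⟨Finset.union_subset (Finset.filter_subset _ _)
          (Finset.filter_subset _ _), fun h => ?_⟩
        rw [← h, Finset.mem_union] at hv
        exact hv.elim hvC fun h => (hSv v h).ne rfl) S Finset.subset_union_right
      (fun h => ((hS w).1 (h ▸ Finset.mem_union_left _ ((hC w).2 .refl))).2.1
        ((hC w).2 .refl)) (by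
        intro s hs t ht hst
        obtain ⟨_, _, c, hc, hcs⟩ := (hS s).1 hs
        obtain ⟨_, _, d, hd, hdt⟩ := (hS t).1 ht
        rw [hC] at hc hd
        refine (hH v s t d (hSv s hs) (hSv t ht) ?_ hdt).resolve_left hst
        exact ((hr (hoff c hc).2.2).trans (hr hd)).head ⟨hcs.symm, (hoff c hc).1⟩)
    have hzC : z ∈ C := (Finset.mem_union.1 hz).resolve_right hzS
    have hzoff := (hoff z ((hC z).1 hzC)).1
    refine ⟨z, (hoff z ((hC z).1 hzC)).2.1, fun h => ?_, fun a ha b hb hza hzb hab => ?_⟩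
    · exact hzoff.1 (hclique v (hvK z h) z h hzoff.2.symm)
    · have hmem : ∀ a ∈ U, H.Adj z a → a ∈ C ∪ S := by
        intro a ha hza
        by_cases haC : a ∈ C
        · exact Finset.mem_union_left _ haC
        · exact Finset.mem_union_right _ ((hS a).2 ⟨ha, haC, z, hzC, hza⟩)
      exact hzs a (hmem a ha hza) b (hmem b hb hzb) hza hzb hab
  · push Not at hcase
    rcases K.eq_empty_or_nonempty with rfl | ⟨k, hk⟩
    · exact ⟨w₀, hw₀, hw₀K, fun a ha b hb _ _ hab => hcase a ha (by simp) b hb hab.symm⟩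
    · have huniv : ∀ a ∈ K, ∀ b ∈ U, a ≠ b → H.Adj a b :=
        fun a ha b hb hab => hcase a (hKU ha) (fun _ _ => ha) b hb hab.symm
      obtain ⟨z, hz, _, hzs⟩ := ih (U \ K) (Finset.sdiff_ssubset hKU ⟨k, hk⟩) ∅ (by simp)
        (fun h => by
          have := Finset.mem_sdiff.2 ⟨hw₀, hw₀K⟩
          rw [← h] at this
          simp at this) (by simp)
      rw [Finset.mem_sdiff] at hz
      refine ⟨z, hz.1, hz.2, fun a ha b hb hza hzb hab => ?_⟩
      by_cases haK : a ∈ K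
      · exact huniv a haK b hb hab
      · by_cases hbK : b ∈ K
        · exact (huniv b hbK a ha hab.symm).symm
        · exact hzs a (Finset.mem_sdiff.2 ⟨ha, haK⟩) b (Finset.mem_sdiff.2 ⟨hb, hbK⟩) hza hzb hab

/-- If `G ⊆ H` are chordal and differ on `U`, some edge of `H` outside `G` can be deleted. -/
theorem HoleFree.exists_removable_on {G H : SimpleGraph V} (hG : HoleFree G) (hH : HoleFree H)
    (hGH : G ≤ H) (U : Finset V) : (∃ a ∈ U, ∃ b ∈ U, H.Adj a b ∧ ¬ G.Adj a b) →
      ∃ x y, H.Adj x y ∧ ¬ G.Adj x y ∧ x ∈ U ∧ y ∈ U ∧ ∀ u ∈ U, ∀ v ∈ U,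
        H.Adj x u → H.Adj y u → H.Adj x v → H.Adj y v → u ≠ v → H.Adj u v := by
  classical
  induction U using Finset.strongInduction with
  | H U ih =>
  rintro ⟨a, ha, b, hb, hab, hnab⟩
  obtain ⟨v, hvU, -, hv⟩ := hG.exists_simplicial U ∅ (by simp)
    (fun h => by rw [← h] at ha; simp at ha) (by simp)
  -- Here v is simplicial in G[U]. If G and H agree at v, then v can be dropped; otherwise the
  -- removable edge is found at v.
  by_cases hcase : ∀ u ∈ U, H.Adj v u → G.Adj v u
  · have hne : ∀ a ∈ U, ∀ b ∈ U, H.Adj a b → ¬ G.Adj a b → a ≠ v := by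
      rintro a - b hb hab hnab rfl
      exact hnab (hcase b hb hab)
    obtain ⟨x, y, hxy, hnxy, hx, hy, hc⟩ := ih (U.erase v) (Finset.erase_ssubset hvU)
      ⟨a, Finset.mem_erase.2 ⟨hne a ha b hb hab hnab, ha⟩, b, Finset.mem_erase.2
        ⟨hne b hb a ha hab.symm fun h => hnab h.symm, hb⟩, hab, hnab⟩
    rw [Finset.mem_erase] at hx hy
    refine ⟨x, y, hxy, hnxy, hx.2, hy.2, ?_⟩
    -- If v were a common neighbour of x and y, it would be one in G too, and since v is simplicial
    -- there, xy would be an edge of G. So v does not affect the clique condition for xy.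
    have hnev : ∀ u, H.Adj x u → H.Adj y u → u ≠ v := by
      rintro u hxu hyu rfl
      exact hnxy (hv x hx.2 y hy.2 (hcase x hx.2 hxu.symm) (hcase y hy.2 hyu.symm) hxy.ne)
    exact fun u hu w hw h1 h2 h3 h4 h5 => hc u (Finset.mem_erase.2 ⟨hnev u h1 h2, hu⟩) w
      (Finset.mem_erase.2 ⟨hnev w h3 h4, hw⟩) h1 h2 h3 h4 h5
  · push Not at hcase
    obtain ⟨u₀, hu₀, hvu₀, hnvu₀⟩ := hcase
    -- The G-neighbours of v in U form a clique of H, and it is a proper part of the H-neighbours. A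
    -- vertex u outside it that is simplicial among the H-neighbours makes the common neighbours of
    -- v and u in U a clique, so vu is removable.
    obtain ⟨u, hu, huK, hs⟩ := hH.exists_simplicial (U.filter (H.Adj v)) (U.filter (G.Adj v))
      (fun w hw => by
        rw [Finset.mem_filter] at hw ⊢
        exact ⟨hw.1, hGH hw.2⟩)
      (fun h => by
        have : u₀ ∈ U.filter (H.Adj v) := Finset.mem_filter.2 ⟨hu₀, hvu₀⟩
        rw [← h, Finset.mem_filter] at this
        exact hnvu₀ this.2)
      (fun s hs t ht hst => by
        rw [Finset.mem_filter] at hs ht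
        exact hGH (hv s hs.1 t ht.1 hs.2 ht.2 hst))
    rw [Finset.mem_filter] at hu huK
    refine ⟨v, u, hu.2, fun h => huK ⟨hu.1, h⟩, hvU, hu.1, ?_⟩
    exact fun a ha b hb h1 h2 h3 h4 => hs a (Finset.mem_filter.2 ⟨ha, h1⟩) b
      (Finset.mem_filter.2 ⟨hb, h3⟩) h2 h4

theorem HoleFree.exists_removable [Fintype V] {G H : SimpleGraph V} (hG : HoleFree G)
    (hH : HoleFree H) (hGH : G < H) : ∃ x y, H.Adj x y ∧ ¬ G.Adj x y ∧ CommonClique H x y := by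
  obtain ⟨a, b, hab, hnab⟩ : ∃ a b, H.Adj a b ∧ ¬ G.Adj a b := by
    by_contra h
    push Not at h
    exact hGH.not_ge fun a b => h a b
  obtain ⟨x, y, h1, h2, -, -, h⟩ := hG.exists_removable_on hH hGH.le Finset.univ
    ⟨a, by simp, b, by simp, hab, hnab⟩
  exact ⟨x, y, h1, h2, fun u v => h u (by simp) v (by simp)⟩

end HoleFree

end ChordalEnum

namespace ChordalEnum

/-! ### Completions, greedy deletion and proximity. -/

section Completions

variable {V : Type*} [Fintype V] [DecidableEq V] {G : SimpleGraph V} {L : List (Sym2 V)}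

theorem mk_mem_nonEdges {u v : V} : s(u, v) ∈ nonEdges G ↔ u ≠ v ∧ ¬ G.Adj u v := by
  simp [nonEdges]

theorem IsPairOrder.mem_of_mem_nonEdges (hL : IsPairOrder L) {e : Sym2 V} (he : e ∈ nonEdges G) :
    e ∈ L := by
  induction e with
  | h u v =>
    rw [hL.2, Sym2.mk_isDiag_iff]
    exact (mk_mem_nonEdges.1 he).1

theorem fillGraph_adj {F : Finset (Sym2 V)} (hF : F ⊆ nonEdges G) {u v : V} :
    (fillGraph G F).Adj u v ↔ G.Adj u v ∨ s(u, v) ∈ F := by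
  simp only [fillGraph, SimpleGraph.sup_adj, SimpleGraph.fromEdgeSet_adj, Finset.mem_coe]
  exact or_congr_right (and_iff_left_of_imp fun h => (mk_mem_nonEdges.1 (hF h)).1)

theorem fillGraph_erase {F : Finset (Sym2 V)} (hF : F ⊆ nonEdges G) {e : Sym2 V} (he : e ∈ F) :
    fillGraph G (F.erase e) = (fillGraph G F).deleteEdges {e} := by
  ext u v
  rw [fillGraph_adj ((Finset.erase_subset _ _).trans hF), SimpleGraph.deleteEdges_adj,
    fillGraph_adj hF, Finset.mem_erase, Set.mem_singleton_iff]
  have : s(u, v) = e → ¬ G.Adj u v := by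
    rintro rfl
    exact (mk_mem_nonEdges.1 (hF he)).2
  tauto

theorem isCompletion_erase_iff {F : Finset (Sym2 V)} (hF : IsCompletion G F) {x y : V}
    (he : s(x, y) ∈ F) :
    IsCompletion G (F.erase s(x, y)) ↔ CommonClique (fillGraph G F) x y := by
  have hxy : (fillGraph G F).Adj x y := (fillGraph_adj hF.1).2 (.inr he)
  rw [IsCompletion, fillGraph_erase hF.1 he, isChordal_iff_holeFree]
  exact ⟨fun h => h.2.commonClique hxy,
    fun h => ⟨(Finset.erase_subset _ _).trans hF.1, hF.2.holeFree.deleteEdge hxy h⟩⟩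

theorem IsCompletion.exists_erase {F F' : Finset (Sym2 V)} (hF : IsCompletion G F)
    (hF' : IsCompletion G F') (h : F ⊂ F') : ∃ e ∈ F', e ∉ F ∧ IsCompletion G (F'.erase e) := by
  obtain ⟨e, he, heF⟩ := Finset.exists_of_ssubset h
  have hle : fillGraph G F ≤ fillGraph G F' := fun u v => by
    rw [fillGraph_adj hF.1, fillGraph_adj hF'.1]
    exact Or.imp_right fun h' => h.1 h'
  obtain ⟨x, y, hxy, hnxy, hc⟩ := hF.2.holeFree.exists_removable hF'.2.holeFree
    (lt_of_le_not_ge hle fun hge => by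
      induction e with
      | h u v =>
        have := @hge u v ((fillGraph_adj hF'.1).2 (.inr he))
        rw [fillGraph_adj hF.1] at this
        exact this.elim (mk_mem_nonEdges.1 (hF'.1 he)).2 heF)
  rw [fillGraph_adj hF'.1] at hxy
  rw [fillGraph_adj hF.1, not_or] at hnxy
  exact ⟨s(x, y), hxy.resolve_left hnxy.1, hnxy.2,
    (isCompletion_erase_iff hF' (hxy.resolve_left hnxy.1)).2 hc⟩

/-- Single deletions suffice: by `IsCompletion.exists_erase`, a smaller completion anywhere below F
forces one of the form `F.erase e`. -/
theorem isMinCompletion_iff {F : Finset (Sym2 V)} :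
    IsMinCompletion G F ↔ IsCompletion G F ∧ ∀ e ∈ F, ¬ IsCompletion G (F.erase e) := by
  constructor
  · refine fun h => ⟨h.1, fun e he hc => ?_⟩
    exact (Finset.notMem_erase e F) (h.2 hc (Finset.erase_subset _ _) he)
  · rintro ⟨h, hmin⟩
    refine ⟨h, fun F' hF' hle => ?_⟩
    by_contra hne
    obtain ⟨e, he, -, hc⟩ := hF'.exists_erase h ⟨hle, hne⟩
    exact hmin e he hc

theorem isCompletion_nonEdges : IsCompletion G (nonEdges G) := by
  refine ⟨subset_rfl, ?_⟩
  have : fillGraph G (nonEdges G) = ⊤ := by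
    ext u v
    rw [fillGraph_adj subset_rfl, mk_mem_nonEdges, SimpleGraph.top_adj]
    have : G.Adj u v → u ≠ v := fun h => h.ne
    tauto
  rw [this]
  exact holeFree_top.isChordal

theorem mem_flip {F : Finset (Sym2 V)} {e s : Sym2 V} : s ∈ flip G F e ↔
    s ∈ nonEdges G ∧ s ∈ (flipGraph (fillGraph G F) e).edgeSet := by
  simp only [flip, Finset.mem_filter]

theorem mk_mem_flip {F : Finset (Sym2 V)} (hF : F ⊆ nonEdges G) {x y u v : V} :
    s(u, v) ∈ flip G F s(x, y) ↔ s(u, v) ∈ nonEdges G ∧ ((s(u, v) ≠ s(x, y) ∧ s(u, v) ∈ F) ∨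
      (((fillGraph G F).Adj x u ∧ (fillGraph G F).Adj y u) ∧
        (fillGraph G F).Adj x v ∧ (fillGraph G F).Adj y v)) := by
  rw [mem_flip]
  refine and_congr_right fun h => ?_
  simp only [SimpleGraph.mem_edgeSet, flipGraph, SimpleGraph.sup_adj,
    SimpleGraph.deleteEdges_adj, SimpleGraph.fromEdgeSet_adj,
    Set.mem_ofPred_eq, Sym2.mem_iff, forall_eq_or_imp, forall_eq, Set.mem_singleton_iff]
  rw [fillGraph_adj hF]
  have := mk_mem_nonEdges.1 h
  tauto

theorem flip_subset {F : Finset (Sym2 V)} {e : Sym2 V} : flip G F e ⊆ nonEdges G :=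
  fun _ h => (mem_flip.1 h).1

theorem fillGraph_flip {F : Finset (Sym2 V)} (hF : F ⊆ nonEdges G) {e : Sym2 V} (he : e ∈ F) :
    fillGraph G (flip G F e) = flipGraph (fillGraph G F) e := by
  ext u v
  rw [fillGraph_adj flip_subset]
  simp only [mem_flip, SimpleGraph.mem_edgeSet]
  constructor
  · rintro (h | h)
    · refine .inl ((SimpleGraph.deleteEdges_adj).2 ⟨(fillGraph_adj hF).2 (.inl h), ?_⟩)
      rintro rfl
      exact (mk_mem_nonEdges.1 (hF he)).2 h
    · exact h.2
  · intro h
    by_cases hG : G.Adj u v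
    · exact .inl hG
    · exact .inr ⟨mk_mem_nonEdges.2 ⟨h.ne, hG⟩, h⟩

theorem isCompletion_flip {F : Finset (Sym2 V)} (hF : IsCompletion G F) {e : Sym2 V}
    (he : e ∈ F) : IsCompletion G (flip G F e) := by
  refine ⟨flip_subset, ?_⟩
  rw [fillGraph_flip hF.1 he]
  induction e with
  | h x y =>
    exact (hF.2.holeFree.flipGraph ((fillGraph_adj hF.1).2 (.inr he))).isChordal

theorem mem_candidates {F X : Finset (Sym2 V)} {e : Sym2 V} :
    e ∈ candidates G F X ↔ e ∈ X ∧ e ∈ F ∧ IsCompletion G (F.erase e) := by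
  simp [candidates, and_assoc]

theorem minCand_mem {F X : Finset (Sym2 V)} {e : Sym2 V} (h : minCand G L F X = some e) :
    e ∈ candidates G F X := by
  simpa using List.find?_some h

theorem minCand_le {F X : Finset (Sym2 V)} {e e' : Sym2 V} (h : minCand G L F X = some e)
    (h' : e' ∈ candidates G F X) : L.idxOf e ≤ L.idxOf e' := by
  obtain ⟨he, as, bs, rfl, has⟩ := List.find?_eq_some_iff_append.1 h
  have hnot : ∀ a ∈ candidates G F X, a ∉ as := fun a ha haas => by simpa [ha] using has a haas
  rw [List.idxOf_append_of_notMem (hnot e' h'), List.idxOf_append_of_notMem (hnot e (by simpa using he))]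
  simp

theorem minCand_eq_none (hL : IsPairOrder L) {F X : Finset (Sym2 V)} (hF : F ⊆ nonEdges G)
    (h : minCand G L F X = none) {e : Sym2 V} (heX : e ∈ X) (heF : e ∈ F) :
    ¬ IsCompletion G (F.erase e) := by
  intro hc
  have := List.find?_eq_none.1 h e (hL.mem_of_mem_nonEdges (hF heF))
  simp only [decide_eq_true_eq] at this
  exact this (mem_candidates.2 ⟨heX, heF, hc⟩)

theorem del_of_none {F X : Finset (Sym2 V)} (h : minCand G L F X = none) : del G L F X = F := by
  rw [del]
  split
  · rfl
  · simp_all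

theorem del_of_some {F X : Finset (Sym2 V)} {e : Sym2 V} (h : minCand G L F X = some e) :
    del G L F X = del G L (F.erase e) X := by
  conv_lhs => rw [del]
  split <;> simp_all

theorem removed_of_none {F X : Finset (Sym2 V)} (h : minCand G L F X = none) :
    removed G L F X = [] := by
  rw [removed]
  split
  · rfl
  · simp_all

theorem removed_of_some {F X : Finset (Sym2 V)} {e : Sym2 V} (h : minCand G L F X = some e) :
    removed G L F X = e :: removed G L (F.erase e) X := by
  conv_lhs => rw [removed]
  split <;> simp_all

/-- Induction along the deletion procedure. -/
theorem del_induction (G : SimpleGraph V) (L : List (Sym2 V)) (X : Finset (Sym2 V))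
    {motive : Finset (Sym2 V) → Prop}
    (none : ∀ F, minCand G L F X = none → motive F)
    (some : ∀ F e, minCand G L F X = some e → motive (F.erase e) → motive F)
    (F : Finset (Sym2 V)) : motive F := by
  induction h : F.card using Nat.strong_induction_on generalizing F with
  | _ n ih =>
    cases hm : minCand G L F X with
    | none => exact none F hm
    | some e =>
      exact some F e hm (ih _ (h ▸ Finset.card_erase_lt_of_mem (mem_of_minCand G L hm)) _ rfl)

theorem del_subset {F X : Finset (Sym2 V)} : del G L F X ⊆ F := by
  induction F using del_induction G L X with
  | none F h => rw [del_of_none h]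
  | some F e h ih => rw [del_of_some h]; exact ih.trans (Finset.erase_subset _ _)

theorem isCompletion_del {F X : Finset (Sym2 V)} (hF : IsCompletion G F) :
    IsCompletion G (del G L F X) := by
  induction F using del_induction G L X with
  | none F h => rwa [del_of_none h]
  | some F e h ih => rw [del_of_some h]; exact ih (mem_candidates.1 (minCand_mem h)).2.2

theorem not_isCompletion_del_erase (hL : IsPairOrder L) {F X : Finset (Sym2 V)}
    (hF : F ⊆ nonEdges G) {e : Sym2 V} (heX : e ∈ X) (he : e ∈ del G L F X) :
    ¬ IsCompletion G ((del G L F X).erase e) := by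
  induction F using del_induction G L X with
  | none F h =>
    rw [del_of_none h] at he ⊢
    exact minCand_eq_none hL hF h heX he
  | some F e h ih =>
    rw [del_of_some h] at he ⊢
    exact ih ((Finset.erase_subset _ _).trans hF) he

theorem mem_removed {F X : Finset (Sym2 V)} {e : Sym2 V} :
    e ∈ removed G L F X ↔ e ∈ F ∧ e ∉ del G L F X := by
  induction F using del_induction G L X with
  | none F h => rw [del_of_none h, removed_of_none h]; simp
  | some F e' h ih =>
    rw [del_of_some h, removed_of_some h, List.mem_cons, ih, Finset.mem_erase]
    have h1 := mem_of_minCand G L h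
    have h2 : e' ∉ del G L (F.erase e') X := fun h => Finset.notMem_erase _ _ (del_subset h)
    by_cases hee : e = e'
    · subst hee; simp [h1, h2]
    · simp [hee]

theorem mem_of_mem_removed {F X : Finset (Sym2 V)} {e : Sym2 V} (he : e ∈ removed G L F X) :
    e ∈ X := by
  induction F using del_induction G L X with
  | none F h => rw [removed_of_none h] at he; simp at he
  | some F e' h ih =>
    rw [removed_of_some h, List.mem_cons] at he
    rcases he with rfl | he
    · exact (mem_candidates.1 (minCand_mem h)).1
    · exact ih he

/-- Deletion can be interrupted and resumed: what is left after any initial run is a completion, and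
the remaining removals depend on it alone. -/
theorem removed_prefix {F X : Finset (Sym2 V)} {p q : List (Sym2 V)}
    (h : removed G L F X = p ++ q) (hF : IsCompletion G F) :
    IsCompletion G (F \ p.toFinset) ∧ removed G L (F \ p.toFinset) X = q := by
  induction p generalizing F with
  | nil => simpa [hF] using h
  | cons a p ih =>
    cases hm : minCand G L F X with
    | none => rw [removed_of_none hm] at h; simp at h
    | some e =>
      rw [removed_of_some hm, List.cons_append, List.cons.injEq] at h
      obtain ⟨rfl, h⟩ := h
      have := ih h (mem_candidates.1 (minCand_mem hm)).2.2
      rwa [show F \ (e :: p).toFinset = F.erase e \ p.toFinset by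
        rw [List.toFinset_cons]; ext x; simp; tauto]

theorem minCand_of_removed_eq {F X : Finset (Sym2 V)} {p q : List (Sym2 V)} {e : Sym2 V}
    (h : removed G L F X = p ++ e :: q) (hF : IsCompletion G F) :
    minCand G L (F \ p.toFinset) X = some e := by
  have h1 := (removed_prefix h hF).2
  cases hm : minCand G L (F \ p.toFinset) X with
  | none => rw [removed_of_none hm] at h1; simp at h1
  | some e' => rw [removed_of_some hm] at h1; simp_all

theorem isMinCompletion_del (hL : IsPairOrder L) {F X : Finset (Sym2 V)} (hF : IsCompletion G F)
    (hX : F ⊆ X) : IsMinCompletion G (del G L F X) :=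
  isMinCompletion_iff.2 ⟨isCompletion_del hF, fun _ he =>
    not_isCompletion_del_erase hL hF.1 (hX (del_subset he)) he⟩

theorem isMinCompletion_root (hL : IsPairOrder L) : IsMinCompletion G (root G L) :=
  isMinCompletion_del hL isCompletion_nonEdges subset_rfl

theorem isMinCompletion_succ (hL : IsPairOrder L) {F : Finset (Sym2 V)} (hF : IsCompletion G F)
    {e : Sym2 V} (he : e ∈ F) : IsMinCompletion G (succ G L F e) :=
  isMinCompletion_del hL (isCompletion_flip hF he) subset_rfl

theorem mem_bar {F : Finset (Sym2 V)} {e : Sym2 V} : e ∈ bar G F ↔ e ∈ nonEdges G ∧ e ∉ F :=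
  Finset.mem_sdiff

/-- Elements of F are never candidates, so the process stays above F. While it is strictly above,
`IsCompletion.exists_erase` provides a candidate outside F, so it cannot stop early. This is why
`can` lists all of bar F. -/
theorem del_bar (hL : IsPairOrder L) {F : Finset (Sym2 V)} (hF : IsCompletion G F) :
    del G L (nonEdges G) (bar G F) = F := by
  have hsub : F ⊆ del G L (nonEdges G) (bar G F) := fun e he => by
    by_contra h
    exact (mem_bar.1 (mem_of_mem_removed (mem_removed.2 ⟨hF.1 he, h⟩))).2 he
  by_contra hne
  obtain ⟨e, he, heF, hc⟩ := hF.exists_erase (isCompletion_del isCompletion_nonEdges)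
    (hsub.ssubset_of_ne (Ne.symm hne))
  exact not_isCompletion_del_erase hL subset_rfl (mem_bar.2 ⟨del_subset he, heF⟩) he hc

theorem mem_can (hL : IsPairOrder L) {F : Finset (Sym2 V)} (hF : IsCompletion G F) {e : Sym2 V} :
    e ∈ can G L F ↔ e ∈ bar G F := by
  rw [can, mem_removed, del_bar hL hF, mem_bar]

theorem getElem?_length_takeWhile {α : Type*} (p : α → Bool) (l : List α) :
    l[(l.takeWhile p).length]? = l.find? fun a => !p a := by
  induction l with
  | nil => simp
  | cons a l ih =>
    rw [List.takeWhile_cons, List.find?_cons]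
    cases p a <;> simp [ih]

theorem nextStep_eq {F C : Finset (Sym2 V)} : nextStep G L F C =
    ((can G L F).find? fun e => !decide (e ∈ bar G C)).map (succ G L C) := by
  rw [nextStep, prox, getElem?_length_takeWhile]

theorem nextStep_of_eq {F C : Finset (Sym2 V)} {w t : List (Sym2 V)} {e : Sym2 V}
    (h : can G L F = w ++ e :: t) (hw : ∀ a ∈ w, a ∈ bar G C) (he : e ∉ bar G C) :
    nextStep G L F C = some (succ G L C e) := by
  rw [nextStep_eq, h, List.find?_append, List.find?_eq_none.2 (by simpa using hw)]
  simp [he]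

theorem IsMinCompletion.eq_of_bar_subset {F C : Finset (Sym2 V)} (hF : IsMinCompletion G F)
    (hC : IsMinCompletion G C) (h : bar G F ⊆ bar G C) : F = C := by
  have hle : C ≤ F := fun e he => by
    by_contra heF
    exact (mem_bar.1 (h (mem_bar.2 ⟨hC.1.1 he, heF⟩))).2 he
  exact (hF.2 hC.1 hle).antisymm hle

/-- The canonical ordering of `F` splits at the first element outside `bar C`. -/
theorem exists_can_eq (hL : IsPairOrder L) {F C : Finset (Sym2 V)} (hF : IsMinCompletion G F)
    (hC : IsMinCompletion G C) (hne : F ≠ C) : ∃ w e t, can G L F = w ++ e :: t ∧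
      (∀ a ∈ w, a ∈ bar G C) ∧ e ∉ bar G C := by
  cases h : (can G L F).find? fun e => !decide (e ∈ bar G C) with
  | none =>
    refine absurd (hF.eq_of_bar_subset hC fun e he => ?_) hne
    simpa using List.find?_eq_none.1 h e ((mem_can hL hF.1).2 he)
  | some e =>
    obtain ⟨he, w, t, heq, hw⟩ := List.find?_eq_some_iff_append.1 h
    exact ⟨w, e, t, heq, by simpa using hw, by simpa using he⟩

theorem mem_of_can_eq (hL : IsPairOrder L) {F C : Finset (Sym2 V)} (hF : IsCompletion G F)
    {w t : List (Sym2 V)} {e : Sym2 V} (h : can G L F = w ++ e :: t) (he : e ∉ bar G C) :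
    e ∈ C := by
  have : e ∈ bar G F := (mem_can hL hF).1 (by simp [h])
  by_contra heC
  exact he (mem_bar.2 ⟨(mem_bar.1 this).1, heC⟩)

/-- The reason why proximity increases. With A = E^c without w, C is contained in A and e is
deletable from A, so the common neighbours of the ends of e are a clique in G_A. The flip of e in C
turns a subset of them into a clique and therefore stays inside `A.erase e`; `del` only makes it
smaller. -/
theorem succ_mem_bar (hL : IsPairOrder L) {F C : Finset (Sym2 V)} (hF : IsCompletion G F)
    (hC : IsCompletion G C) {w t : List (Sym2 V)} {e : Sym2 V} (h : can G L F = w ++ e :: t)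
    (hw : ∀ a ∈ w, a ∈ bar G C) (he : e ∉ bar G C) :
    ∀ a ∈ w ++ [e], a ∈ bar G (succ G L C e) := by
  have heC := mem_of_can_eq hL hF h he
  set A := nonEdges G \ w.toFinset with hA
  have hAc : IsCompletion G A := (removed_prefix h isCompletion_nonEdges).1
  have hcand := mem_candidates.1 (minCand_mem (minCand_of_removed_eq h isCompletion_nonEdges))
  have hCA : C ⊆ A := fun a ha => Finset.mem_sdiff.2 ⟨hC.1 ha, fun haw =>
    (mem_bar.1 (hw a (List.mem_toFinset.1 haw))).2 ha⟩
  have hsub : succ G L C e ⊆ A.erase e := by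
    refine del_subset.trans fun s hs => ?_
    induction e with
    | h x y =>
    induction s with
    | h u v =>
      have hclique := (isCompletion_erase_iff hAc hcand.2.1).1 hcand.2.2
      rw [mk_mem_flip hC.1] at hs
      have hmono : ∀ u v, (fillGraph G C).Adj u v → (fillGraph G A).Adj u v := fun u v => by
        rw [fillGraph_adj hC.1, fillGraph_adj hAc.1]
        exact Or.imp_right fun h => hCA h
      obtain ⟨hs, ⟨hne, hsC⟩ | ⟨⟨h1, h2⟩, h3, h4⟩⟩ := hs
      · exact Finset.mem_erase.2 ⟨hne, hCA hsC⟩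
      · have := hclique u v (hmono _ _ h1) (hmono _ _ h2) (hmono _ _ h3) (hmono _ _ h4)
          (mk_mem_nonEdges.1 hs).1
        rw [fillGraph_adj hAc.1] at this
        refine Finset.mem_erase.2 ⟨fun heq => ?_, this.resolve_left (mk_mem_nonEdges.1 hs).2⟩
        -- The flip does not put e back, since no end of e is its own neighbour.
        rcases Sym2.eq_iff.1 heq with ⟨rfl, rfl⟩ | ⟨rfl, rfl⟩
        · exact h1.ne rfl
        · exact h2.ne rfl
  intro a ha
  rw [List.mem_append, List.mem_singleton] at ha
  refine mem_bar.2 ⟨?_, fun has => ?_⟩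
  · rcases ha with ha | rfl
    · exact (mem_bar.1 (hw a ha)).1
    · exact hC.1 heC
  · have := Finset.mem_erase.1 (hsub has)
    rcases ha with ha | ha
    · exact (Finset.mem_sdiff.1 this.2).2 (List.mem_toFinset.2 ha)
    · exact this.1 ha

theorem prox_eq {F C : Finset (Sym2 V)} {w t : List (Sym2 V)} {e : Sym2 V}
    (h : can G L F = w ++ e :: t) (hw : ∀ a ∈ w, a ∈ bar G C) (he : e ∉ bar G C) :
    prox G L C F = w.length := by
  rw [prox, h, List.takeWhile_append_of_pos (by simpa using hw)]
  simp [he]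

theorem le_prox {F C : Finset (Sym2 V)} {w t : List (Sym2 V)}
    (h : can G L F = w ++ t) (hw : ∀ a ∈ w, a ∈ bar G C) : w.length ≤ prox G L C F := by
  rw [prox, h, List.takeWhile_append_of_pos (by simpa using hw)]
  simp

theorem prox_le {F C : Finset (Sym2 V)} : prox G L C F ≤ (can G L F).length :=
  (List.takeWhile_prefix _).length_le

/-- A step towards `F ≠ C` exists, stays in the minimal completions and increases the
proximity. -/
theorem exists_nextStep (hL : IsPairOrder L) {F C : Finset (Sym2 V)} (hF : IsMinCompletion G F)
    (hC : IsMinCompletion G C) (hne : F ≠ C) : ∃ C', nextStep G L F C = some C' ∧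
      IsMinCompletion G C' ∧ prox G L C F < prox G L C' F ∧ C' ∈ neighbours G L C := by
  obtain ⟨w, e, t, h, hw, he⟩ := exists_can_eq hL hF hC hne
  have heC := mem_of_can_eq hL hF.1 h he
  refine ⟨succ G L C e, nextStep_of_eq h hw he, isMinCompletion_succ hL hC.1 heC, ?_,
    Finset.mem_image_of_mem _ heC⟩
  rw [prox_eq h hw he]
  have := le_prox (F := F) (L := L) (C := succ G L C e) (w := w ++ [e]) (t := t) (by simp [h])
    (succ_mem_bar hL hF.1 hC.1 h hw he)
  simp at this
  omega

theorem nextStep_self (hL : IsPairOrder L) {F : Finset (Sym2 V)} (hF : IsMinCompletion G F) :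
    nextStep G L F F = none := by
  rw [nextStep_eq, List.find?_eq_none.2, Option.map_none]
  intro e he
  simpa using (mem_can hL hF.1).1 he

end Completions

end ChordalEnum

namespace ChordalEnum

/-! ### Canonical paths, parents and the arborescence. -/

section Arborescence

open Relation

/-- A chain of a functional relation is determined by its start as long as it continues, and it can
end only at z because z has no successor. Used for canonical paths, and for the reversals of walks
from the root. -/
theorem chain_unique {α : Type*} {r : α → α → Prop} (hr : ∀ a b c, r a b → r a c → b = c) {z : α}
    (hz : ∀ b, ¬ r z b) : ∀ p q : List α, p.head? = q.head? → p.getLast? = some z →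
      q.getLast? = some z → p.IsChain r → q.IsChain r → p = q
  | [], _, _, h, _, _, _ => by simp at h
  | _ :: _, [], h, _, _, _, _ => by simp at h
  | [a], [b], h, _, _, _, _ => by simpa using h
  | [a], b :: c :: q, h, h1, _, _, h4 => by
    simp only [List.head?_cons, Option.some.injEq, List.getLast?_singleton] at h h1
    rw [← h, h1, List.isChain_cons_cons] at h4
    exact absurd h4.1 (hz _)
  | a :: c :: p, [b], h, _, h2, h3, _ => by
    simp only [List.head?_cons, Option.some.injEq, List.getLast?_singleton] at h h2
    rw [h, h2, List.isChain_cons_cons] at h3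
    exact absurd h3.1 (hz _)
  | a :: c :: p, b :: d :: q, h, h1, h2, h3, h4 => by
    simp only [List.head?_cons, Option.some.injEq] at h
    subst h
    rw [List.isChain_cons_cons] at h3 h4
    rw [List.getLast?_cons_cons] at h1 h2
    rw [chain_unique hr hz (c :: p) (d :: q) (by simp [hr _ _ _ h3.1 h4.1]) h1 h2 h3.2 h4.2]

theorem isChain_append_singleton_imp {α : Type*} {r r' : α → α → Prop} {b : α} :
    ∀ q : List α, (q ++ [b]).IsChain r → (∀ a ∈ q, ∀ c, r a c → r' a c) → (q ++ [b]).IsChain r'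
  | [], _, _ => by simp
  | [a], h, h' => by
    simp only [List.cons_append, List.nil_append, List.isChain_cons_cons] at h ⊢
    exact ⟨h' a (by simp) _ h.1, by simp⟩
  | a :: c :: q, h, h' => by
    simp only [List.cons_append, List.isChain_cons_cons] at h ⊢
    exact ⟨h' a (by simp) _ h.1,
      isChain_append_singleton_imp (c :: q) h.2 fun a ha => h' a (List.mem_cons_of_mem _ ha)⟩

theorem lt_last_of_isChain {α : Type*} {r : α → α → Prop} {f : α → ℕ} {b : α} :
    ∀ q : List α, (q ++ [b]).IsChain r → (∀ a ∈ q, ∀ c, r a c → f a < f c) →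
      ∀ a ∈ q, f a < f b
  | [], _, _ => by simp
  | [a], h, h' => by
    simp only [List.cons_append, List.nil_append, List.isChain_cons_cons] at h
    simpa using h' a (by simp) _ h.1
  | a :: c :: q, h, h' => by
    simp only [List.cons_append, List.isChain_cons_cons] at h
    have ih := lt_last_of_isChain (c :: q) h.2 fun a ha => h' a (List.mem_cons_of_mem _ ha)
    intro x hx
    rcases List.mem_cons.1 hx with rfl | hx
    · exact (h' x (by simp) _ h.1).trans (ih c (by simp))
    · exact ih x hx

theorem exists_first_difference {α : Type*} : ∀ l l' : List α, ¬ l <+: l' → ¬ l' <+: l →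
    ∃ w a b t t', l = w ++ a :: t ∧ l' = w ++ b :: t' ∧ a ≠ b
  | [], _, h, _ => absurd (List.nil_prefix) h
  | _ :: _, [], _, h => absurd (List.nil_prefix) h
  | a :: l, b :: l', h, h' => by
    by_cases hab : a = b
    · subst hab
      rw [List.prefix_cons_inj] at h h'
      obtain ⟨w, c, d, t, t', h1, h2, h3⟩ := exists_first_difference l l' h h'
      exact ⟨a :: w, c, d, t, t', by simp [h1], by simp [h2], h3⟩
    · exact ⟨[], a, b, l, l', rfl, rfl, hab⟩

theorem map_append_cons_lt {α : Type*} {f : α → ℕ} {w t t' : List α} {a b : α} (h : f a < f b) :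
    (w ++ a :: t).map f < (w ++ b :: t').map f := by
  induction w with
  | nil => exact List.cons_lt_cons_iff.2 (.inl h)
  | cons c w ih => exact List.cons_lt_cons_iff.2 (.inr ⟨rfl, ih⟩)

variable {V : Type*} [Fintype V] [DecidableEq V] {G : SimpleGraph V} {L : List (Sym2 V)}

theorem nextStep_spec (hL : IsPairOrder L) {F C C' : Finset (Sym2 V)} (hF : IsMinCompletion G F)
    (hC : IsMinCompletion G C) (h : nextStep G L F C = some C') :
    IsMinCompletion G C' ∧ prox G L C F < prox G L C' F ∧ C' ∈ neighbours G L C := by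
  have hne : F ≠ C := by
    rintro rfl
    rw [nextStep_self hL hF] at h
    simp at h
  obtain ⟨D, hD, h1⟩ := exists_nextStep hL hF hC hne
  rw [h, Option.some.injEq] at hD
  rwa [hD]

theorem exists_path (hL : IsPairOrder L) {F : Finset (Sym2 V)} (hF : IsMinCompletion G F)
    (C : Finset (Sym2 V)) (hC : IsMinCompletion G C) : ∃ p : List (Finset (Sym2 V)),
      p.head? = some C ∧ p.getLast? = some F ∧ (∀ C ∈ p, IsMinCompletion G C) ∧
        p.IsChain fun C C' => nextStep G L F C = some C' := by
  induction h : (can G L F).length - prox G L C F using Nat.strong_induction_on generalizing C with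
  | _ n ih =>
    by_cases hne : F = C
    · subst hne
      exact ⟨[F], by simp [hF]⟩
    · obtain ⟨C', hs, hC', hlt, -⟩ := exists_nextStep hL hF hC hne
      have hle := prox_le (G := G) (L := L) (F := F) (C := C')
      obtain ⟨p, h1, h2, h3, h4⟩ := ih _ (by omega) C' hC' rfl
      cases p with
      | nil => simp at h1
      | cons a p =>
        simp only [List.head?_cons, Option.some.injEq] at h1
        subst h1
        refine ⟨C :: a :: p, rfl, by rwa [List.getLast?_cons_cons], ?_, h4.cons_cons hs⟩
        intro D hD
        rcases List.mem_cons.1 hD with rfl | hD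
        · exact hC
        · exact h3 D hD

theorem existsUnique_isCanonicalPath (hL : IsPairOrder L) {F : Finset (Sym2 V)}
    (hF : IsMinCompletion G F) : ∃! p, IsCanonicalPath G L F p := by
  obtain ⟨p, hp⟩ := exists_path hL hF _ (isMinCompletion_root hL)
  refine ⟨p, hp, fun q hq => ?_⟩
  exact chain_unique (fun a b c h h' => Option.some.inj (h.symm.trans h'))
    (fun b hb => by rw [nextStep_self hL hF] at hb; simp at hb) _ _
    (hq.1.trans hp.1.symm) hq.2.1 hp.2.1 hq.2.2.2 hp.2.2.2

theorem isCanonicalPath_root (hL : IsPairOrder L) : IsCanonicalPath G L (root G L) [root G L] := by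
  simp [IsCanonicalPath, isMinCompletion_root hL]

theorem IsParent.isMin {P F : Finset (Sym2 V)} (h : IsParent G L P F) :
    IsMinCompletion G P ∧ IsMinCompletion G F := by
  obtain ⟨q, hq⟩ := h
  exact ⟨hq.2.2.1 P (by simp), hq.2.2.1 F (by simp)⟩

theorem IsParent.nextStep {P F : Finset (Sym2 V)} (h : IsParent G L P F) :
    nextStep G L F P = some F := by
  obtain ⟨q, hq⟩ := h
  simpa using (List.isChain_append.1 hq.2.2.2).2.1

theorem mem_children (hL : IsPairOrder L) {P F : Finset (Sym2 V)} :
    F ∈ children G L P ↔ IsParent G L P F := by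
  simp only [children, Finset.mem_filter, and_iff_right_iff_imp]
  exact fun h => (nextStep_spec hL h.isMin.2 h.isMin.1 h.nextStep).2.2

theorem IsParent.unique (hL : IsPairOrder L) {P P' F : Finset (Sym2 V)} (h : IsParent G L P F)
    (h' : IsParent G L P' F) : P = P' := by
  have hF := h.isMin.2
  obtain ⟨q, hq⟩ := h
  obtain ⟨q', hq'⟩ := h'
  have := (existsUnique_isCanonicalPath hL hF).unique hq hq'
  rw [List.append_cons, List.append_cons q', List.append_left_inj] at this
  simpa using (List.append_inj' this rfl).2

theorem not_isParent_root (hL : IsPairOrder L) {P : Finset (Sym2 V)} :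
    ¬ IsParent G L P (root G L) := by
  rintro ⟨q, hq⟩
  have := (existsUnique_isCanonicalPath hL (isMinCompletion_root hL)).unique hq
    (isCanonicalPath_root hL)
  simpa using congrArg List.length this

theorem existsUnique_isParent (hL : IsPairOrder L) {F : Finset (Sym2 V)}
    (hF : IsMinCompletion G F) (hne : F ≠ root G L) : ∃! P, IsParent G L P F := by
  obtain ⟨p, hp, -⟩ := existsUnique_isCanonicalPath hL hF
  suffices ∃ P, IsParent G L P F by
    obtain ⟨P, hP⟩ := this
    exact ⟨P, hP, fun P' hP' => hP'.unique hL hP⟩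
  obtain ⟨q, rfl⟩ := List.getLast?_eq_some_iff.1 hp.2.1
  rcases q.eq_nil_or_concat with rfl | ⟨q, P, rfl⟩
  · exact absurd (by simpa using hp.1) hne
  · exact ⟨P, q, by simpa using hp⟩

/-- All members of the path before P have proximity to F below that of P, which is the length of the
common prefix w. So their first missing element lies in w and is the same for F and for P: the steps
towards F are also the steps towards P. -/
theorem isCanonicalPath_of_lt (hL : IsPairOrder L) {F P : Finset (Sym2 V)}
    (hF : IsMinCompletion G F) (hP : IsMinCompletion G P) {w t t' : List (Sym2 V)} {f g : Sym2 V}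
    (hcF : can G L F = w ++ f :: t) (hcP : can G L P = w ++ g :: t')
    (hfg : L.idxOf f < L.idxOf g) {q : List (Finset (Sym2 V))}
    (hroot : (q ++ [P]).head? = some (root G L)) (hmin : ∀ C ∈ q ++ [P], IsMinCompletion G C)
    (hchain : (q ++ [P]).IsChain fun C C' => nextStep G L F C = some C') :
    IsCanonicalPath G L P (q ++ [P]) := by
  refine ⟨hroot, by simp, hmin, isChain_append_singleton_imp q hchain fun C hC C' h => ?_⟩
  have hw : ∀ a ∈ w, a ∈ bar G P := fun a ha => (mem_can hL hP.1).1 (by simp [hcP, ha])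
  -- Both orderings remove w first, and f is deletable at that point. If f were in bar P, Can(bar P)
  -- would have chosen f before the larger g.
  have hf : f ∉ bar G P := fun hf => by
    have h1 := mem_candidates.1 (minCand_mem (minCand_of_removed_eq hcF isCompletion_nonEdges))
    exact hfg.not_ge (minCand_le (minCand_of_removed_eq hcP isCompletion_nonEdges)
      (mem_candidates.2 ⟨hf, h1.2⟩))
  have hprox : prox G L C F < w.length := by
    rw [← prox_eq hcF hw hf]
    exact lt_last_of_isChain (f := fun C => prox G L C F) q hchain
      (fun a ha c hac => (nextStep_spec hL hF (hmin a (by simp [ha])) hac).2.1) C hC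
  have hfind : (w.find? fun e => !decide (e ∈ bar G C)) ≠ none := fun hnone => by
    exact hprox.not_ge (le_prox hcF (by simpa using hnone))
  obtain ⟨e, he⟩ := Option.ne_none_iff_exists'.1 hfind
  rw [nextStep_eq, hcF, List.find?_append, he] at h
  rw [nextStep_eq, hcP, List.find?_append, he]
  exact h

/-- Outer induction on canonical orderings, compared lexicographically by positions in L; there are
finitely many sets, so this is well-founded. Inside, the canonical path of F is followed, and each
of its members is reached either by a parent arc from its predecessor or by the outer induction. -/
theorem reach_root (hL : IsPairOrder L) (F : Finset (Sym2 V)) (hF : IsMinCompletion G F) :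
    ReflTransGen (fun P F => F ∈ children G L P) (root G L) F := by
  let key : Finset (Sym2 V) → List ℕ := fun F => (can G L F).map L.idxOf
  have hwf : WellFounded fun F F' => key F < key F' := by
    have : IsTrans _ fun F F' => key F < key F' := ⟨fun _ _ _ h h' => lt_trans h h'⟩
    have : Std.Irrefl fun F F' => key F < key F' := ⟨fun _ h => lt_irrefl _ h⟩
    exact Finite.wellFounded_of_trans_of_irrefl _
  induction F using hwf.induction with
  | _ F ih =>
  obtain ⟨p, hp, -⟩ := existsUnique_isCanonicalPath hL hF
  have hprefix : ∀ q : List (Finset (Sym2 V)), ∀ P, q ++ [P] <+: p →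
      ReflTransGen (fun P F => F ∈ children G L P) (root G L) P := by
    intro q
    induction q using List.reverseRecOn with
    | nil =>
      rintro P ⟨s, rfl⟩
      rw [show P = root G L by simpa using hp.1]
    | append_singleton q P' ihq =>
      rintro P hpre
      have hP' := ihq P' ((List.prefix_append _ _).trans hpre)
      have hmin : ∀ C ∈ q ++ [P'] ++ [P], IsMinCompletion G C := fun C hC => hp.2.2.1 C (hpre.subset hC)
      obtain ⟨s, hs⟩ := hpre
      have hchain : (q ++ [P'] ++ [P]).IsChain fun C C' => nextStep G L F C = some C' :=
        (List.isChain_append.1 (hs ▸ hp.2.2.2)).1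
      have hroot : (q ++ [P'] ++ [P]).head? = some (root G L) := by
        rw [← hp.1, ← hs]; simp
      have hP : IsMinCompletion G P := hmin P (by simp)
      have hfin : IsCanonicalPath G L P (q ++ [P'] ++ [P]) →
          ReflTransGen (fun P F => F ∈ children G L P) (root G L) P := fun h =>
        hP'.tail ((mem_children hL).2 ⟨q, by simpa using h⟩)
      by_cases hPF : P = F
      · subst hPF
        exact hfin ⟨hroot, by simp, hmin, hchain⟩
      -- Canonical orderings of distinct minimal completions are not prefixes of each other, since
      -- otherwise one complement would contain the other. So they have a first difference.
      have hnot : ∀ {A B : Finset (Sym2 V)}, IsMinCompletion G A → IsMinCompletion G B → A ≠ B →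
          ¬ can G L A <+: can G L B := fun hA hB hne hpre =>
        hne (hA.eq_of_bar_subset hB fun e he =>
          (mem_can hL hB.1).1 (hpre.subset ((mem_can hL hA.1).2 he)))
      obtain ⟨w, f, g, t, t', h1, h2, h3⟩ := exists_first_difference _ _
        (hnot hF hP (Ne.symm hPF)) (hnot hP hF hPF)
      rcases lt_trichotomy (L.idxOf f) (L.idxOf g) with h | h | h
      · exact hfin (isCanonicalPath_of_lt hL hF hP h1 h2 h hroot hmin hchain)
      · refine absurd ((List.idxOf_inj (hL.mem_of_mem_nonEdges (G := G) ?_)).1 h) h3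
        exact (mem_bar.1 ((mem_can hL hF.1).1 (by simp [h1]))).1
      · refine ih P ?_ hP
        change (can G L P).map _ < (can G L F).map _
        rw [h1, h2]
        exact map_append_cons_lt h
  obtain ⟨q, hq⟩ := List.getLast?_eq_some_iff.1 hp.2.1
  exact hprefix q F (by rw [hq])

theorem isSpanningArborescence_children (hL : IsPairOrder L) :
    IsSpanningArborescence {F | IsMinCompletion G F} (fun F F' => F' ∈ children G L F)
      (root G L) := by
  refine ⟨isMinCompletion_root hL, fun a b h _ => ((mem_children hL).1 h).isMin.2,
    fun F hF => ?_⟩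
  obtain ⟨l, hl1, hl2⟩ := List.exists_isChain_cons_of_relationReflTransGen (reach_root hL F hF)
  refine ⟨root G L :: l, ⟨rfl, by rw [List.getLast?_eq_getLast_of_ne_nil (by simp), hl2], hl1⟩, ?_⟩
  rintro q ⟨hq1, hq2, hq3⟩
  -- Walked backwards, the arcs go to parents: a functional relation for which the root is terminal.
  refine List.reverse_injective (chain_unique (r := fun F F' => F ∈ children G L F')
    (fun a b c h h' => ((mem_children hL).1 h).unique hL ((mem_children hL).1 h'))
    (z := root G L) (fun b h => not_isParent_root hL ((mem_children hL).1 h)) _ _ ?_ ?_ ?_ ?_ ?_)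
  · rw [List.head?_reverse, List.head?_reverse, hq2,
      List.getLast?_eq_getLast_of_ne_nil (by simp), hl2]
  · rw [List.getLast?_reverse, hq1]
  · rw [List.getLast?_reverse]; rfl
  · rw [List.isChain_reverse]; exact hq3
  · rw [List.isChain_reverse]; exact hl1

/-- The length of the unique walk from the root. Both ends of an arc are minimal completions, so the
values elsewhere do not matter. -/
theorem exists_height (hL : IsPairOrder L) : ∃ h : Finset (Sym2 V) → ℕ,
    ∀ A B, B ∈ children G L A → h B = h A + 1 := by
  classical
  have hA := (isSpanningArborescence_children (G := G) hL).2.2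
  choose! w hw hu using hA
  refine ⟨fun F => (w F).length, fun A B hAB => ?_⟩
  have hmin := ((mem_children hL).1 hAB).isMin
  have hwA := hw A hmin.1
  change (w B).length = (w A).length + 1
  rw [← hu B hmin.2 (w A ++ [B]) ⟨?_, by simp, ?_⟩]
  · simp
  · rw [List.head?_append, hwA.1]; rfl
  · rw [List.isChain_append]
    refine ⟨hwA.2.2, by simp, fun x hx y hy => ?_⟩
    rw [hwA.2.1] at hx
    simp only [Option.mem_def, Option.some.injEq, List.head?_cons] at hx hy
    subst hx hy
    exact hAB

theorem wellFounded_children (hL : IsPairOrder L) :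
    WellFounded fun F' F : Finset (Sym2 V) => F' ∈ children G L F := by
  obtain ⟨h, hh⟩ := exists_height (G := G) hL
  have hwf : WellFounded fun F' F : Finset (Sym2 V) => h F < h F' := by
    have : IsTrans _ fun F' F : Finset (Sym2 V) => h F < h F' := ⟨fun _ _ _ h h' => h'.trans h⟩
    have : Std.Irrefl fun F' F : Finset (Sym2 V) => h F < h F' := ⟨fun _ h => lt_irrefl _ h⟩
    exact Finite.wellFounded_of_trans_of_irrefl _
  exact Subrelation.wf (fun {a b} hab => by rw [hh b a hab]; omega) hwf

theorem height_le_of_reach {h : Finset (Sym2 V) → ℕ} (hh : ∀ A B, B ∈ children G L A → h B = h A + 1)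
    {A B : Finset (Sym2 V)} (hAB : ReflTransGen (fun P F => F ∈ children G L P) A B) :
    h A ≤ h B ∧ (h A = h B → A = B) := by
  induction hAB with
  | refl => simp
  | tail _ h2 ih => rw [hh _ _ h2]; omega

/-! ### Correctness of the recursive procedure. -/

theorem EnumOutput.append_singleton {d : ℕ} {F : Finset (Sym2 V)} {Fs o o' : List (Finset (Sym2 V))}
    (h : EnumOutput G L d [F] o) (h' : EnumOutput G L d Fs o') :
    EnumOutput G L d (F :: Fs) (o ++ o') := by
  cases h with
  | cons _ _ _ kids out out' h1 h2 h3 h4 =>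
    cases h4
    simpa using EnumOutput.cons d F Fs kids out o' h1 h2 h3 h'

theorem exists_enumOutput (hL : IsPairOrder L) (F : Finset (Sym2 V)) (d : ℕ) :
    ∃ out, EnumOutput G L d [F] out := by
  induction F using (wellFounded_children (G := G) hL).induction generalizing d with
  | _ F ih =>
  have hlist : ∀ Fs : List (Finset (Sym2 V)), (∀ F' ∈ Fs, F' ∈ children G L F) →
      ∃ out, EnumOutput G L (d + 1) Fs out := by
    intro Fs
    induction Fs with
    | nil => exact fun _ => ⟨[], .nil _⟩
    | cons F' Fs ih' =>
      intro hFs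
      obtain ⟨o, ho⟩ := ih F' (hFs F' (by simp)) (d + 1)
      obtain ⟨o', ho'⟩ := ih' fun A hA => hFs A (List.mem_cons_of_mem _ hA)
      exact ⟨_, ho.append_singleton ho'⟩
  obtain ⟨out, hout⟩ := hlist (children G L F).toList (by simp)
  exact ⟨_, .cons d F [] _ out [] (Finset.nodup_toList _) (by simp) hout (.nil d)⟩

theorem EnumOutput.mem_iff {d : ℕ} {Fs out : List (Finset (Sym2 V))}
    (h : EnumOutput G L d Fs out) (X : Finset (Sym2 V)) :
    X ∈ out ↔ ∃ F ∈ Fs, ReflTransGen (fun P F => F ∈ children G L P) F X := by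
  induction h with
  | nil => simp
  | cons d F Fs kids out out' _ hk _ _ ih1 ih2 =>
    have hmem : X ∈ (if Even d then F :: out else out ++ [F]) ↔ F = X ∨ X ∈ out := by
      split_ifs <;> simp [or_comm, eq_comm]
    rw [List.mem_append, hmem, ih1, ih2, List.exists_mem_cons_iff, ReflTransGen.cases_head_iff]
    simp only [hk]

theorem EnumOutput.nodup (hL : IsPairOrder L) {d : ℕ} {Fs out : List (Finset (Sym2 V))}
    (h : EnumOutput G L d Fs out)
    (hFs : Fs.Pairwise fun A B => ∀ X, ReflTransGen (fun P F => F ∈ children G L P) A X →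
      ¬ ReflTransGen (fun P F => F ∈ children G L P) B X) : out.Nodup := by
  obtain ⟨ht, hht⟩ := exists_height (G := G) hL
  induction h with
  | nil => simp
  | cons d F Fs kids out out' hnd hk h1 h2 ih1 ih2 =>
    rw [List.pairwise_cons] at hFs
    have hout : out.Nodup := ih1 (hnd.imp_of_mem fun {A B} hA hB hAB X hAX hBX => by
      have hA' := hht _ _ ((hk A).1 hA)
      have hB' := hht _ _ ((hk B).1 hB)
      -- Two siblings with a common descendant both lie on its line of ancestors, so one is above
      -- the other; being at the same height, they coincide.
      rcases ReflTransGen.total_of_right_unique (r := fun F P => F ∈ children G L P)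
        (fun a b c h h' => ((mem_children hL).1 h).unique hL ((mem_children hL).1 h'))
        (reflTransGen_swap.2 hAX) (reflTransGen_swap.2 hBX) with h | h
      · exact hAB ((height_le_of_reach hht (reflTransGen_swap.1 h)).2 (by omega)).symm
      · exact hAB ((height_le_of_reach hht (reflTransGen_swap.1 h)).2 (by omega)))
    have hF : F ∉ out := fun hF => by
      obtain ⟨K, hK, hKF⟩ := (h1.mem_iff F).1 hF
      have := hht _ _ ((hk K).1 hK)
      have := (height_le_of_reach hht hKF).1
      omega
    have hall : (if Even d then F :: out else out ++ [F]).Perm (F :: out) := by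
      split_ifs
      · exact .refl _
      · exact List.perm_append_singleton _ _
    rw [List.nodup_append', hall.nodup_iff, List.nodup_cons]
    refine ⟨⟨hF, hout⟩, ih2 hFs.2, fun X hX hX' => ?_⟩
    obtain ⟨B, hB, hBX⟩ := (h2.mem_iff X).1 hX'
    refine hFs.1 B hB X ?_ hBX
    rcases List.mem_cons.1 (hall.mem_iff.1 hX) with rfl | hX
    · exact .refl
    · obtain ⟨K, hK, hKX⟩ := (h1.mem_iff X).1 hX
      exact hKX.head ((hk K).1 hK)

theorem isAlgorithmOutput_spec (hL : IsPairOrder L) {out : List (Finset (Sym2 V))}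
    (h : IsAlgorithmOutput G L out) : out.Nodup ∧ ∀ F, F ∈ out ↔ IsMinCompletion G F := by
  refine ⟨EnumOutput.nodup hL h (by simp), fun F => ?_⟩
  rw [EnumOutput.mem_iff h]
  simp only [List.mem_singleton, exists_eq_left]
  refine ⟨fun hF => ?_, reach_root hL F⟩
  rcases ReflTransGen.cases_tail hF with rfl | ⟨P, _, hP⟩
  · exact isMinCompletion_root hL
  · exact ((mem_children hL).1 hP).isMin.2

end Arborescence

end ChordalEnum

namespace ChordalEnum

/-! ### Polynomially bounded functions -/

/-- A monotone function that is bounded by a polynomial. -/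
def PolyBound (b : ℕ → ℕ) : Prop :=
  Monotone b ∧ ∃ p : Polynomial ℕ, ∀ m, b m ≤ p.eval m

theorem PolyBound.const (k : ℕ) : PolyBound fun _ => k :=
  ⟨monotone_const, .C k, by simp⟩

theorem PolyBound.id : PolyBound fun m => m :=
  ⟨monotone_id, .X, by simp⟩

theorem PolyBound.add {a b : ℕ → ℕ} (ha : PolyBound a) (hb : PolyBound b) :
    PolyBound fun m => a m + b m := by
  obtain ⟨ha, p, hp⟩ := ha
  obtain ⟨hb, q, hq⟩ := hb
  exact ⟨ha.add hb, p + q, fun m => by simpa using add_le_add (hp m) (hq m)⟩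

theorem PolyBound.mul {a b : ℕ → ℕ} (ha : PolyBound a) (hb : PolyBound b) :
    PolyBound fun m => a m * b m := by
  obtain ⟨ha, p, hp⟩ := ha
  obtain ⟨hb, q, hq⟩ := hb
  exact ⟨ha.mul' hb, p * q, fun m => by simpa using Nat.mul_le_mul (hp m) (hq m)⟩

theorem PolyBound.comp {a b : ℕ → ℕ} (ha : PolyBound a) (hb : PolyBound b) :
    PolyBound fun m => a (b m) := by
  obtain ⟨ha, p, hp⟩ := ha
  obtain ⟨hb, q, hq⟩ := hb
  exact ⟨ha.comp hb, p.comp q, fun m => by simpa using (ha (hq m)).trans (hp _)⟩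

/-! ### Trees as lists -/

namespace Data

/-- Every tree is a list of trees. -/
def toList : Data → List Data
  | nil => []
  | cons a b => a :: toList b

@[simp] theorem toList_nil : toList nil = [] := rfl

@[simp] theorem toList_cons (a b : Data) : toList (cons a b) = a :: toList b := rfl

@[simp] theorem ofList_nil : ofList [] = nil := rfl

@[simp] theorem ofList_cons (a : Data) (l : List Data) : ofList (a :: l) = cons a (ofList l) := rfl

@[simp] theorem toList_ofList (l : List Data) : toList (ofList l) = l := by
  induction l with
  | nil => rfl
  | cons a l ih => simp [ih]

@[simp] theorem ofList_toList (d : Data) : ofList (toList d) = d := by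
  induction d with
  | nil => rfl
  | cons a b _ ih => simp [ih]

@[simp] theorem hd_cons (a b : Data) : (cons a b).hd = a := rfl

@[simp] theorem tl_cons (a b : Data) : (cons a b).tl = b := rfl

@[simp] theorem size_nil : size nil = 1 := rfl

@[simp] theorem size_cons (a b : Data) : size (cons a b) = a.size + b.size + 1 := rfl

theorem one_le_size (d : Data) : 1 ≤ d.size := by
  cases d <;> simp

theorem size_hd_le (d : Data) : d.hd.size ≤ d.size := by
  cases d with
  | nil => exact le_rfl
  | cons a b => simp only [hd_cons, size_cons]; omega

theorem size_tl_le (d : Data) : d.tl.size ≤ d.size := by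
  cases d with
  | nil => exact le_rfl
  | cons a b => simp only [tl_cons, size_cons]; omega

theorem size_ofList (l : List Data) : (ofList l).size = (l.map fun a => a.size + 1).sum + 1 := by
  induction l with
  | nil => rfl
  | cons a l ih => simp [ih]; omega

theorem size_lt_of_mem {a : Data} {d : Data} (h : a ∈ d.toList) : a.size < d.size := by
  induction d with
  | nil => simp at h
  | cons b c _ ih =>
    rw [toList_cons, List.mem_cons] at h
    rcases h with rfl | h
    · simp only [size_cons]; omega
    · have := ih h; simp only [size_cons]; omega

theorem length_toList_lt (d : Data) : d.toList.length < d.size := by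
  induction d with
  | nil => simp
  | cons b c _ ih => have := one_le_size b; simp; omega

theorem size_ofList_le_of_forall {l : List Data} {k : ℕ} (h : ∀ a ∈ l, a.size ≤ k) :
    (ofList l).size ≤ l.length * (k + 1) + 1 := by
  rw [size_ofList]
  have := List.sum_le_card_nsmul (l.map fun a => a.size + 1) (k + 1) (by simpa using h)
  simpa using this

theorem size_ofList_le_of_sublist {l l' : List Data} (h : l.Sublist l') :
    (ofList l).size ≤ (ofList l').size := by
  rw [size_ofList, size_ofList]
  exact Nat.add_le_add_right ((h.map _).sum_le_sum (by simp)) _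

theorem size_ofList_reverse (l : List Data) : (ofList l.reverse).size = (ofList l).size := by
  rw [size_ofList, size_ofList, List.map_reverse, List.sum_reverse]

/-- The truth value of a proposition. -/
noncomputable def ofProp (p : Prop) : Data :=
  open Classical in if p then cons nil nil else nil

theorem ofProp_eq_nil {p : Prop} : ofProp p = nil ↔ ¬ p := by
  unfold ofProp; split_ifs <;> simp_all

theorem size_ofProp_le (p : Prop) : (ofProp p).size ≤ 3 := by
  unfold ofProp; split_ifs <;> simp

/-- A choice between two trees. -/
noncomputable def ite (p : Prop) (a b : Data) : Data :=
  open Classical in if p then a else b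

theorem ite_pos {p : Prop} (hp : p) (a b : Data) : ite p a b = a := if_pos hp

theorem ite_neg {p : Prop} (hp : ¬ p) (a b : Data) : ite p a b = b := if_neg hp

/-- The members of `l` that satisfy `P`. -/
noncomputable def filter (l : Data) (P : Data → Prop) : Data :=
  open Classical in ofList (l.toList.filter fun a => P a)

theorem filter_toList_sublist (l : Data) (P : Data → Prop) :
    (filter l P).toList.Sublist l.toList := by
  rw [filter, toList_ofList]
  exact List.filter_sublist

theorem mem_filter {l : Data} {P : Data → Prop} {a : Data} :
    a ∈ (filter l P).toList ↔ a ∈ l.toList ∧ P a := by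
  simp [filter]

theorem hd_mem_of_ne_nil {l : Data} (h : l.hd ≠ nil) : l.hd ∈ l.toList := by
  cases l with
  | nil => exact absurd rfl h
  | cons a b => simp

theorem size_le_hd_add_tl (d : Data) : d.size ≤ d.hd.size + d.tl.size + 1 := by
  cases d with
  | nil => simp [hd, tl]
  | cons a b => exact le_rfl

theorem size_le_of_sublist {l l' : Data} (h : l.toList.Sublist l'.toList) : l.size ≤ l'.size := by
  have := size_ofList_le_of_sublist h
  rwa [ofList_toList, ofList_toList] at this

theorem ofBool_eq_ofProp (b : Bool) : ofBool b = ofProp (b = true) := by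
  cases b <;> simp [ofBool, ofProp]

end Data

/-! ### Runs of programs with a single variable -/

open Data

/-- The store of a program with a single variable. -/
def store (v : Data) : Fin 1 → Data := fun _ => v

theorem storeSize_store (v : Data) : storeSize (store v) = v.size := by
  simp [storeSize, store]

theorem update_store (v w : Data) : Function.update (store v) 0 w = store w := by
  funext i
  simp [Subsingleton.elim i 0, store]

/-- `c` takes the value `v` to `w` without output, in at most `N` steps and space `S`. -/
def Silent (c : Prog (Fin 1)) (v w : Data) (S N : ℕ) : Prop :=
  ∃ tr, Run c (store v) tr (store w) ∧ (∀ y ∈ tr, y.out = none ∧ y.size ≤ S) ∧ tr.length ≤ N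

theorem Silent.mono {c : Prog (Fin 1)} {v w : Data} {S N S' N' : ℕ} (h : Silent c v w S N)
    (hS : S ≤ S') (hN : N ≤ N') : Silent c v w S' N' := by
  obtain ⟨tr, h1, h2, h3⟩ := h
  exact ⟨tr, h1, fun y hy => ⟨(h2 y hy).1, (h2 y hy).2.trans hS⟩, h3.trans hN⟩

theorem Silent.assign (a : Expr (Fin 1)) (v : Data) :
    Silent (.assign 0 a) v (a.eval (store v)) v.size 1 := by
  refine ⟨_, update_store v _ ▸ Run.assign 0 a (store v), ?_, by simp⟩
  simp [storeSize_store]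

theorem Silent.seq {c d : Prog (Fin 1)} {u v w : Data} {S N N' : ℕ} (h : Silent c u v S N)
    (h' : Silent d v w S N') : Silent (.seq c d) u w S (N + N') := by
  obtain ⟨tr, h1, h2, h3⟩ := h
  obtain ⟨tr', h1', h2', h3'⟩ := h'
  refine ⟨_, .seq _ _ _ _ _ _ _ h1 h1', fun y hy => ?_, by simp; omega⟩
  exact (List.mem_append.1 hy).elim (h2 y) (h2' y)

theorem Silent.cond_true {a : Expr (Fin 1)} {c d : Prog (Fin 1)} {v w : Data} {S N : ℕ}
    (ha : a.eval (store v) ≠ .nil) (h : Silent c v w S N) (hS : v.size ≤ S) :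
    Silent (.cond a c d) v w S (N + 1) := by
  obtain ⟨tr, h1, h2, h3⟩ := h
  refine ⟨_, .cond_true _ _ _ _ _ _ ha h1, fun y hy => ?_, by simpa using h3⟩
  rcases List.mem_cons.1 hy with rfl | hy
  · simpa [storeSize_store] using hS
  · exact h2 y hy

theorem Silent.cond_false {a : Expr (Fin 1)} {c d : Prog (Fin 1)} {v w : Data} {S N : ℕ}
    (ha : a.eval (store v) = .nil) (h : Silent d v w S N) (hS : v.size ≤ S) :
    Silent (.cond a c d) v w S (N + 1) := by
  obtain ⟨tr, h1, h2, h3⟩ := h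
  refine ⟨_, .cond_false _ _ _ _ _ _ ha h1, fun y hy => ?_, by simpa using h3⟩
  rcases List.mem_cons.1 hy with rfl | hy
  · simpa [storeSize_store] using hS
  · exact h2 y hy

theorem Silent.loop_true {a : Expr (Fin 1)} {c : Prog (Fin 1)} {u v w : Data} {S N N' : ℕ}
    (ha : a.eval (store u) ≠ .nil) (h : Silent c u v S N) (h' : Silent (.loop a c) v w S N')
    (hS : u.size ≤ S) : Silent (.loop a c) u w S (N + 1 + N') := by
  obtain ⟨tr, h1, h2, h3⟩ := h
  obtain ⟨tr', h1', h2', h3'⟩ := h'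
  refine ⟨_, .loop_true _ _ _ _ _ _ _ ha h1 h1', fun y hy => ?_, by simp; omega⟩
  rcases List.mem_cons.1 hy with rfl | hy
  · simpa [storeSize_store] using hS
  · exact (List.mem_append.1 hy).elim (h2 y) (h2' y)

theorem Silent.loop_false {a : Expr (Fin 1)} {c : Prog (Fin 1)} {v : Data}
    (ha : a.eval (store v) = .nil) : Silent (.loop a c) v v v.size 1 :=
  ⟨_, .loop_false _ _ _ ha, by simp [storeSize_store], by simp⟩

/-! ### Functions computable in polynomial time. -/

/-- The program `c` replaces the top `x` of the stack by `f x`, in steps and space bounded by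
`b`. -/
def Implements (c : Prog (Fin 1)) (f : Data → Data) (b : ℕ → ℕ) : Prop :=
  ∀ x r, Silent c (.cons x r) (.cons (f x) r) (r.size + b x.size) (b x.size)

/-- The function `f` is computed in polynomial time. -/
def Comp (f : Data → Data) : Prop :=
  ∃ c b, PolyBound b ∧ Implements c f b ∧ ∀ x, (f x).size ≤ b x.size

/-- The predicate `P` is decided in polynomial time. -/
def CompP (P : Data → Prop) : Prop :=
  Comp fun x => .ofProp (P x)

theorem Comp.of_expr {f : Data → Data} (a : Expr (Fin 1)) {k : ℕ}
    (ha : ∀ x r, a.eval (store (.cons x r)) = f x) (hf : ∀ x, (f x).size ≤ x.size + k) :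
    Comp f := by
  refine ⟨.assign 0 (.cons a (.tl (.var 0))), fun m => m + (k + 1),
    PolyBound.id.add (.const _), fun x r => ?_, fun x => (hf x).trans (by beta_reduce; omega)⟩
  beta_reduce
  have := Silent.assign (.cons a (.tl (.var 0))) (.cons x r)
  simp only [Expr.eval, ha] at this
  exact this.mono (by simp only [size_cons]; omega) (by omega)

theorem Comp.exists_bound {f : Data → Data} (hf : Comp f) :
    ∃ b, PolyBound b ∧ ∀ x, (f x).size ≤ b x.size :=
  let ⟨_, b, hb, _, hs⟩ := hf
  ⟨b, hb, hs⟩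

theorem Comp.id : Comp fun x => x :=
  .of_expr (k := 0) (.hd (.var 0)) (fun _ _ => rfl) (fun _ => le_rfl)

theorem Comp.nil : Comp fun _ => .nil :=
  .of_expr (k := 1) .nil (fun _ _ => rfl) (fun _ => by simp)

theorem Comp.comp {f g : Data → Data} (hf : Comp f) (hg : Comp g) : Comp fun x => f (g x) := by
  obtain ⟨c, b, hb, hc, hs⟩ := hf
  obtain ⟨c', b', hb', hc', hs'⟩ := hg
  refine ⟨.seq c' c, fun m => b' m + b (b' m), hb'.add (hb.comp hb'), fun x r => ?_, fun x => ?_⟩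
  · have h := hb.1 (hs' x)
    beta_reduce
    exact ((hc' x r).mono (by omega) le_rfl).seq ((hc (g x) r).mono (by omega) h)
  · exact (hs _).trans ((hb.1 (hs' x)).trans (by beta_reduce; omega))

theorem Comp.hd {f : Data → Data} (hf : Comp f) : Comp fun x => (f x).hd :=
  Comp.comp (f := Data.hd) (.of_expr (k := 0) (.hd (.hd (.var 0))) (fun _ _ => rfl) size_hd_le) hf

theorem Comp.tl {f : Data → Data} (hf : Comp f) : Comp fun x => (f x).tl :=
  Comp.comp (f := Data.tl) (.of_expr (k := 0) (.tl (.hd (.var 0))) (fun _ _ => rfl) size_tl_le) hf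

/-- The single variable holds a stack whose lower part a subprogram leaves alone. So x is
duplicated, the first program runs on the copy, its result is swapped below x, the second program
runs, and the two results are paired. -/
theorem Comp.cons {f g : Data → Data} (hf : Comp f) (hg : Comp g) :
    Comp fun x => .cons (f x) (g x) := by
  obtain ⟨c, b, hb, hc, hs⟩ := hf
  obtain ⟨c', b', hb', hc', hs'⟩ := hg
  refine ⟨.seq (.assign 0 (.cons (.hd (.var 0)) (.var 0))) (.seq c
    (.seq (.assign 0 (.cons (.hd (.tl (.var 0))) (.cons (.hd (.var 0)) (.tl (.tl (.var 0))))))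
      (.seq c' (.assign 0 (.cons (.cons (.hd (.tl (.var 0))) (.hd (.var 0)))
        (.tl (.tl (.var 0)))))))), fun m => (b m + b' m) + (m + 6), (hb.add hb').add
        (PolyBound.id.add (.const _)), fun x r => ?_, fun x => ?_⟩
  · have h1 := hs x
    have h2 := hs' x
    have s1 := Silent.assign (.cons (.hd (.var 0)) (.var 0)) (.cons x r)
    have s2 := hc x (.cons x r)
    have s3 := Silent.assign (.cons (.hd (.tl (.var 0))) (.cons (.hd (.var 0))
      (.tl (.tl (.var 0))))) (.cons (f x) (.cons x r))
    have s4 := hc' x (.cons (f x) r)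
    have s5 := Silent.assign (.cons (.cons (.hd (.tl (.var 0))) (.hd (.var 0)))
        (.tl (.tl (.var 0)))) (.cons (g x) (.cons (f x) r))
    simp only [Expr.eval, store, Data.hd, Data.tl, Data.size] at s1 s2 s3 s4 s5
    refine Silent.mono (Silent.seq (s1.mono ?_ le_rfl) (.seq (s2.mono ?_ le_rfl)
      (.seq (s3.mono ?_ le_rfl) (.seq (s4.mono ?_ le_rfl) (s5.mono ?_ le_rfl)))))
      (S := r.size + (b x.size + b' x.size + (x.size + 6))) ?_ ?_
    all_goals beta_reduce; omega
  · have h1 := hs x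
    have h2 := hs' x
    simp only [Data.size]
    omega

theorem CompP.eq {f g : Data → Data} (hf : Comp f) (hg : Comp g) : CompP fun x => f x = g x := by
  have h : Comp fun x => .ofProp (x.hd = x.tl) := by
    refine .of_expr (k := 3) (.eq (.hd (.hd (.var 0))) (.tl (.hd (.var 0)))) (fun x r => ?_)
      (fun x => (size_ofProp_le _).trans (by omega))
    simp only [Expr.eval, store, ofBool_eq_ofProp, hd_cons]
    exact congrArg ofProp (propext decide_eq_true_iff)
  exact h.comp (hf.cons hg)

theorem Comp.ite {P : Data → Prop} {f g : Data → Data} (hP : CompP P) (hf : Comp f)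
    (hg : Comp g) : Comp fun x => .ite (P x) (f x) (g x) := by
  obtain ⟨cp, bp, hbp, hcp, -⟩ := hP
  obtain ⟨c, b, hb, hc, hs⟩ := hf
  obtain ⟨c', b', hb', hc', hs'⟩ := hg
  refine ⟨.seq (.assign 0 (.cons (.hd (.var 0)) (.var 0))) (.seq cp (.cond (.hd (.var 0))
    (.seq (.assign 0 (.tl (.var 0))) c) (.seq (.assign 0 (.tl (.var 0))) c'))),
    fun m => bp m + (b m + b' m) + (m + 6), (hbp.add (hb.add hb')).add
      (PolyBound.id.add (.const _)), fun x r => ?_, fun x => ?_⟩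
  · have s1 := Silent.assign (.cons (.hd (.var 0)) (.var 0)) (.cons x r)
    have s2 := hcp x (.cons x r)
    have s3 := Silent.assign (.tl (.var 0)) (.cons (.ofProp (P x)) (.cons x r))
    have h3 := size_ofProp_le (P x)
    simp only [Expr.eval, store, Data.hd, Data.tl, Data.size] at s1 s2 s3
    by_cases h : P x
    · have s4 := hc x r
      simp only [Data.ite_pos h]
      simp only [h] at s2 s3 h3
      refine Silent.mono (Silent.seq (s1.mono ?_ le_rfl) (.seq (s2.mono ?_ le_rfl)
        (.cond_true ?_ (.seq (s3.mono ?_ le_rfl) (s4.mono ?_ le_rfl)) ?_)))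
        (S := r.size + (bp x.size + (b x.size + b' x.size) + (x.size + 6))) ?_ ?_
      case refine_3 => simpa [Expr.eval, store] using fun h' => ofProp_eq_nil.1 h' trivial
      all_goals try simp only [Data.size]
      all_goals omega
    · have s4 := hc' x r
      simp only [Data.ite_neg h]
      simp only [h] at s2 s3 h3
      refine Silent.mono (Silent.seq (s1.mono ?_ le_rfl) (.seq (s2.mono ?_ le_rfl)
        (.cond_false ?_ (.seq (s3.mono ?_ le_rfl) (s4.mono ?_ le_rfl)) ?_)))
        (S := r.size + (bp x.size + (b x.size + b' x.size) + (x.size + 6))) ?_ ?_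
      case refine_3 => simpa [Expr.eval, store] using ofProp_eq_nil.2 not_false
      all_goals try simp only [Data.size]
      all_goals omega
  · have h1 := hs x
    have h2 := hs' x
    by_cases h : P x
    · simp only [Data.ite_pos h]; omega
    · simp only [Data.ite_neg h]; omega

/-- Polynomial time is not preserved by iteration in general, since sizes may compound. The number
of rounds and the sizes of all intermediate values are therefore bounded beforehand by one
polynomial in the size of the input. -/
theorem Comp.loop {g s : Data → Data} (hg : Comp g) (hs : Comp s) {N : Data → ℕ} {b : ℕ → ℕ}
    (hb : PolyBound b) (hN : ∀ x, N x ≤ b x.size)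
    (hrun : ∀ x, ∀ i < N x, (g^[i] (s x)).hd ≠ .nil) (hhalt : ∀ x, (g^[N x] (s x)).hd = .nil)
    (hsize : ∀ x, ∀ i ≤ N x, (g^[i] (s x)).size ≤ b x.size) : Comp fun x => g^[N x] (s x) := by
  obtain ⟨c, bg, hbg, hc, -⟩ := hg
  obtain ⟨c', bs, hbs, hc', -⟩ := hs
  refine ⟨.seq c' (.loop (.hd (.hd (.var 0))) c),
    fun m => bs m + (b m + 1 + bg (b m)) + (b m * (bg (b m) + 1) + 1), (hbs.add ((hb.add
      (.const _)).add (hbg.comp hb))).add ((hb.mul ((hbg.comp hb).add (.const _))).add (.const _)),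
    fun x r => ?_, fun x => ?_⟩
  · have key : ∀ k ≤ N x, Silent (.loop (.hd (.hd (.var 0))) c) (.cons (g^[N x - k] (s x)) r)
        (.cons (g^[N x] (s x)) r) (r.size + (b x.size + 1 + bg (b x.size)))
        (k * (bg (b x.size) + 1) + 1) := by
      intro k
      induction k with
      | zero =>
        intro _
        have h1 := hsize x (N x) le_rfl
        rw [Nat.sub_zero]
        refine (Silent.loop_false ?_).mono ?_ (by omega)
        · simpa [Expr.eval, store] using hhalt x
        · simp only [Data.size]; omega
      | succ k ih =>
        intro hk
        have h1 := hsize x (N x - (k + 1)) (by omega)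
        have h2 := hbg.1 h1
        have h3 := (hc (g^[N x - (k + 1)] (s x)) r).mono
          (S' := r.size + (b x.size + 1 + bg (b x.size))) (by omega) h2
        rw [← Function.iterate_succ_apply' g, show (N x - (k + 1)).succ = N x - k by omega] at h3
        refine (Silent.loop_true ?_ h3 (ih (by omega)) ?_).mono le_rfl (le_of_eq (by ring))
        · simpa [Expr.eval, store] using hrun x (N x - (k + 1)) (by omega)
        · simp only [Data.size]; omega
    have h1 := key (N x) le_rfl
    rw [Nat.sub_self] at h1
    have h2 := Nat.mul_le_mul_right (bg (b x.size) + 1) (hN x)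
    beta_reduce
    exact (((hc' x r).mono (by omega) le_rfl).seq (h1.mono (by omega) le_rfl)).mono le_rfl
      (by omega)
  · have := hsize x (N x) le_rfl
    dsimp only
    omega

/-! ### List processing in polynomial time -/

/-- The loop carries the rest of the list, the original input x as a parameter and the accumulator;
it stops when the rest is empty. -/
theorem Comp.foldl {l init : Data → Data} {h : Data → Data → Data → Data} (hl : Comp l)
    (hi : Comp init) (hh : Comp fun y => h y.hd y.tl.hd y.tl.tl) {b : ℕ → ℕ} (hb : PolyBound b)
    (hsize : ∀ x p, p <+: (l x).toList →
      (p.foldl (fun acc a => h a x acc) (init x)).size ≤ b x.size) :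
    Comp fun x => (l x).toList.foldl (fun acc a => h a x acc) (init x) := by
  obtain ⟨bl, hbl, hsl⟩ := hl.exists_bound
  let g : Data → Data := fun y =>
    .cons y.hd.tl (.cons y.tl.hd (h y.hd.hd y.tl.hd y.tl.tl))
  have hg : Comp g := Comp.id.hd.tl.cons (Comp.id.tl.hd.cons
    (hh.comp (g := fun y => .cons y.hd.hd y.tl) (Comp.id.hd.hd.cons Comp.id.tl)))
  have hiter : ∀ (x : Data) (q p : List Data) (acc : Data),
      g^[p.length] (.cons (ofList (p ++ q)) (.cons x acc)) =
        .cons (ofList q) (.cons x (p.foldl (fun acc a => h a x acc) acc)) := by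
    intro x q p
    induction p with
    | nil => intro acc; rfl
    | cons a p ih =>
      intro acc
      rw [List.length_cons, Function.iterate_succ_apply, List.foldl_cons, ← ih]
      rfl
  have hit : ∀ x, ∀ i ≤ (l x).toList.length, g^[i] (.cons (l x) (.cons x (init x))) =
      .cons (ofList ((l x).toList.drop i)) (.cons x
        (((l x).toList.take i).foldl (fun acc a => h a x acc) (init x))) := by
    intro x i hi
    have := hiter x ((l x).toList.drop i) ((l x).toList.take i) (init x)
    rwa [List.take_append_drop, ofList_toList, List.length_take_of_le hi] at this
  have := (Comp.loop hg (hl.cons (Comp.id.cons hi)) (N := fun x => (l x).toList.length)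
    (b := fun m => bl m + (m + b m + 2)) (hbl.add ((PolyBound.id.add hb).add (.const _)))
    (fun x => ?_) (fun x i hi => ?_) (fun x => ?_) (fun x i hi => ?_)).tl.tl
  · convert this using 2 with x
    rw [hit x _ le_rfl]
    simp
  · have h1 := length_toList_lt (l x)
    have h2 := hsl x
    omega
  -- The loop tests the rest of the list as a tree, and a non-empty list is not `nil`.
  · rw [hit x i hi.le, hd_cons]
    cases h' : (l x).toList.drop i with
    | nil => rw [List.drop_eq_nil_iff] at h'; omega
    | cons a t => simp
  · rw [hit x _ le_rfl]
    simp
  · rw [hit x i hi]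
    have h1 := size_ofList_le_of_sublist (List.drop_sublist i (l x).toList)
    have h2 := hsize x _ (List.take_prefix i (l x).toList)
    have h3 := hsl x
    rw [ofList_toList] at h1
    simp only [Data.size]
    omega

theorem foldl_cons_eq (l : List Data) (acc : Data) :
    l.foldl (fun acc a => .cons a acc) acc = ofList (l.reverse ++ acc.toList) := by
  induction l generalizing acc with
  | nil => simp
  | cons a l ih => simp [ih]

theorem Comp.reverse {l : Data → Data} (hl : Comp l) :
    Comp fun x => ofList (l x).toList.reverse := by
  obtain ⟨b, hb, hs⟩ := hl.exists_bound
  have := Comp.foldl (h := fun a _ acc => .cons a acc) hl .nil (Comp.id.hd.cons Comp.id.tl.tl)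
    hb fun x p hp => by
      rw [foldl_cons_eq, toList_nil, List.append_nil, size_ofList_reverse]
      refine (size_ofList_le_of_sublist hp.sublist).trans ?_
      rw [ofList_toList]
      exact hs x
  simpa only [foldl_cons_eq, toList_nil, List.append_nil] using this

theorem Comp.map {l : Data → Data} {f : Data → Data → Data} (hl : Comp l)
    (hf : Comp fun y => f y.hd y.tl) :
    Comp fun x => ofList ((l x).toList.map fun a => f a x) := by
  obtain ⟨bl, hbl, hsl⟩ := hl.exists_bound
  obtain ⟨bf, hbf, hsf⟩ := hf.exists_bound
  have hfold : ∀ x p, List.foldl (fun acc a => Data.cons (f a x) acc) .nil p =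
      ofList (p.map fun a => f a x).reverse := by
    intro x p
    have := foldl_cons_eq (p.map fun a => f a x) .nil
    rwa [List.foldl_map, toList_nil, List.append_nil] at this
  have := (Comp.foldl (h := fun a x acc => .cons (f a x) acc) hl .nil
    ((hf.comp (g := fun y => .cons y.hd y.tl.hd) (Comp.id.hd.cons Comp.id.tl.hd)).cons
      Comp.id.tl.tl) (b := fun m => bl m * (bf (bl m + m + 1) + 1) + 1)
      ((hbl.mul ((hbf.comp ((hbl.add .id).add (.const _))).add (.const _))).add (.const _))
      fun x p hp => ?_).reverse
  · simpa only [hfold, toList_ofList, List.reverse_reverse] using this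
  · rw [hfold, size_ofList_reverse]
    have h1 : p.length ≤ bl x.size :=
      hp.length_le.trans ((length_toList_lt (l x)).le.trans (hsl x))
    refine (size_ofList_le_of_forall (k := bf (bl x.size + x.size + 1)) ?_).trans ?_
    · simp only [List.mem_map]
      rintro _ ⟨a, ha, rfl⟩
      refine (hsf (.cons a x)).trans (hbf.1 ?_)
      have h2 := size_lt_of_mem (hp.subset ha)
      have h3 := hsl x
      simp only [Data.size]
      omega
    · rw [List.length_map]
      exact Nat.add_le_add_right (Nat.mul_le_mul_right _ h1) _

theorem CompP.iff {P Q : Data → Prop} (hP : CompP P) (h : ∀ x, P x ↔ Q x) : CompP Q := by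
  rwa [show Q = P from funext fun x => propext (h x).symm]

theorem CompP.not {P : Data → Prop} (hP : CompP P) : CompP fun x => ¬ P x :=
  (CompP.eq hP .nil).iff fun _ => ofProp_eq_nil

theorem Comp.ofProp_true : Comp fun _ => .ofProp True := by
  have : Comp fun _ => .cons .nil .nil := Comp.nil.cons Comp.nil
  simpa [ofProp] using this

theorem CompP.ite {P Q R : Data → Prop} (hP : CompP P) (hQ : CompP Q) (hR : CompP R) :
    CompP fun x => (P x ∧ Q x) ∨ (¬ P x ∧ R x) := by
  have := Comp.ite hP hQ hR
  refine (congrArg Comp (funext fun x => ?_)).mp this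
  by_cases h : P x
  · rw [Data.ite_pos h]; simp [h]
  · rw [Data.ite_neg h]; simp [h]

theorem CompP.false : CompP fun _ => False := by
  have : Comp fun _ => .nil := Comp.nil
  simpa [CompP, ofProp] using this

theorem CompP.and {P Q : Data → Prop} (hP : CompP P) (hQ : CompP Q) : CompP fun x => P x ∧ Q x :=
  (hP.ite hQ .false).iff fun x => by tauto

theorem CompP.or {P Q : Data → Prop} (hP : CompP P) (hQ : CompP Q) : CompP fun x => P x ∨ Q x :=
  (hP.ite .ofProp_true hQ).iff fun x => by tauto

theorem CompP.exists {l : Data → Data} {P : Data → Data → Prop} (hl : Comp l)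
    (hP : CompP fun y => P y.hd y.tl) : CompP fun x => ∃ a ∈ (l x).toList, P a x := by
  have hfold : ∀ x p q, List.foldl (fun acc a => Data.ofProp (P a x ∨ acc ≠ .nil)) (.ofProp q) p =
      .ofProp (q ∨ ∃ a ∈ p, P a x) := by
    intro x p
    induction p with
    | nil => simp
    | cons a p ih =>
      intro q
      rw [List.foldl_cons, ih, List.exists_mem_cons_iff]
      congr 1
      rw [ne_eq, ofProp_eq_nil, not_not, eq_iff_iff]
      tauto
  have := Comp.foldl (h := fun a x acc => .ofProp (P a x ∨ acc ≠ .nil)) hl CompP.false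
    (CompP.or (Comp.comp (f := fun y => .ofProp (P y.hd y.tl)) hP (Comp.id.hd.cons Comp.id.tl.hd))
      (CompP.eq Comp.id.tl.tl .nil).not) (.const 3) fun x p _ => by
        rw [hfold]; exact size_ofProp_le _
  simp only [hfold, false_or] at this
  exact this

theorem CompP.forall {l : Data → Data} {P : Data → Data → Prop} (hl : Comp l)
    (hP : CompP fun y => P y.hd y.tl) : CompP fun x => ∀ a ∈ (l x).toList, P a x :=
  (CompP.exists (P := fun a x => ¬ P a x) hl hP.not).not.iff fun x => by push Not; rfl

theorem CompP.mem {f l : Data → Data} (hf : Comp f) (hl : Comp l) :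
    CompP fun x => f x ∈ (l x).toList :=
  (CompP.exists (P := fun a x => a = f x) hl (.eq Comp.id.hd (hf.comp Comp.id.tl))).iff
    fun x => by simp

open Classical in
theorem Comp.filter {l : Data → Data} {P : Data → Data → Prop} (hl : Comp l)
    (hP : CompP fun y => P y.hd y.tl) :
    Comp fun x => .filter (l x) fun a => P a x := by
  obtain ⟨bl, hbl, hsl⟩ := hl.exists_bound
  have hfold : ∀ x p acc, List.foldl (fun acc a => .ite (P a x) (Data.cons a acc) acc) acc p =
      ofList ((p.filter fun a => P a x).reverse ++ acc.toList) := by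
    intro x p
    induction p with
    | nil => simp
    | cons a p ih =>
      intro acc
      rw [List.foldl_cons, ih, List.filter_cons]
      by_cases h : P a x
      · simp [h, Data.ite_pos]
      · simp [h, Data.ite_neg]
  have := (Comp.foldl (h := fun a x acc => .ite (P a x) (.cons a acc) acc) hl .nil
    (.ite (P := fun y => P y.hd y.tl.hd) (Comp.comp (f := fun y => .ofProp (P y.hd y.tl)) hP
      (Comp.id.hd.cons Comp.id.tl.hd)) (Comp.id.hd.cons Comp.id.tl.tl) Comp.id.tl.tl) hbl
      fun x p hp => ?_).reverse
  · simp only [hfold, toList_nil, List.append_nil, toList_ofList, List.reverse_reverse] at this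
    exact this
  · rw [hfold, toList_nil, List.append_nil, size_ofList_reverse]
    refine (size_ofList_le_of_sublist (List.filter_sublist.trans hp.sublist)).trans ?_
    rw [ofList_toList]
    exact hsl x

/-- Iterating `f` as often as the list `l` is long. -/
theorem Comp.iterate {l init : Data → Data} {f : Data → Data → Data} (hl : Comp l)
    (hi : Comp init) (hf : Comp fun y => f y.tl y.hd) {b : ℕ → ℕ} (hb : PolyBound b)
    (hsize : ∀ x, ∀ i ≤ (l x).toList.length, ((f x)^[i] (init x)).size ≤ b x.size) :
    Comp fun x => (f x)^[(l x).toList.length] (init x) := by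
  have := Comp.foldl (h := fun _ x acc => f x acc) hl hi
    (hf.comp (g := fun y => .cons y.tl.tl y.tl.hd) (Comp.id.tl.tl.cons Comp.id.tl.hd)) hb fun x p hp => by
    rw [List.foldl_const]
    exact hsize x _ hp.length_le
  simpa only [List.foldl_const] using this

end ChordalEnum

namespace ChordalEnum

open Data

/-! ### The algorithm on trees -/

namespace Data

/-- The pair `uv` is listed in `E` or in `F`. -/
def Adj (E F u v : Data) : Prop :=
  cons u v ∈ E.toList ∨ cons v u ∈ E.toList ∨ cons u v ∈ F.toList ∨ cons v u ∈ F.toList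

/-- The members of the pair `s` are common neighbours of the members of the pair `e`. -/
def Common (E F e s : Data) : Prop :=
  (Adj E F e.hd s.hd ∧ Adj E F e.tl s.hd) ∧ Adj E F e.hd s.tl ∧ Adj E F e.tl s.tl

/-- No pair outside `E` and `F` is a pair of common neighbours of the members of `e`. -/
def Removable (N E F e : Data) : Prop :=
  ∀ s ∈ N.toList, s ∈ F.toList ∨ ¬ Common E F e s

/-- The lists are kept in the order of L, so the smallest candidate is the head of the filtered
list. If there is none the head is `nil`, which encodes no pair. -/
noncomputable def minCand (N E F X : Data) : Data :=
  (filter F fun e => e ∈ X.toList ∧ Removable N E F e).hd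

/-- One deletion in the set `s.hd`; deleted elements are collected in `s.tl`. -/
noncomputable def delStep (N E X s : Data) : Data :=
  ite (minCand N E s.hd X = nil) s
    (cons (filter s.hd (· ≠ minCand N E s.hd X)) (cons (minCand N E s.hd X) s.tl))

/-- As many rounds as F has elements suffice: each effective round deletes one, and once no
candidate is left `delStep` does nothing. -/
noncomputable def delRun (N E F X : Data) : Data :=
  (delStep N E X)^[F.toList.length] (cons F nil)

noncomputable def del (N E F X : Data) : Data :=
  (delRun N E F X).hd

/-- The reversal is needed because deleted elements are pushed on the front. -/
noncomputable def can (N E F : Data) : Data :=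
  ofList (delRun N E N (filter N (· ∉ F.toList))).tl.toList.reverse

noncomputable def flip (N E F e : Data) : Data :=
  filter N fun s => (s ≠ e ∧ s ∈ F.toList) ∨ Common E F e s

noncomputable def succ (N E F e : Data) : Data :=
  del N E (flip N E F e) (flip N E F e)

noncomputable def root (N E : Data) : Data :=
  del N E N N

noncomputable def nextStep (N E F C : Data) : Data :=
  succ N E C (filter (can N E F) (· ∉ (filter N (· ∉ C.toList)).toList)).hd

/-- A step along the canonical path of `F`: `s.tl` is the current completion and `s.hd` the
previous one. -/
noncomputable def parentStep (N E F s : Data) : Data :=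
  ite (s.tl = F) s (cons s.tl (nextStep N E F s.tl))

/-- As many rounds as there are non-edges suffice, because proximity grows along a canonical path.
For the root the value is the default `nil`, which also encodes the empty completion. -/
noncomputable def parent (N E F : Data) : Data :=
  ((parentStep N E F)^[N.toList.length] (cons nil (root N E))).hd

noncomputable def dedup (l : Data) : Data :=
  l.toList.foldl (fun acc a => ite (a ∈ acc.toList) acc (cons a acc)) nil

/-- Different edges may have the same successor, and moving to the next sibling requires a list
without repetitions. The test against the root excludes the default value of `parent` there. -/
noncomputable def children (N E F : Data) : Data :=
  dedup (filter (ofList (F.toList.map fun e => succ N E F e))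
    fun K => K ≠ root N E ∧ parent N E K = F)

/-- The tail of `l` after the first occurrence of `K`. -/
noncomputable def after (l K : Data) : Data :=
  ((fun m => ite (m.hd = K) m m.tl)^[l.toList.length] l).tl

/-- A state of the traversal: the completion `F` is entered (`m = p`: it is output) or left. -/
def state (m p F N E : Data) : Data :=
  cons (cons nil nil) (cons m (cons p (cons F (cons N E))))

noncomputable def enterStep (p F N E : Data) : Data :=
  ite (children N E F = nil) (state nil p F N E)
    (state (ofProp True) (ofProp (p = nil)) (children N E F).hd N E)

/-- The next sibling is found by recomputing the parent and its list of children, so the space does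
not depend on the depth of the recursion. Parity is kept for a sibling and reversed for the parent.
-/
noncomputable def leaveStep (p F N E : Data) : Data :=
  ite (F = root N E) nil (ite (after (children N E (parent N E F)) F = nil)
    (state nil (ofProp (p = nil)) (parent N E F) N E)
    (state (ofProp True) p (after (children N E (parent N E F)) F).hd N E))

noncomputable def step (s : Data) : Data :=
  ite (s.tl.hd = nil)
    (leaveStep s.tl.tl.hd s.tl.tl.tl.hd s.tl.tl.tl.tl.hd s.tl.tl.tl.tl.tl)
    (enterStep s.tl.tl.hd s.tl.tl.tl.hd s.tl.tl.tl.tl.hd s.tl.tl.tl.tl.tl)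

noncomputable def nonEdgeList (x : Data) : Data :=
  ofList ((filter x.tl fun a => a.tl = nil).toList.map hd)

noncomputable def edgeList (x : Data) : Data :=
  ofList ((filter x.tl fun a => a.tl ≠ nil).toList.map hd)

noncomputable def start (x : Data) : Data :=
  state (ofProp True) (ofProp True) (root (nonEdgeList x) (edgeList x)) (nonEdgeList x)
    (edgeList x)

/-! Bounds for the sizes of the values -/

theorem minCand_mem {N E F X : Data} (h : minCand N E F X ≠ nil) :
    minCand N E F X ∈ F.toList ∧ minCand N E F X ∈ X.toList ∧
      Removable N E F (minCand N E F X) :=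
  mem_filter.1 (hd_mem_of_ne_nil h)

theorem delStep_iterate (N E F X : Data) (i : ℕ) :
    ((delStep N E X)^[i] (cons F nil)).hd.toList.Sublist F.toList ∧
      ((delStep N E X)^[i] (cons F nil)).tl.toList.length ≤ i ∧
        ∀ a ∈ ((delStep N E X)^[i] (cons F nil)).tl.toList, a ∈ F.toList := by
  induction i with
  | zero => simp
  | succ i ih =>
    rw [Function.iterate_succ_apply']
    generalize (delStep N E X)^[i] (cons F nil) = s at ih ⊢
    by_cases h : minCand N E s.hd X = nil
    · rw [delStep, ite_pos h]
      exact ⟨ih.1, ih.2.1.trans (by omega), ih.2.2⟩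
    · rw [delStep, ite_neg h]
      refine ⟨(filter_toList_sublist _ _).trans ih.1, by simpa using ih.2.1, ?_⟩
      simp only [tl_cons, toList_cons, List.mem_cons, forall_eq_or_imp]
      exact ⟨ih.1.subset (minCand_mem h).1, ih.2.2⟩

theorem size_delStep_iterate_le (N E F X : Data) {i : ℕ} (hi : i ≤ F.toList.length) :
    ((delStep N E X)^[i] (cons F nil)).size ≤ F.size + (F.size * (F.size + 1) + 2) := by
  obtain ⟨h1, h2, h3⟩ := delStep_iterate N E F X i
  have h4 := size_le_of_sublist h1
  have h5 := size_ofList_le_of_forall fun a ha => (size_lt_of_mem (h3 a ha)).le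
  rw [ofList_toList] at h5
  have h6 := Nat.mul_le_mul_right (F.size + 1) (h2.trans (hi.trans (length_toList_lt F).le))
  have h7 := size_le_hd_add_tl ((delStep N E X)^[i] (cons F nil))
  omega

theorem size_del_le (N E F X : Data) : (del N E F X).size ≤ F.size :=
  size_le_of_sublist (delStep_iterate N E F X _).1

theorem size_succ_le (N E F e : Data) : (succ N E F e).size ≤ N.size :=
  (size_del_le _ _ _ _).trans (size_le_of_sublist (filter_toList_sublist _ _))

theorem size_parentStep_iterate_le (N E F : Data) (i : ℕ) :
    ((parentStep N E F)^[i] (cons nil (root N E))).hd.size ≤ N.size ∧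
      ((parentStep N E F)^[i] (cons nil (root N E))).tl.size ≤ N.size := by
  induction i with
  | zero => exact ⟨one_le_size N, size_del_le _ _ _ _⟩
  | succ i ih =>
    rw [Function.iterate_succ_apply']
    generalize (parentStep N E F)^[i] (cons nil (root N E)) = s at ih ⊢
    by_cases h : s.tl = F
    · rwa [parentStep, ite_pos h]
    · rw [parentStep, ite_neg h]
      exact ⟨ih.2, size_succ_le _ _ _ _⟩

theorem foldl_dedup (p : List Data) (acc : Data) :
    ((p.foldl (fun acc a => ite (a ∈ acc.toList) acc (cons a acc)) acc).toList.length ≤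
      acc.toList.length + p.length) ∧
    (∀ a, a ∈ (p.foldl (fun acc a => ite (a ∈ acc.toList) acc (cons a acc)) acc).toList ↔
      a ∈ acc.toList ∨ a ∈ p) ∧
    (acc.toList.Nodup →
      (p.foldl (fun acc a => ite (a ∈ acc.toList) acc (cons a acc)) acc).toList.Nodup) := by
  induction p generalizing acc with
  | nil => simp
  | cons b p ih =>
    rw [List.foldl_cons]
    obtain ⟨h1, h2, h3⟩ := ih (ite (b ∈ acc.toList) acc (cons b acc))
    by_cases h : b ∈ acc.toList
    · rw [ite_pos h] at h1 h2 h3 ⊢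
      refine ⟨by simp; omega, fun a => ?_, h3⟩
      rw [h2, List.mem_cons]
      have : a = b → a ∈ acc.toList := fun hab => hab ▸ h
      tauto
    · rw [ite_neg h] at h1 h2 h3 ⊢
      refine ⟨by simp at h1 ⊢; omega, fun a => ?_, fun hn => h3 (by simp [h, hn])⟩
      rw [h2, toList_cons, List.mem_cons, List.mem_cons]
      tauto

theorem mem_dedup {l a : Data} : a ∈ (dedup l).toList ↔ a ∈ l.toList := by
  have := (foldl_dedup l.toList nil).2.1 a
  simp only [toList_nil, List.not_mem_nil, false_or] at this
  exact this

theorem nodup_dedup (l : Data) : (dedup l).toList.Nodup :=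
  (foldl_dedup l.toList nil).2.2 (by simp)

end Data

open Data

/-! Polynomial time -/

/-- In the closure rules for lists, predicates act on `cons a x` with a the list element and x the
parameter; this lets functions of the parameter act there. -/
theorem Comp.snd {f : Data → Data} (hf : Comp f) : Comp fun y => f y.tl :=
  hf.comp Comp.id.tl

theorem Comp.fst : Comp fun y => y.hd :=
  Comp.id.hd

section

variable {N E F X C e s l p : Data → Data}

theorem CompP.adj {u v : Data → Data} (hE : Comp E) (hF : Comp F) (hu : Comp u) (hv : Comp v) :
    CompP fun x => Data.Adj (E x) (F x) (u x) (v x) :=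
  (CompP.mem (hu.cons hv) hE).or ((CompP.mem (hv.cons hu) hE).or
    ((CompP.mem (hu.cons hv) hF).or (.mem (hv.cons hu) hF)))

theorem CompP.common (hE : Comp E) (hF : Comp F) (he : Comp e) (hs : Comp s) :
    CompP fun x => Data.Common (E x) (F x) (e x) (s x) :=
  ((CompP.adj hE hF he.hd hs.hd).and (.adj hE hF he.tl hs.hd)).and
    ((CompP.adj hE hF he.hd hs.tl).and (.adj hE hF he.tl hs.tl))

theorem CompP.removable (hN : Comp N) (hE : Comp E) (hF : Comp F) (he : Comp e) :
    CompP fun x => Data.Removable (N x) (E x) (F x) (e x) :=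
  .forall (P := fun s x => s ∈ (F x).toList ∨ ¬ Data.Common (E x) (F x) (e x) s) hN
    ((CompP.mem .fst hF.snd).or (CompP.common hE.snd hF.snd he.snd .fst).not)

theorem Comp.minCand (hN : Comp N) (hE : Comp E) (hF : Comp F) (hX : Comp X) :
    Comp fun x => Data.minCand (N x) (E x) (F x) (X x) :=
  (Comp.filter (P := fun e x => e ∈ (X x).toList ∧ Data.Removable (N x) (E x) (F x) e) hF
    ((CompP.mem .fst hX.snd).and (.removable hN.snd hE.snd hF.snd .fst))).hd

theorem Comp.delStep (hN : Comp N) (hE : Comp E) (hX : Comp X) (hs : Comp s) :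
    Comp fun x => Data.delStep (N x) (E x) (X x) (s x) :=
  have hm := hN.minCand hE hs.hd hX
  .ite (.eq hm .nil) hs ((Comp.filter (P := fun a x => a ≠ Data.minCand (N x) (E x) (s x).hd (X x))
    hs.hd (CompP.eq .fst hm.snd).not).cons (hm.cons hs.tl))

theorem Comp.delRun (hN : Comp N) (hE : Comp E) (hF : Comp F) (hX : Comp X) :
    Comp fun x => Data.delRun (N x) (E x) (F x) (X x) := by
  obtain ⟨b, hb, hFb⟩ := hF.exists_bound
  refine Comp.iterate (f := fun x => Data.delStep (N x) (E x) (X x)) hF (hF.cons .nil)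
    (hN.snd.delStep hE.snd hX.snd .fst) (b := fun m => b m + (b m * (b m + 1) + 2))
    (hb.add ((hb.mul (hb.add (.const _))).add (.const _))) fun x i hi => ?_
  have h := hFb x
  refine (size_delStep_iterate_le _ _ _ _ hi).trans ?_
  gcongr

theorem Comp.del (hN : Comp N) (hE : Comp E) (hF : Comp F) (hX : Comp X) :
    Comp fun x => Data.del (N x) (E x) (F x) (X x) :=
  (hN.delRun hE hF hX).hd

theorem Comp.can (hN : Comp N) (hE : Comp E) (hF : Comp F) :
    Comp fun x => Data.can (N x) (E x) (F x) :=
  (hN.delRun hE hN (Comp.filter (P := fun a x => a ∉ (F x).toList) hN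
    (CompP.mem .fst hF.snd).not)).tl.reverse

theorem Comp.succ (hN : Comp N) (hE : Comp E) (hF : Comp F) (he : Comp e) :
    Comp fun x => Data.succ (N x) (E x) (F x) (e x) :=
  have hflip : Comp fun x => Data.flip (N x) (E x) (F x) (e x) :=
    .filter (P := fun s x => (s ≠ e x ∧ s ∈ (F x).toList) ∨ Data.Common (E x) (F x) (e x) s) hN
      (((CompP.eq .fst he.snd).not.and (.mem .fst hF.snd)).or
        (.common hE.snd hF.snd he.snd .fst))
  hN.del hE hflip hflip

theorem Comp.root (hN : Comp N) (hE : Comp E) : Comp fun x => Data.root (N x) (E x) :=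
  hN.del hE hN hN

theorem Comp.nextStep (hN : Comp N) (hE : Comp E) (hF : Comp F) (hC : Comp C) :
    Comp fun x => Data.nextStep (N x) (E x) (F x) (C x) :=
  have hbar : Comp fun x => Data.filter (N x) (· ∉ (C x).toList) :=
    .filter (P := fun a x => a ∉ (C x).toList) hN (CompP.mem .fst hC.snd).not
  hN.succ hE hC (Comp.filter
    (P := fun a x => a ∉ (Data.filter (N x) (· ∉ (C x).toList)).toList) (hN.can hE hF)
    (CompP.mem .fst hbar.snd).not).hd

theorem Comp.parent (hN : Comp N) (hE : Comp E) (hF : Comp F) :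
    Comp fun x => Data.parent (N x) (E x) (F x) := by
  obtain ⟨b, hb, hNb⟩ := hN.exists_bound
  have hstep : Comp fun y => Data.parentStep (N y.tl) (E y.tl) (F y.tl) y.hd :=
    .ite (.eq Comp.fst.tl hF.snd) .fst (Comp.fst.tl.cons (hN.snd.nextStep hE.snd hF.snd Comp.fst.tl))
  refine (Comp.iterate (f := fun x => Data.parentStep (N x) (E x) (F x)) hN (Comp.nil.cons (hN.root hE))
    hstep (b := fun m => b m + b m + 1) ((hb.add hb).add (.const _)) fun x i hi => ?_).hd
  have h := hNb x
  have h1 := size_parentStep_iterate_le (N x) (E x) (F x) i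
  refine (size_le_hd_add_tl _).trans ?_
  omega

theorem Comp.dedup (hl : Comp l) : Comp fun x => Data.dedup (l x) := by
  obtain ⟨b, hb, hlb⟩ := hl.exists_bound
  refine Comp.foldl (h := fun a _ acc => Data.ite (a ∈ acc.toList) acc (Data.cons a acc)) hl .nil
    (.ite (CompP.mem .fst Comp.id.tl.tl) Comp.id.tl.tl (Comp.fst.cons Comp.id.tl.tl))
    (b := fun m => b m * (b m + 1) + 1) ((hb.mul (hb.add (.const _))).add (.const _))
    fun x p hp => ?_
  have h := hlb x
  obtain ⟨h1, h2, -⟩ := foldl_dedup p .nil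
  have h3 := size_ofList_le_of_forall fun a ha => ((size_lt_of_mem (hp.subset
    (by simpa using (h2 a).1 ha))).le.trans h)
  rw [ofList_toList] at h3
  refine h3.trans (Nat.add_le_add_right (Nat.mul_le_mul_right _ ?_) _)
  have h4 := hp.length_le
  have h5 := length_toList_lt (l x)
  simp only [toList_nil, List.length_nil] at h1
  omega

theorem Comp.children (hN : Comp N) (hE : Comp E) (hF : Comp F) :
    Comp fun x => Data.children (N x) (E x) (F x) :=
  (Comp.filter (P := fun K x => K ≠ Data.root (N x) (E x) ∧ Data.parent (N x) (E x) K = F x)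
    (Comp.map (f := fun e x => Data.succ (N x) (E x) (F x) e) hF
      (hN.snd.succ hE.snd hF.snd .fst))
    ((CompP.eq .fst (hN.root hE).snd).not.and
      (.eq (hN.snd.parent hE.snd .fst) hF.snd))).dedup

theorem Comp.after (hl : Comp l) (hF : Comp F) : Comp fun x => Data.after (l x) (F x) := by
  obtain ⟨b, hb, hlb⟩ := hl.exists_bound
  refine (Comp.iterate (f := fun x m => Data.ite (m.hd = F x) m m.tl) hl hl
    (.ite (.eq Comp.fst.hd hF.snd) .fst Comp.fst.tl) hb fun x i _ => ?_).tl
  refine le_trans ?_ (hlb x)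
  induction i with
  | zero => exact le_rfl
  | succ i ih =>
    rw [Function.iterate_succ_apply']
    generalize (fun m => Data.ite (m.hd = F x) m m.tl)^[i] (l x) = m at ih ⊢
    by_cases h : m.hd = F x
    · rw [ite_pos h]
      exact ih (by omega)
    · rw [ite_neg h]
      exact (size_tl_le m).trans (ih (by omega))

theorem Comp.state {m : Data → Data} (hm : Comp m) (hp : Comp p) (hF : Comp F) (hN : Comp N)
    (hE : Comp E) : Comp fun x => Data.state (m x) (p x) (F x) (N x) (E x) :=
  (Comp.nil.cons .nil).cons (hm.cons (hp.cons (hF.cons (hN.cons hE))))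

theorem Comp.enterStep (hp : Comp p) (hF : Comp F) (hN : Comp N) (hE : Comp E) :
    Comp fun x => Data.enterStep (p x) (F x) (N x) (E x) :=
  have hc := hN.children hE hF
  .ite (.eq hc .nil) (Comp.nil.state hp hF hN hE)
    (Comp.ofProp_true.state (CompP.eq hp .nil) hc.hd hN hE)

theorem Comp.leaveStep (hp : Comp p) (hF : Comp F) (hN : Comp N) (hE : Comp E) :
    Comp fun x => Data.leaveStep (p x) (F x) (N x) (E x) :=
  have hP := hN.parent hE hF
  have ha := (hN.children hE hP).after hF
  .ite (.eq hF (hN.root hE)) .nil (.ite (.eq ha .nil)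
    (Comp.nil.state (CompP.eq hp .nil) hP hN hE) (Comp.ofProp_true.state hp ha.hd hN hE))

end

theorem Comp.step : Comp Data.step :=
  have h1 := Comp.id.tl.tl
  .ite (.eq Comp.id.tl.hd .nil) (h1.hd.leaveStep h1.tl.hd h1.tl.tl.hd h1.tl.tl.tl)
    (h1.hd.enterStep h1.tl.hd h1.tl.tl.hd h1.tl.tl.tl)

theorem Comp.start : Comp Data.start := by
  have hN : Comp nonEdgeList :=
    .map (f := fun a _ => a.hd) (.filter (P := fun a _ => a.tl = .nil) Comp.id.tl
      (.eq Comp.fst.tl .nil)) Comp.fst.hd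
  have hE : Comp edgeList :=
    .map (f := fun a _ => a.hd) (.filter (P := fun a _ => a.tl ≠ .nil) Comp.id.tl
      (CompP.eq Comp.fst.tl .nil).not) Comp.fst.hd
  exact Comp.ofProp_true.state Comp.ofProp_true (hN.root hE) hN hE

end ChordalEnum

namespace ChordalEnum

open Data

/-! ### Correctness of the algorithm on trees -/

theorem Data.ofNat_injective : Function.Injective Data.ofNat := by
  intro a
  induction a with
  | zero => intro b h; cases b <;> simp_all [Data.ofNat]
  | succ a ih =>
    intro b h
    cases b with
    | zero => simp [Data.ofNat] at h
    | succ b =>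
      simp only [Data.ofNat, Data.cons.injEq, true_and] at h
      rw [ih h]

theorem Data.ofBool_eq_nil {b : Bool} : Data.ofBool b = .nil ↔ b = false := by
  cases b <;> simp [Data.ofBool]

theorem filter_ofList_map {α : Type*} {l : List α} {f : α → Data} {P : Data → Prop} {q : α → Bool}
    (h : ∀ a ∈ l, P (f a) ↔ q a = true) :
    filter (ofList (l.map f)) P = ofList ((l.filter q).map f) := by
  rw [Data.filter, toList_ofList, List.filter_map, List.filter_congr (q := q) fun a ha => by
    rw [Bool.eq_iff_iff]; simpa using h a ha]

section Encoding

variable {n : ℕ}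

theorem exists_encodePair_eq (e : Sym2 (Fin n)) :
    ∃ x y, e = s(x, y) ∧ encodePair e = .cons (.ofNat x) (.ofNat y) := by
  induction e with
  | h x y =>
    rcases le_total x y with h | h
    · exact ⟨x, y, rfl, by simp [encodePair, h]⟩
    · exact ⟨y, x, Sym2.eq_swap, by simp [encodePair, h]⟩

theorem encodePair_injective : Function.Injective (encodePair (n := n)) := by
  intro e f h
  obtain ⟨x, y, rfl, h1⟩ := exists_encodePair_eq e
  obtain ⟨u, v, rfl, h2⟩ := exists_encodePair_eq f
  rw [h1, h2, Data.cons.injEq] at h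
  rw [Fin.ext (ofNat_injective h.1), Fin.ext (ofNat_injective h.2)]

theorem encodePair_eq_or (u v : Fin n) (e : Sym2 (Fin n)) :
    (Data.cons (.ofNat u) (.ofNat v) = encodePair e ∨
      Data.cons (.ofNat v) (.ofNat u) = encodePair e) ↔ e = s(u, v) := by
  constructor
  · obtain ⟨x, y, rfl, h⟩ := exists_encodePair_eq e
    simp only [h, Data.cons.injEq]
    rintro (h | h)
    · rw [Fin.ext (ofNat_injective h.1), Fin.ext (ofNat_injective h.2)]
    · rw [Fin.ext (ofNat_injective h.1), Fin.ext (ofNat_injective h.2), Sym2.eq_swap]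
  · rintro rfl
    rcases le_total u v with h | h
    · exact .inl (by simp [encodePair, h])
    · exact .inr (by simp [encodePair, h])

theorem encodePair_ne_nil (e : Sym2 (Fin n)) : encodePair e ≠ .nil := by
  simp [encodePair]

variable {G : SimpleGraph (Fin n)} {L : List (Sym2 (Fin n))}

theorem toList_encodeCompletion (F : Finset (Sym2 (Fin n))) :
    (encodeCompletion L F).toList = (L.filter fun e => decide (e ∈ F)).map encodePair := by
  rw [encodeCompletion, toList_ofList]

theorem mem_encodeCompletion {F : Finset (Sym2 (Fin n))} {d : Data} :
    d ∈ (encodeCompletion L F).toList ↔ ∃ e ∈ L, e ∈ F ∧ encodePair e = d := by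
  simp [toList_encodeCompletion, and_assoc]

theorem encodePair_mem {F : Finset (Sym2 (Fin n))} {e : Sym2 (Fin n)} (he : e ∈ L) :
    encodePair e ∈ (encodeCompletion L F).toList ↔ e ∈ F := by
  rw [mem_encodeCompletion]
  constructor
  · rintro ⟨f, -, hf, h⟩
    exact encodePair_injective h ▸ hf
  · exact fun h => ⟨e, he, h, rfl⟩

theorem encodeCompletion_injOn (hL : IsPairOrder L) {F F' : Finset (Sym2 (Fin n))}
    (hF : F ⊆ nonEdges G) (hF' : F' ⊆ nonEdges G)
    (h : encodeCompletion L F = encodeCompletion L F') : F = F' := by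
  ext e
  constructor
  · intro he
    rwa [← encodePair_mem (hL.mem_of_mem_nonEdges (hF he)), ← h,
      encodePair_mem (hL.mem_of_mem_nonEdges (hF he))]
  · intro he
    rwa [← encodePair_mem (hL.mem_of_mem_nonEdges (hF' he)), h,
      encodePair_mem (hL.mem_of_mem_nonEdges (hF' he))]

theorem filter_encodeCompletion {F F' : Finset (Sym2 (Fin n))} {P : Data → Prop}
    (h : ∀ e ∈ L, e ∈ F' ↔ e ∈ F ∧ P (encodePair e)) :
    filter (encodeCompletion L F) P = encodeCompletion L F' := by
  rw [encodeCompletion, filter_ofList_map (q := fun e => decide (e ∈ F')), List.filter_filter,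
    encodeCompletion]
  · congr 2
    refine List.filter_congr fun e he => ?_
    rw [Bool.eq_iff_iff]
    simp only [Bool.and_eq_true, decide_eq_true_eq, h e he]
    tauto
  · intro e he
    rw [List.mem_filter, decide_eq_true_eq] at he
    rw [decide_eq_true_iff, h e he.1, and_iff_right he.2]

theorem filter_ofList_map_hd {l : List (Sym2 (Fin n))} {P : Data → Prop} {p : Sym2 (Fin n) → Bool}
    (h : ∀ e ∈ l, P (encodePair e) ↔ p e = true) :
    (filter (ofList (l.map encodePair)) P).hd = (l.find? p).elim .nil encodePair := by
  rw [filter_ofList_map h, ← List.head?_filter]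
  cases l.filter p <;> rfl

theorem card_le_length (hL : IsPairOrder L) {F : Finset (Sym2 (Fin n))} (hF : F ⊆ nonEdges G) :
    F.card ≤ (encodeCompletion L F).toList.length := by
  rw [toList_encodeCompletion, List.length_map]
  refine le_trans (Finset.card_le_card fun e he => ?_)
    (List.toFinset_card_le (L.filter fun e => decide (e ∈ F)))
  simpa [he] using hL.mem_of_mem_nonEdges (hF he)

open Classical in
/-- The list of the edges of `G`, in the order `L`. -/
noncomputable def encodeEdges (G : SimpleGraph (Fin n)) (L : List (Sym2 (Fin n))) : Data :=
  encodeCompletion L {e | e ∈ G.edgeSet}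

theorem encodePair_mem_or {F : Finset (Sym2 (Fin n))} (u v : Fin n) :
    (Data.cons (.ofNat u) (.ofNat v) ∈ (encodeCompletion L F).toList ∨
      Data.cons (.ofNat v) (.ofNat u) ∈ (encodeCompletion L F).toList) ↔
        s(u, v) ∈ L ∧ s(u, v) ∈ F := by
  simp only [mem_encodeCompletion, eq_comm (a := encodePair _)]
  rw [← exists_or]
  simp only [← and_or_left, encodePair_eq_or]
  constructor
  · rintro ⟨e, h1, h2, rfl⟩; exact ⟨h1, h2⟩
  · rintro ⟨h1, h2⟩; exact ⟨_, h1, h2, rfl⟩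

theorem adj_iff (hL : IsPairOrder L) {F : Finset (Sym2 (Fin n))} (hF : F ⊆ nonEdges G)
    (u v : Fin n) : Data.Adj (encodeEdges G L) (encodeCompletion L F) (.ofNat u) (.ofNat v) ↔
      (fillGraph G F).Adj u v := by
  rw [Data.Adj, ← or_assoc, encodeEdges, encodePair_mem_or, encodePair_mem_or, fillGraph_adj hF]
  have h1 : G.Adj u v → s(u, v) ∈ L := fun h => (hL.2 _).2 (by simpa using h.ne)
  have h2 : s(u, v) ∈ F → s(u, v) ∈ L := fun h => hL.mem_of_mem_nonEdges (hF h)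
  simp only [Finset.mem_filter, Finset.mem_univ, true_and, SimpleGraph.mem_edgeSet]
  tauto

theorem common_iff (hL : IsPairOrder L) {F : Finset (Sym2 (Fin n))} (hF : F ⊆ nonEdges G)
    {e s : Data} {x y u v : Fin n} (he : e = .cons (.ofNat x) (.ofNat y))
    (hs : s = .cons (.ofNat u) (.ofNat v)) :
    Data.Common (encodeEdges G L) (encodeCompletion L F) e s ↔
      ((fillGraph G F).Adj x u ∧ (fillGraph G F).Adj y u) ∧
        (fillGraph G F).Adj x v ∧ (fillGraph G F).Adj y v := by
  simp only [Data.Common, he, hs, hd_cons, tl_cons, adj_iff hL hF]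

/-- This is the deletion criterion `isCompletion_erase_iff`. Only non-edges of G need to be
inspected, since edges of G cannot violate the clique condition. -/
theorem removable_iff (hL : IsPairOrder L) {F : Finset (Sym2 (Fin n))} (hF : IsCompletion G F)
    {e : Sym2 (Fin n)} (he : e ∈ F) :
    Data.Removable (encodeCompletion L (nonEdges G)) (encodeEdges G L) (encodeCompletion L F)
      (encodePair e) ↔ IsCompletion G (F.erase e) := by
  obtain ⟨x, y, rfl, hxy⟩ := exists_encodePair_eq e
  rw [isCompletion_erase_iff hF he]
  constructor
  · intro h u v hxu hyu hxv hyv huv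
    by_contra hadj
    have hnot : ¬ G.Adj u v ∧ s(u, v) ∉ F := by rwa [fillGraph_adj hF.1, not_or] at hadj
    have hN : s(u, v) ∈ nonEdges G := mk_mem_nonEdges.2 ⟨huv, hnot.1⟩
    obtain ⟨u', v', heq, henc⟩ := exists_encodePair_eq s(u, v)
    have := h (encodePair s(u, v)) ((encodePair_mem (hL.mem_of_mem_nonEdges hN)).2 hN)
    rw [encodePair_mem (hL.mem_of_mem_nonEdges hN), common_iff hL hF.1 hxy henc] at this
    refine this.elim hnot.2 fun h => h ?_
    rcases Sym2.eq_iff.1 heq with ⟨rfl, rfl⟩ | ⟨rfl, rfl⟩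
    · exact ⟨⟨hxu, hyu⟩, hxv, hyv⟩
    · exact ⟨⟨hxv, hyv⟩, hxu, hyu⟩
  · intro h s hs
    obtain ⟨f, hfL, hfN, rfl⟩ := mem_encodeCompletion.1 hs
    obtain ⟨u, v, rfl, huv⟩ := exists_encodePair_eq f
    rw [encodePair_mem hfL, common_iff hL hF.1 hxy huv]
    by_contra hcon
    rw [not_or, not_not] at hcon
    obtain ⟨h1, ⟨h2, h3⟩, h4, h5⟩ := hcon
    have := h u v h2 h3 h4 h5 (mk_mem_nonEdges.1 hfN).1
    rw [fillGraph_adj hF.1] at this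
    exact this.elim (mk_mem_nonEdges.1 hfN).2 h1

theorem minCand_encode (hL : IsPairOrder L) {F X : Finset (Sym2 (Fin n))}
    (hF : IsCompletion G F) :
    Data.minCand (encodeCompletion L (nonEdges G)) (encodeEdges G L) (encodeCompletion L F)
      (encodeCompletion L X) = (minCand G L F X).elim .nil encodePair := by
  rw [Data.minCand, filter_encodeCompletion (F' := candidates G F X), encodeCompletion, minCand,
    ← List.head?_filter]
  · cases L.filter _ <;> rfl
  · intro e he
    rw [mem_candidates, encodePair_mem he]
    constructor
    · rintro ⟨h1, h2, h3⟩
      exact ⟨h2, h1, (removable_iff hL hF h2).2 h3⟩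
    · rintro ⟨h1, h2, h3⟩
      exact ⟨h2, h1, (removable_iff hL hF h1).1 h3⟩

/-- Any number of rounds from `F.card` upwards gives the same result, because the process has then
reached its fixed point. -/
theorem delStep_iterate_encode (hL : IsPairOrder L) {F X : Finset (Sym2 (Fin n))}
    (hF : IsCompletion G F) (acc : List Data) {k : ℕ} (hk : F.card ≤ k) :
    (Data.delStep (encodeCompletion L (nonEdges G)) (encodeEdges G L) (encodeCompletion L X))^[k]
      (.cons (encodeCompletion L F) (ofList acc)) = .cons (encodeCompletion L (del G L F X))
        (ofList (((removed G L F X).map encodePair).reverse ++ acc)) := by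
  induction F using del_induction G L X generalizing k acc with
  | none F h =>
    rw [del_of_none h, removed_of_none h]
    refine Function.iterate_fixed ?_ k
    rw [Data.delStep, ite_pos]
    simp [minCand_encode hL hF, h]
  | some F e h ih =>
    have hmem := mem_candidates.1 (minCand_mem h)
    have hcard := Finset.card_erase_lt_of_mem hmem.2.1
    obtain ⟨k, rfl⟩ : ∃ j, k = j + 1 := ⟨k - 1, by omega⟩
    rw [del_of_some h, removed_of_some h, Function.iterate_succ_apply]
    have := ih hmem.2.2 (encodePair e :: acc) (k := k) (by omega)
    rw [List.map_cons, List.reverse_cons, List.append_assoc, List.singleton_append, ← this]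
    congr 1
    rw [Data.delStep, hd_cons, minCand_encode hL hF, h, Option.elim_some,
      ite_neg (encodePair_ne_nil e), tl_cons, filter_encodeCompletion (F' := F.erase e),
      ofList_cons]
    intro f _
    rw [Finset.mem_erase, and_comm, ne_eq, ne_eq, encodePair_injective.eq_iff]

theorem delRun_encode (hL : IsPairOrder L) {F X : Finset (Sym2 (Fin n))}
    (hF : IsCompletion G F) :
    Data.delRun (encodeCompletion L (nonEdges G)) (encodeEdges G L) (encodeCompletion L F)
      (encodeCompletion L X) = .cons (encodeCompletion L (del G L F X))
        (ofList ((removed G L F X).map encodePair).reverse) := by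
  have := delStep_iterate_encode hL (X := X) hF [] (card_le_length hL hF.1)
  rwa [List.append_nil] at this

theorem del_encode (hL : IsPairOrder L) {F X : Finset (Sym2 (Fin n))} (hF : IsCompletion G F) :
    Data.del (encodeCompletion L (nonEdges G)) (encodeEdges G L) (encodeCompletion L F)
      (encodeCompletion L X) = encodeCompletion L (del G L F X) := by
  rw [Data.del, delRun_encode hL hF, hd_cons]

theorem filter_notMem_encode (F : Finset (Sym2 (Fin n))) :
    filter (encodeCompletion L (nonEdges G)) (· ∉ (encodeCompletion L F).toList) =
      encodeCompletion L (bar G F) :=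
  filter_encodeCompletion fun e he => by rw [mem_bar, encodePair_mem he]

theorem can_encode (hL : IsPairOrder L) (F : Finset (Sym2 (Fin n))) :
    Data.can (encodeCompletion L (nonEdges G)) (encodeEdges G L) (encodeCompletion L F) =
      ofList ((can G L F).map encodePair) := by
  rw [Data.can, filter_notMem_encode, delRun_encode hL isCompletion_nonEdges, tl_cons,
    toList_ofList, List.reverse_reverse, can]

theorem flip_encode (hL : IsPairOrder L) {F : Finset (Sym2 (Fin n))} (hF : F ⊆ nonEdges G)
    (e : Sym2 (Fin n)) :
    Data.flip (encodeCompletion L (nonEdges G)) (encodeEdges G L) (encodeCompletion L F)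
      (encodePair e) = encodeCompletion L (flip G F e) := by
  refine filter_encodeCompletion fun s hs => ?_
  rw [encodePair_mem hs, ne_eq, encodePair_injective.eq_iff]
  obtain ⟨x, y, rfl, hxy⟩ := exists_encodePair_eq e
  obtain ⟨u, v, rfl, huv⟩ := exists_encodePair_eq s
  rw [mk_mem_flip hF, common_iff hL hF hxy huv]

theorem succ_encode (hL : IsPairOrder L) {F : Finset (Sym2 (Fin n))} (hF : IsCompletion G F)
    {e : Sym2 (Fin n)} (he : e ∈ F) :
    Data.succ (encodeCompletion L (nonEdges G)) (encodeEdges G L) (encodeCompletion L F)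
      (encodePair e) = encodeCompletion L (succ G L F e) := by
  rw [Data.succ, flip_encode hL hF.1, del_encode hL (isCompletion_flip hF he), succ]

theorem root_encode (hL : IsPairOrder L) :
    Data.root (encodeCompletion L (nonEdges G)) (encodeEdges G L) =
      encodeCompletion L (root G L) :=
  del_encode hL isCompletion_nonEdges

theorem nextStep_encode (hL : IsPairOrder L) {F C C' : Finset (Sym2 (Fin n))}
    (hF : IsMinCompletion G F) (hC : IsMinCompletion G C) (h : nextStep G L F C = some C') :
    Data.nextStep (encodeCompletion L (nonEdges G)) (encodeEdges G L) (encodeCompletion L F)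
      (encodeCompletion L C) = encodeCompletion L C' := by
  rw [nextStep_eq, Option.map_eq_some_iff] at h
  obtain ⟨e, he, rfl⟩ := h
  have hmem : e ∈ can G L F := List.mem_of_find?_eq_some he
  have heF := (mem_bar.1 ((mem_can hL hF.1).1 hmem)).1
  rw [Data.nextStep, filter_notMem_encode, can_encode hL,
    filter_ofList_map_hd (p := fun e => !decide (e ∈ bar G C)), he, Option.elim_some,
    succ_encode hL hC.1]
  · have := List.find?_some he
    simp only [Bool.not_eq_true', decide_eq_false_iff_not, mem_bar, not_and, not_not] at this
    exact this heF
  · intro e he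
    have := (mem_bar.1 ((mem_can hL hF.1).1 he)).1
    rw [encodePair_mem (hL.mem_of_mem_nonEdges this)]
    simp

theorem length_removed_le {F X : Finset (Sym2 (Fin n))} : (removed G L F X).length ≤ F.card := by
  induction F using del_induction G L X with
  | none F h => simp [removed_of_none h]
  | some F e h ih =>
    have := Finset.card_erase_lt_of_mem (mem_of_minCand G L h)
    rw [removed_of_some h, List.length_cons]
    omega

theorem add_length_le_of_isChain {α : Type*} {r : α → α → Prop} {f : α → ℕ} {b : α} :
    ∀ (q : List α) (a : α), (a :: (q ++ [b])).IsChain r →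
      (∀ x ∈ a :: (q ++ [b]), ∀ y, r x y → f x < f y) → f a + q.length < f b
  | [], a, h, h' => by
    simp only [List.nil_append, List.isChain_cons_cons] at h
    simpa using h' a (by simp) _ h.1
  | c :: q, a, h, h' => by
    simp only [List.cons_append, List.isChain_cons_cons] at h
    have := add_length_le_of_isChain q c h.2 fun x hx => h' x (List.mem_cons_of_mem _ hx)
    have := h' a (by simp) _ h.1
    simp only [List.length_cons]
    omega

/-- The path has q.length + 1 steps; after them the pair (P, F) is a fixed point, so any larger
number of rounds does no harm. -/
theorem parentStep_iterate_encode (hL : IsPairOrder L) {F P : Finset (Sym2 (Fin n))}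
    (hF : IsMinCompletion G F) (q : List (Finset (Sym2 (Fin n)))) (C : Finset (Sym2 (Fin n)))
    (d : Data) {k : ℕ} (hk : q.length < k) (hhead : (q ++ [P, F]).head? = some C)
    (hmin : ∀ D ∈ q ++ [P, F], IsMinCompletion G D)
    (hchain : (q ++ [P, F]).IsChain fun C C' => nextStep G L F C = some C') :
    (Data.parentStep (encodeCompletion L (nonEdges G)) (encodeEdges G L)
      (encodeCompletion L F))^[k] (.cons d (encodeCompletion L C)) =
        .cons (encodeCompletion L P) (encodeCompletion L F) := by
  have hstep : ∀ C' D d, nextStep G L F C' = some D → IsMinCompletion G C' →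
      Data.parentStep (encodeCompletion L (nonEdges G)) (encodeEdges G L) (encodeCompletion L F)
        (.cons d (encodeCompletion L C')) =
          .cons (encodeCompletion L C') (encodeCompletion L D) := by
    intro C' D d h hC'
    have hne : encodeCompletion L C' ≠ encodeCompletion L F := by
      intro heq
      rw [encodeCompletion_injOn hL hC'.1.1 hF.1.1 heq, nextStep_self hL hF] at h
      simp at h
    rw [Data.parentStep, tl_cons, ite_neg hne, nextStep_encode hL hF hC' h]
  induction q generalizing C d k with
  | nil =>
    obtain ⟨k, rfl⟩ : ∃ j, k = j + 1 := ⟨k - 1, by simp at hk; omega⟩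
    rw [Function.iterate_succ_apply]
    obtain rfl : P = C := by simpa using hhead
    rw [hstep P F d (by simpa using hchain) (hmin P (by simp))]
    refine Function.iterate_fixed ?_ k
    rw [Data.parentStep, tl_cons, ite_pos rfl]
  | cons A q ih =>
    obtain rfl : A = C := by simpa using hhead
    obtain ⟨D, hD⟩ : ∃ D, (q ++ [P, F]).head? = some D := by
      cases q <;> simp
    rw [List.cons_append, List.isChain_cons] at hchain
    simp only [List.length_cons] at hk
    obtain ⟨k, rfl⟩ : ∃ j, k = j + 1 := ⟨k - 1, by omega⟩
    rw [Function.iterate_succ_apply, hstep A D d (hchain.1 D hD) (hmin A (by simp))]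
    exact ih D _ (by omega) hD (fun X hX => hmin X (List.mem_cons_of_mem _ hX)) hchain.2

theorem parent_encode (hL : IsPairOrder L) {F P : Finset (Sym2 (Fin n))}
    (h : IsParent G L P F) :
    Data.parent (encodeCompletion L (nonEdges G)) (encodeEdges G L) (encodeCompletion L F) =
      encodeCompletion L P := by
  have hF := h.isMin.2
  obtain ⟨q, hq⟩ := h
  have hlen : q.length < (encodeCompletion L (nonEdges G)).toList.length := by
    -- The proximity to F increases by at least one on each of the q.length + 1 steps and ends at
    -- most at the length of Can(bar F), which has at most one entry per non-edge.
    refine lt_of_lt_of_le ?_ (card_le_length hL (subset_refl (nonEdges G)))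
    refine lt_of_lt_of_le ?_ (prox_le.trans length_removed_le : prox G L F F ≤ _)
    have hinc : ∀ x ∈ q ++ [P, F], ∀ y, nextStep G L F x = some y →
        prox G L x F < prox G L y F :=
      fun x hx y hxy => (nextStep_spec hL hF (hq.2.2.1 x hx) hxy).2.1
    cases q with
    | nil =>
      have := hinc P (by simp) F (by simpa using hq.2.2.2)
      simp only [List.length_nil]
      omega
    | cons A q =>
      have := add_length_le_of_isChain (f := fun C => prox G L C F) (b := F) (q ++ [P]) A
        (by simpa using hq.2.2.2) (by simpa using hinc)
      simp only [List.length_append, List.length_singleton] at this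
      simp only [List.length_cons]
      omega
  rw [Data.parent, root_encode hL, parentStep_iterate_encode hL hF q _ _ hlen hq.1 hq.2.2.1
    hq.2.2.2, hd_cons]

theorem exists_eq_map {α β : Type*} {f : α → β} {P : α → Prop} (l : List β)
    (h : ∀ b ∈ l, ∃ a, f a = b ∧ P a) : ∃ l' : List α, l = l'.map f ∧ ∀ a ∈ l', P a := by
  induction l with
  | nil => exact ⟨[], rfl, by simp⟩
  | cons b l ih =>
    obtain ⟨a, ha, hPa⟩ := h b (by simp)
    obtain ⟨l', rfl, hl'⟩ := ih fun c hc => h c (List.mem_cons_of_mem _ hc)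
    exact ⟨a :: l', by simp [ha], by simpa [hPa] using hl'⟩

/-- Excluding the root guarantees that a computed successor has a parent, so that `parent_encode`
applies; conversely every child is a successor by `nextStep_spec`. -/
theorem mem_children_encode (hL : IsPairOrder L) {F : Finset (Sym2 (Fin n))}
    (hF : IsMinCompletion G F) (d : Data) :
    d ∈ (Data.children (encodeCompletion L (nonEdges G)) (encodeEdges G L)
      (encodeCompletion L F)).toList ↔ ∃ K ∈ children G L F, encodeCompletion L K = d := by
  rw [Data.children, mem_dedup, Data.mem_filter, toList_ofList, List.mem_map, root_encode hL]
  constructor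
  · rintro ⟨⟨d', hd', rfl⟩, h1, h2⟩
    obtain ⟨e, heL, heF, rfl⟩ := mem_encodeCompletion.1 hd'
    rw [succ_encode hL hF.1 heF] at h1 h2 ⊢
    have hK := isMinCompletion_succ hL hF.1 heF
    obtain ⟨P, hP, -⟩ := existsUnique_isParent hL hK fun h => h1 (by rw [h])
    rw [parent_encode hL hP] at h2
    obtain rfl := encodeCompletion_injOn hL hP.isMin.1.1.1 hF.1.1 h2
    exact ⟨_, (mem_children hL).2 hP, rfl⟩
  · rintro ⟨K, hK, rfl⟩
    have hKP := (mem_children hL).1 hK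
    obtain ⟨e, he, rfl⟩ := Finset.mem_image.1
      (nextStep_spec hL hKP.isMin.2 hKP.isMin.1 hKP.nextStep).2.2
    refine ⟨⟨encodePair e, (encodePair_mem (hL.mem_of_mem_nonEdges (hF.1.1 he))).2 he,
      succ_encode hL hF.1 he⟩, fun h => ?_, parent_encode hL hKP⟩
    rw [encodeCompletion_injOn hL hKP.isMin.2.1.1 (isMinCompletion_root hL).1.1 h] at hKP
    exact not_isParent_root hL hKP

theorem children_encode (hL : IsPairOrder L) {F : Finset (Sym2 (Fin n))}
    (hF : IsMinCompletion G F) : ∃ kids : List (Finset (Sym2 (Fin n))),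
      Data.children (encodeCompletion L (nonEdges G)) (encodeEdges G L) (encodeCompletion L F) =
        ofList (kids.map (encodeCompletion L)) ∧ kids.Nodup ∧
          ∀ K, K ∈ kids ↔ K ∈ children G L F := by
  obtain ⟨kids, h1, h2⟩ := exists_eq_map (f := encodeCompletion L)
    (P := fun K => K ∈ children G L F) _ fun d hd => by
      obtain ⟨K, hK, h⟩ := (mem_children_encode hL hF d).1 hd
      exact ⟨K, h, hK⟩
  refine ⟨kids, by rw [← h1, ofList_toList], ?_, fun K => ⟨h2 K, fun hK => ?_⟩⟩
  · have := nodup_dedup (Data.filter (ofList ((encodeCompletion L F).toList.map fun e =>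
      Data.succ (encodeCompletion L (nonEdges G)) (encodeEdges G L) (encodeCompletion L F) e))
      fun K => K ≠ Data.root (encodeCompletion L (nonEdges G)) (encodeEdges G L) ∧
        Data.parent (encodeCompletion L (nonEdges G)) (encodeEdges G L) K =
          encodeCompletion L F)
    change (Data.children _ _ _).toList.Nodup at this
    rw [h1] at this
    exact this.of_map
  · have := (mem_children_encode hL hF _).2 ⟨K, hK, rfl⟩
    rw [h1, List.mem_map] at this
    obtain ⟨K', hK', h⟩ := this
    rwa [← encodeCompletion_injOn hL ((mem_children hL).1 (h2 K' hK')).isMin.2.1.1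
      ((mem_children hL).1 hK).isMin.2.1.1 h]

theorem after_append {l l' : List Data} {a : Data} (ha : a ∉ l) :
    Data.after (ofList (l ++ a :: l')) a = ofList l' := by
  have key : ∀ k, l.length ≤ k → ((fun m : Data => Data.ite (m.hd = a) m m.tl)^[k]
      (ofList (l ++ a :: l'))) = ofList (a :: l') := by
    induction l with
    | nil =>
      intro k _
      refine Function.iterate_fixed ?_ k
      simp [ite_pos]
    | cons b l ih =>
      intro k hk
      simp only [List.length_cons] at hk
      obtain ⟨k, rfl⟩ : ∃ j, k = j + 1 := ⟨k - 1, by omega⟩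
      rw [Function.iterate_succ_apply]
      simp only [List.mem_cons, not_or] at ha
      simp only [List.cons_append, ofList_cons, hd_cons, tl_cons]
      rw [ite_neg (Ne.symm ha.1)]
      exact ih ha.2 k (by omega)
  rw [Data.after, key _ (by simp), ofList_cons, tl_cons]

theorem nonEdgeList_encodeGraph (hL : IsPairOrder L) :
    nonEdgeList (encodeGraph G L) = encodeCompletion L (nonEdges G) := by
  rw [nonEdgeList, encodeGraph, tl_cons, filter_ofList_map (q := fun e => decide (e ∈ nonEdges G)),
    toList_ofList, List.map_map, encodeCompletion]
  · rfl
  · intro e he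
    have hd := (hL.2 e).1 he
    induction e with
    | h u v =>
      rw [tl_cons, ofBool_eq_nil, decide_eq_false_iff_not, decide_eq_true_iff, mk_mem_nonEdges,
        SimpleGraph.mem_edgeSet]
      exact (and_iff_right hd).symm

open Classical in
theorem edgeList_encodeGraph : edgeList (encodeGraph G L) = encodeEdges G L := by
  rw [edgeList, encodeGraph, tl_cons,
    filter_ofList_map (q := fun e => decide (e ∈ ({e | e ∈ G.edgeSet} : Finset (Sym2 (Fin n))))),
    toList_ofList, List.map_map, encodeEdges, encodeCompletion]
  · rfl
  · intro e _
    rw [tl_cons, ne_eq, ofBool_eq_nil, decide_eq_false_iff_not, not_not, decide_eq_true_iff,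
      Finset.mem_filter, and_iff_right (Finset.mem_univ e)]

end Encoding

end ChordalEnum

namespace ChordalEnum

open Data

/-! ### Delay of a run -/

/-- If time `a` has passed since the last output before `tr`, then no output in `tr`, nor the end
of `tr`, has delay above `D`, and at most `b` has passed since the last output at the end. -/
def DelayFrom (D : ℕ) : ℕ → List Step → ℕ → Prop
  | a, [], b => a ≤ b
  | a, x :: tr, b => a + x.size ≤ D ∧ DelayFrom D (if x.out.isSome then 0 else a + x.size) tr b

theorem DelayFrom.mono {D a a' b : ℕ} {tr : List Step} (h : DelayFrom D a tr b) (ha : a' ≤ a) :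
    DelayFrom D a' tr b := by
  induction tr generalizing a a' with
  | nil => exact ha.trans h
  | cons x tr ih =>
    refine ⟨(Nat.add_le_add_right ha _).trans h.1, ih h.2 ?_⟩
    split_ifs <;> omega

theorem DelayFrom.append {D a b c : ℕ} {tr tr' : List Step} (h : DelayFrom D a tr b)
    (h' : DelayFrom D b tr' c) : DelayFrom D a (tr ++ tr') c := by
  induction tr generalizing a with
  | nil => exact h'.mono h
  | cons x tr ih => exact ⟨h.1, ih h.2⟩

theorem DelayFrom.of_silent {D a S : ℕ} {tr : List Step} (h : ∀ y ∈ tr, y.out = none ∧ y.size ≤ S)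
    (hD : a + tr.length * S ≤ D) : DelayFrom D a tr (a + tr.length * S) := by
  induction tr generalizing a with
  | nil => simp [DelayFrom]
  | cons x tr ih =>
    obtain ⟨h1, h2⟩ := h x (by simp)
    rw [List.length_cons, Nat.succ_mul] at hD ⊢
    refine ⟨by omega, ?_⟩
    have h3 := ih (a := a + S) (fun y hy => h y (List.mem_cons_of_mem _ hy)) (by omega)
    rw [show a + (tr.length * S + S) = a + S + tr.length * S by omega]
    exact h3.mono (by simp [h1, h2])

theorem DelayFrom.drop {D a b : ℕ} {tr tr' : List Step} (h : DelayFrom D a (tr ++ tr') b) :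
    ∃ c, DelayFrom D c tr' b := by
  induction tr generalizing a with
  | nil => exact ⟨a, h⟩
  | cons x tr ih => exact ih h.2

theorem DelayFrom.delayLE {D a b : ℕ} {tr : List Step} (h : DelayFrom D a tr b) :
    DelayLE tr D := by
  rintro u x ⟨p, s, rfl⟩ hu
  rw [List.append_assoc] at h
  obtain ⟨c, hc⟩ := h.drop
  have key : ∀ (u : List Step) (c : ℕ), (∀ y ∈ u, y.out = none) →
      DelayFrom D c (u ++ [x] ++ s) b → c + time (u ++ [x]) ≤ D := by
    intro u
    induction u with
    | nil => intro c _ h; simpa [time] using h.1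
    | cons y u ih =>
      intro c hu h
      have h1 := ih _ (fun z hz => hu z (List.mem_cons_of_mem _ hz)) h.2
      have h2 : time (y :: u ++ [x]) = y.size + time (u ++ [x]) := by simp [time]
      simp only [hu y (by simp), Option.isSome_none, Bool.false_eq_true, if_false] at h1
      omega
  have := key u c hu hc
  omega

theorem outputs_append (tr tr' : List Step) : outputs (tr ++ tr') = outputs tr ++ outputs tr' :=
  List.filterMap_append

theorem outputs_of_silent {tr : List Step} {S : ℕ} (h : ∀ y ∈ tr, y.out = none ∧ y.size ≤ S) :
    outputs tr = [] :=
  List.filterMap_eq_nil_iff.2 fun y hy => (h y hy).1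

/-! ### The main loop -/

/-- The completion in the state `s` is output. -/
def Emits (s : Data) : Prop :=
  s.tl.hd = s.tl.tl.hd

open Classical in
/-- The value that is output in the state `s`, if any. -/
noncomputable def emission (s : Data) : List Data :=
  if Emits s then [s.tl.tl.tl.hd] else []

/-- From the state `s`, the traversal outputs `o` and arrives in the state `t`. All states on the
way have size at most `B`, and no two consecutive ones are without output. -/
inductive Exec (B : ℕ) : Data → List Data → Data → Prop
  | refl (s : Data) : Exec B s [] s
  | step (s t : Data) (o : List Data) : s.hd ≠ .nil → s.size ≤ B →
      (¬ Emits s → Emits s.step ∨ s.step = .nil) → Exec B s.step o t →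
      Exec B s (emission s ++ o) t

theorem Exec.trans {B : ℕ} {s t u : Data} {o o' : List Data} (h : Exec B s o t)
    (h' : Exec B t o' u) : Exec B s (o ++ o') u := by
  induction h with
  | refl => exact h'
  | step s t o h1 h2 h3 _ ih => rw [List.append_assoc]; exact .step _ _ _ h1 h2 h3 (ih h')

/-- The loop of the main program; `c` is a program for `Data.step`. -/
def mainLoop (c : Prog (Fin 1)) : Prog (Fin 1) :=
  .loop (.hd (.hd (.var 0))) (.seq (.cond (.eq (.hd (.tl (.hd (.var 0))))
    (.hd (.tl (.tl (.hd (.var 0)))))) (.emit (.hd (.tl (.tl (.tl (.hd (.var 0)))))))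
      (.assign 0 (.var 0))) c)

/-- One round, including the two tests and the output or idle step, takes time at most T. The time
since the last output is at most T at a silent non-final state and at most 2T at an emitting or
final one, because after a silent state `Exec` demands an emitting state or the end. The next output
or the final test then adds at most another T. -/
theorem run_mainLoop {c : Prog (Fin 1)} {b : ℕ → ℕ} (hb : Monotone b)
    (hc : Implements c Data.step b) {B S T : ℕ} (hS : B + b B + 3 ≤ S) (hT : (b B + 3) * S ≤ T)
    {s t : Data} {o : List Data} (h : Exec B s o t) (ht : t = .nil) {a : ℕ} (ha : a ≤ 2 * T)
    (ha' : ¬ Emits s → s ≠ .nil → a ≤ T) :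
    ∃ tr, Run (mainLoop c) (store (.cons s .nil)) tr (store (.cons t .nil)) ∧ outputs tr = o ∧
      DelayFrom (3 * T) a tr (3 * T) ∧ ∀ x ∈ tr, x.size ≤ S := by
  induction h generalizing a with
  | refl s =>
    subst ht
    have hST : S ≤ T := le_trans (Nat.le_mul_of_pos_left _ (by omega)) hT
    refine ⟨_, .loop_false _ _ _ rfl, rfl, ?_, ?_⟩
    · simp only [DelayFrom, storeSize_store, size_cons, size_nil]
      simp
      omega
    · simp only [List.mem_singleton, forall_eq, storeSize_store, size_cons, size_nil]
      omega
  | step s t o h1 h2 h3 _ ih =>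
    obtain ⟨trc, hr1, hr2, hr3⟩ := hc s .nil
    have hb2 := hb h2
    have hsize : (Data.cons s .nil).size ≤ S := by simp only [size_cons, size_nil]; omega
    have hr2' : ∀ y ∈ trc, y.out = none ∧ y.size ≤ S := fun y hy =>
      ⟨(hr2 y hy).1, (hr2 y hy).2.trans (by simp only [size_nil]; omega)⟩
    have hlen : trc.length * S + 3 * S ≤ T := by
      rw [← Nat.add_mul]
      exact (Nat.mul_le_mul_right _ (by omega)).trans hT
    have htest : (Expr.hd (.hd (.var 0))).eval (store (.cons s .nil)) ≠ .nil := h1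
    have htest' : (Expr.eq (.hd (.tl (.hd (.var 0)))) (.hd (.tl (.tl (.hd (.var 0)))))).eval
        (store (.cons s .nil)) = .ofProp (Emits s) := by
      simp only [Expr.eval, store, ofBool_eq_ofProp, hd_cons, Emits]
      exact congrArg ofProp (propext decide_eq_true_iff)
    by_cases hE : Emits s
    -- The output resets the clock, so only the steps of `c` count afterwards.
    · obtain ⟨tr, hr, hout, hdel, hsz⟩ := ih ht (a := trc.length * S) (by omega)
        (fun _ _ => by omega)
      refine ⟨_, .loop_true _ _ _ _ _ _ _ htest (.seq _ _ _ _ _ _ _ (.cond_true _ _ _ _ _ _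
        (by rw [htest', ne_eq, ofProp_eq_nil, not_not]; exact hE) (.emit _ _)) hr1) hr, ?_, ?_, ?_⟩
      · rw [emission, if_pos hE, ← hout]
        simp only [outputs, List.filterMap_cons, List.filterMap_append, List.cons_append,
          List.nil_append]
        rw [List.filterMap_eq_nil_iff.2 fun y hy => (hr2' y hy).1]
        rfl
      · have hsil := DelayFrom.of_silent (D := 3 * T) (a := 0) hr2' (by omega)
        rw [Nat.zero_add] at hsil
        simp only [List.cons_append, List.nil_append, DelayFrom, storeSize_store, Option.isSome_none,
          Option.isSome_some, Bool.false_eq_true, if_false, if_true]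
        exact ⟨by omega, by omega, by omega, hsil.append hdel⟩
      · simp only [List.cons_append, List.nil_append, List.mem_cons, List.mem_append,
          storeSize_store]
        rintro x (rfl | rfl | rfl | hx | hx)
        · exact hsize
        · exact hsize
        · exact hsize
        · exact (hr2' x hx).2
        · exact hsz x hx
    · have haT := ha' hE fun h => h1 (by rw [h]; rfl)
      obtain ⟨tr, hr, hout, hdel, hsz⟩ := ih ht (a := a + 3 * S + trc.length * S) (by omega)
        (fun h h' => absurd (h3 hE) (by simp [h, h']))
      have hskip : Run (.assign 0 (.var 0)) (store (.cons s .nil))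
          [⟨storeSize (store (.cons s .nil)), none⟩] (store (.cons s .nil)) := by
        have := Run.assign 0 (.var 0) (store (.cons s .nil))
        rwa [update_store] at this
      refine ⟨_, .loop_true _ _ _ _ _ _ _ htest (.seq _ _ _ _ _ _ _ (.cond_false _ _ _ _ _ _
        (by rw [htest', ofProp_eq_nil]; exact hE) hskip) hr1) hr, ?_, ?_, ?_⟩
      · rw [emission, if_neg hE, ← hout]
        simp only [outputs, List.filterMap_cons, List.filterMap_append, List.cons_append,
          List.nil_append]
        rw [List.filterMap_eq_nil_iff.2 fun y hy => (hr2' y hy).1, List.nil_append]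
      · have hsil := DelayFrom.of_silent (D := 3 * T) (a := a + 3 * S) hr2' (by omega)
        simp only [List.cons_append, List.nil_append, DelayFrom, storeSize_store, Option.isSome_none,
          Bool.false_eq_true, if_false]
        exact ⟨by omega, by omega, by omega, (hsil.append hdel).mono (by omega)⟩
      · simp only [List.cons_append, List.nil_append, List.mem_cons, List.mem_append,
          storeSize_store]
        rintro x (rfl | rfl | rfl | hx | hx)
        · exact hsize
        · exact hsize
        · exact hsize
        · exact (hr2' x hx).2
        · exact hsz x hx

/-! ### The traversal -/

section Traversal

variable {n : ℕ} (G : SimpleGraph (Fin n)) (L : List (Sym2 (Fin n)))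

/-- The state in which `F` is entered at depth `d`. -/
noncomputable def enterState (F : Finset (Sym2 (Fin n))) (d : ℕ) : Data :=
  state (ofProp True) (ofProp (Even d)) (encodeCompletion L F) (encodeCompletion L (nonEdges G))
    (encodeEdges G L)

/-- The state in which `F` is left at depth `d`. -/
noncomputable def leaveState (F : Finset (Sym2 (Fin n))) (d : ℕ) : Data :=
  state .nil (ofProp (Even d)) (encodeCompletion L F) (encodeCompletion L (nonEdges G))
    (encodeEdges G L)

variable {G L}

theorem ofProp_ofProp_eq_nil (d : ℕ) :
    ofProp (ofProp (Even d) = .nil) = ofProp (Even (d + 1)) := by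
  rw [ofProp_eq_nil, Nat.even_add_one]

theorem ofProp_true_eq_iff {p : Prop} : ofProp True = ofProp p ↔ p := by
  by_cases h : p <;> simp [ofProp, h]

theorem emits_enterState (F : Finset (Sym2 (Fin n))) (d : ℕ) :
    Emits (enterState G L F d) ↔ Even d :=
  ofProp_true_eq_iff

theorem emits_leaveState (F : Finset (Sym2 (Fin n))) (d : ℕ) :
    Emits (leaveState G L F d) ↔ ¬ Even d :=
  eq_comm.trans ofProp_eq_nil

theorem emission_enterState (F : Finset (Sym2 (Fin n))) (d : ℕ) :
    emission (enterState G L F d) = if Even d then [encodeCompletion L F] else [] := by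
  by_cases h : Even d
  · rw [emission, if_pos ((emits_enterState F d).2 h), if_pos h]
    rfl
  · rw [emission, if_neg (mt (emits_enterState F d).1 h), if_neg h]

theorem emission_leaveState (F : Finset (Sym2 (Fin n))) (d : ℕ) :
    emission (leaveState G L F d) = if Even d then [] else [encodeCompletion L F] := by
  by_cases h : Even d
  · rw [emission, if_neg fun h' => (emits_leaveState F d).1 h' h, if_pos h]
  · rw [emission, if_pos ((emits_leaveState F d).2 h), if_neg h]
    rfl

theorem step_enterState (F : Finset (Sym2 (Fin n))) (d : ℕ) :
    (enterState G L F d).step = enterStep (ofProp (Even d)) (encodeCompletion L F)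
      (encodeCompletion L (nonEdges G)) (encodeEdges G L) :=
  Data.ite_neg (by simp [enterState, state, ofProp_eq_nil]) _ _

theorem step_leaveState (F : Finset (Sym2 (Fin n))) (d : ℕ) :
    (leaveState G L F d).step = leaveStep (ofProp (Even d)) (encodeCompletion L F)
      (encodeCompletion L (nonEdges G)) (encodeEdges G L) :=
  Data.ite_pos rfl _ _

theorem step_enterState_nil {F : Finset (Sym2 (Fin n))}
    (h : Data.children (encodeCompletion L (nonEdges G)) (encodeEdges G L)
      (encodeCompletion L F) = .nil) (d : ℕ) :
    (enterState G L F d).step = leaveState G L F d := by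
  rw [step_enterState, enterStep, Data.ite_pos h, leaveState]

theorem step_enterState_cons {F K : Finset (Sym2 (Fin n))} {l : List Data}
    (h : Data.children (encodeCompletion L (nonEdges G)) (encodeEdges G L)
      (encodeCompletion L F) = ofList (encodeCompletion L K :: l)) (d : ℕ) :
    (enterState G L F d).step = enterState G L K (d + 1) := by
  rw [step_enterState, enterStep, h, ofList_cons, Data.ite_neg (by simp), hd_cons,
    ofProp_ofProp_eq_nil, enterState]

theorem step_leaveState_root (hL : IsPairOrder L) (d : ℕ) :
    (leaveState G L (root G L) d).step = .nil := by
  rw [step_leaveState, leaveStep, root_encode hL, Data.ite_pos rfl]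

/-- The children are split at K, so that what `after` returns is l₂: its head is the next sibling,
and if it is empty the traversal goes back up to F. K must not occur in l₁, since `after` cuts at
the first occurrence. -/
theorem step_leaveState_child (hL : IsPairOrder L) {F K : Finset (Sym2 (Fin n))}
    {l₁ l₂ : List (Finset (Sym2 (Fin n)))} (hK : IsParent G L F K)
    (h : Data.children (encodeCompletion L (nonEdges G)) (encodeEdges G L)
      (encodeCompletion L F) = ofList ((l₁ ++ K :: l₂).map (encodeCompletion L)))
    (hl : encodeCompletion L K ∉ l₁.map (encodeCompletion L)) (d : ℕ) :
    (leaveState G L K (d + 1)).step = l₂.head?.elim (leaveState G L F d)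
      fun K' => enterState G L K' (d + 1) := by
  rw [step_leaveState, leaveStep, root_encode hL, parent_encode hL hK, h, List.map_append,
    List.map_cons, after_append hl, Data.ite_neg, ofProp_ofProp_eq_nil]
  · cases l₂ with
    | nil =>
      rw [Data.ite_pos (by rfl), List.head?_nil, Option.elim_none, leaveState,
        show Even (d + 1 + 1) ↔ Even d by rw [Nat.even_add_one, Nat.even_add_one, not_not]]
    | cons K' l₂ =>
      rw [Data.ite_neg (by simp), List.head?_cons, Option.elim_some, enterState, List.map_cons,
        ofList_cons, hd_cons]
  · intro heq
    rw [encodeCompletion_injOn hL hK.isMin.2.1.1 (isMinCompletion_root hL).1.1 heq] at hK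
    exact not_isParent_root hL hK

theorem size_encodeCompletion_le {F : Finset (Sym2 (Fin n))} (hF : F ⊆ nonEdges G) :
    (encodeCompletion L F).size ≤ (encodeCompletion L (nonEdges G)).size := by
  refine size_le_of_sublist ?_
  rw [toList_encodeCompletion, toList_encodeCompletion]
  exact (List.monotone_filter_right _ fun e he => by simpa using hF (by simpa using he)).map _

/-- Induction over the subtree of F, and inside it over the list of siblings from its end. Silent
states enter at odd or leave at even depth. From the former one enters a child at even depth or
leaves F itself at odd depth; from the latter one enters a sibling at even depth, leaves the parent
at odd depth, or halts at the root, so the next state outputs unless the traversal ends. In the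
bound, F is no larger than the list of non-edges, the two flags have size at most 3 each, and the
running flag and the five outer pairs account for the remaining 8. -/
theorem exec_enterState (hL : IsPairOrder L) {B : ℕ}
    (hB : 2 * (encodeCompletion L (nonEdges G)).size + (encodeEdges G L).size + 14 ≤ B)
    (F : Finset (Sym2 (Fin n))) (hF : IsMinCompletion G F) (d : ℕ) :
    ∃ kids mid : List (Finset (Sym2 (Fin n))), kids.Nodup ∧ (∀ K, K ∈ kids ↔ K ∈ children G L F) ∧
      EnumOutput G L (d + 1) kids mid ∧ Exec B (enterState G L F d)
        (((if Even d then [F] else []) ++ mid).map (encodeCompletion L)) (leaveState G L F d) := by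
  have hsize : ∀ (F : Finset (Sym2 (Fin n))) (d : ℕ), IsMinCompletion G F →
      (enterState G L F d).size ≤ B ∧ (leaveState G L F d).size ≤ B := by
    intro F d hF
    have h1 := size_encodeCompletion_le (L := L) hF.1.1
    have h2 := size_ofProp_le True
    have h3 := size_ofProp_le (Even d)
    simp only [enterState, leaveState, state, size_cons, size_nil]
    omega
  induction F using (wellFounded_children (G := G) hL).induction generalizing d with
  | _ F ih =>
  obtain ⟨kids, hkids, hnd, hmem⟩ := children_encode hL hF
  have hstep_child : ∀ (l₁ l₂ : List (Finset (Sym2 (Fin n)))) (K : Finset (Sym2 (Fin n)))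
      (o : List (Finset (Sym2 (Fin n)))), kids = l₁ ++ K :: l₂ → EnumOutput G L (d + 1) l₂ o →
      Exec B (l₂.head?.elim (leaveState G L F d) fun K' => enterState G L K' (d + 1))
        (o.map (encodeCompletion L)) (leaveState G L F d) →
      ∃ out, EnumOutput G L (d + 1) (K :: l₂) out ∧
        Exec B (enterState G L K (d + 1)) (out.map (encodeCompletion L)) (leaveState G L F d) := by
    intro l₁ l₂ K o hkeq ho hexec
    have hK := (hmem K).1 (by simp [hkeq])
    have hKF := (mem_children hL).1 hK
    obtain ⟨kids', mid, h1, h2, h3, h4⟩ := ih K hK hKF.isMin.2 (d + 1)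
    refine ⟨_, .cons _ _ _ kids' mid o h1 h2 h3 ho, ?_⟩
    have hl : encodeCompletion L K ∉ l₁.map (encodeCompletion L) := by
      rw [List.mem_map]
      rintro ⟨K', hK', heq⟩
      have hKF' := (mem_children hL).1 ((hmem K').1 (by simp [hkeq, hK']))
      rw [encodeCompletion_injOn hL hKF'.isMin.2.1.1 hKF.isMin.2.1.1 heq] at hK'
      rw [hkeq, List.nodup_append] at hnd
      exact hnd.2.2 K hK' K (by simp) rfl
    -- Leaving K leads to the next sibling or back to F, which is where the execution `hexec`
    -- starts.
    have hst := step_leaveState_child hL hKF (hkeq ▸ hkids) hl d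
    have hlast := Exec.step (leaveState G L K (d + 1)) (leaveState G L F d) _
      (by simp [leaveState, state]) (hsize K (d + 1) hKF.isMin.2).2 (fun h => .inl ?_)
      (by rw [hst]; exact hexec)
    · have := h4.trans hlast
      rw [emission_leaveState] at this
      convert this using 1
      split_ifs <;> simp
    · rw [emits_leaveState, not_not] at h
      rw [hst]
      cases l₂ with
      | nil => exact (emits_leaveState F d).2 (Nat.even_add_one.1 h)
      | cons K' l₂ => exact (emits_enterState K' (d + 1)).2 h
  have hsuffix : ∀ (l₂ l₁ : List (Finset (Sym2 (Fin n)))) (K : Finset (Sym2 (Fin n))),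
      kids = l₁ ++ K :: l₂ → ∃ out, EnumOutput G L (d + 1) (K :: l₂) out ∧
        Exec B (enterState G L K (d + 1)) (out.map (encodeCompletion L)) (leaveState G L F d) := by
    intro l₂
    induction l₂ with
    | nil => exact fun l₁ K hkeq => hstep_child l₁ [] K [] hkeq (.nil _) (.refl _)
    | cons K' l₂ ih₂ =>
      intro l₁ K hkeq
      obtain ⟨o, ho, hexec⟩ := ih₂ (l₁ ++ [K]) K' (by simp [hkeq])
      exact hstep_child l₁ _ K o hkeq ho hexec
  cases kids with
  | nil =>
    have hstep := step_enterState_nil (by simpa using hkids) d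
    refine ⟨[], [], hnd, hmem, .nil _, ?_⟩
    have := Exec.step (enterState G L F d) (leaveState G L F d) [] (by simp [enterState, state])
      (hsize F d hF).1 (fun h => .inl ?_) (by rw [hstep]; exact .refl _)
    · rw [emission_enterState] at this
      convert this using 1
      split_ifs <;> simp
    · rw [hstep, emits_leaveState]
      rwa [emits_enterState] at h
  | cons K l =>
    have hstep := step_enterState_cons (by simpa using hkids) d
    obtain ⟨out, h1, h2⟩ := hsuffix l [] K rfl
    refine ⟨_, out, hnd, hmem, h1, ?_⟩
    have := Exec.step (enterState G L F d) (leaveState G L F d) _ (by simp [enterState, state])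
      (hsize F d hF).1 (fun h => .inl ?_) (by rw [hstep]; exact h2)
    · rw [emission_enterState] at this
      convert this using 1
      split_ifs <;> simp
    · rw [hstep, emits_enterState, Nat.even_add_one]
      rwa [emits_enterState] at h

end Traversal

end ChordalEnum

namespace ChordalEnum

open Data

/-! ### The program and its complexity -/

section Complexity

variable {n : ℕ} {G : SimpleGraph (Fin n)} {L : List (Sym2 (Fin n))}

theorem size_ofNat (k : ℕ) : (ofNat k).size = 2 * k + 1 := by
  induction k with
  | zero => rfl
  | succ k ih => rw [ofNat, size_cons, ih, size_nil]; omega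

theorem length_le_mul_self (hL : IsPairOrder L) : L.length ≤ n * n :=
  hL.1.length_le_card.trans <| (Fintype.card_le_of_surjective (fun p : Fin n × Fin n => s(p.1, p.2))
    fun e => Sym2.ind (fun x y => ⟨(x, y), rfl⟩) e).trans (by simp)

theorem size_encodeGraph_le (hL : IsPairOrder L) :
    (encodeGraph G L).size ≤ 2 * n + (n * n * (4 * n + 8) + 1) + 2 := by
  rw [encodeGraph, size_cons, size_ofNat]
  have h1 := length_le_mul_self hL
  have h2 := size_ofList_le_of_forall (k := 4 * n + 7)
    (l := L.map fun e => .cons (encodePair e) (.ofBool (open Classical in decide (e ∈ G.edgeSet))))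
    (by
      simp only [List.mem_map]
      rintro _ ⟨e, _, rfl⟩
      have h3 := e.inf.isLt
      have h4 := e.sup.isLt
      rw [size_cons, encodePair, size_cons, size_ofNat, size_ofNat, ofBool_eq_ofProp]
      have h5 := size_ofProp_le ((open Classical in decide (e ∈ G.edgeSet)) = true)
      omega)
  rw [List.length_map, show 4 * n + 7 + 1 = 4 * n + 8 from rfl] at h2
  have h6 := Nat.mul_le_mul_right (4 * n + 8) h1
  omega

theorem start_encodeGraph (hL : IsPairOrder L) :
    start (encodeGraph G L) = enterState G L (root G L) 0 := by
  rw [start, nonEdgeList_encodeGraph hL, edgeList_encodeGraph, root_encode hL, enterState,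
    show Even 0 ↔ True from iff_true_intro Even.zero]

/-- The traversal outputs what the algorithm outputs. -/
theorem exec_start (hL : IsPairOrder L) {B : ℕ} (hB : 3 * (start (encodeGraph G L)).size + 14 ≤ B) :
    ∃ out, IsAlgorithmOutput G L out ∧
      Exec B (start (encodeGraph G L)) (out.map (encodeCompletion L)) .nil := by
  have hsize : (encodeCompletion L (nonEdges G)).size + (encodeEdges G L).size ≤
      (start (encodeGraph G L)).size := by
    rw [start_encodeGraph hL]
    simp only [enterState, state, size_cons]
    omega
  obtain ⟨kids, mid, h1, h2, h3, h4⟩ := exec_enterState hL (B := B) (by omega) (root G L)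
    (isMinCompletion_root hL) 0
  refine ⟨_, .cons 0 _ [] kids mid [] h1 h2 h3 (.nil 0), ?_⟩
  have hlt : (leaveState G L (root G L) 0).size ≤ B := by
    refine le_trans ?_ (show (start (encodeGraph G L)).size ≤ B by omega)
    rw [start_encodeGraph hL]
    simp only [enterState, leaveState, state, size_cons, size_nil]
    have := one_le_size (ofProp True)
    omega
  have hlast := Exec.step (leaveState G L (root G L) 0) .nil [] (by simp [leaveState, state]) hlt
    (fun _ => .inr (step_leaveState_root hL 0)) (by rw [step_leaveState_root hL]; exact .refl _)
  have := h4.trans hlast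
  rw [emission_leaveState, ← start_encodeGraph hL] at this
  convert this using 1
  simp

/-- There is a program that carries out the algorithm with polynomial delay and in polynomial
space. -/
theorem exists_polynomial_delay_program : ∃ (k : ℕ) (c : Prog (Fin (k + 1))) (p q : Polynomial ℕ),
    ∀ (n : ℕ) (G : SimpleGraph (Fin n)) (L : List (Sym2 (Fin n))), IsPairOrder L →
      ∃ (out : List (Finset (Sym2 (Fin n)))) (tr : List Step) (t : Fin (k + 1) → Data),
        IsAlgorithmOutput G L out ∧ Run c (initStore k (encodeGraph G L)) tr t ∧
          outputs tr = out.map (encodeCompletion L) ∧ DelayLE tr (p.eval n) ∧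
            SpaceLE tr t (q.eval n) := by
  obtain ⟨c₁, b₁, hb₁, hc₁, hs₁⟩ := Comp.start
  obtain ⟨c₂, b₂, hb₂, hc₂, -⟩ := Comp.step
  -- I bounds the input, B the states of the traversal, S the store at every step, and T both the
  -- preprocessing and one round of the main loop. The delay is 3T and the space S.
  let I : ℕ → ℕ := fun n => 2 * n + (n * n * (4 * n + 8) + 1) + 2
  let B : ℕ → ℕ := fun n => 3 * b₁ (I n) + 14
  let S : ℕ → ℕ := fun n => I n + B n + b₂ (B n) + b₁ (I n) + 3
  let T : ℕ → ℕ := fun n => (b₂ (B n) + b₁ (I n) + 3) * S n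
  have hI : PolyBound I := .add (.add (.mul (.const 2) .id) (.add (.mul (.mul .id .id)
    (.add (.mul (.const 4) .id) (.const 8))) (.const 1))) (.const 2)
  have hB : PolyBound B := .add (.mul (.const 3) (hb₁.comp hI)) (.const 14)
  have hS : PolyBound S :=
    .add (.add (.add (hI.add hB) (hb₂.comp hB)) (hb₁.comp hI)) (.const 3)
  have hT : PolyBound T := .mul (.add (.add (hb₂.comp hB) (hb₁.comp hI)) (.const 3)) hS
  obtain ⟨-, p, hp⟩ := PolyBound.mul (.const 3) hT
  obtain ⟨-, q, hq⟩ := hS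
  refine ⟨0, .seq (.assign 0 (.cons (.var 0) .nil)) (.seq c₁ (mainLoop c₂)), p, q,
    fun n G L hL => ?_⟩
  have hin : (encodeGraph G L).size ≤ I n := size_encodeGraph_le hL
  have hbI := hb₁.1 hin
  obtain ⟨out, hout, hexec⟩ := exec_start (G := G) hL (B := B n) (by
    have := hs₁ (encodeGraph G L)
    change _ ≤ 3 * b₁ (I n) + 14
    omega)
  obtain ⟨tr₁, hr1, hr2, hr3⟩ := hc₁ (encodeGraph G L) .nil
  have hSn : S n = I n + B n + b₂ (B n) + b₁ (I n) + 3 := rfl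
  have hTn : T n = (b₂ (B n) + b₁ (I n) + 3) * S n := rfl
  let x₀ : Step := ⟨(encodeGraph G L).size, none⟩
  have hsil : ∀ y ∈ x₀ :: tr₁, y.out = none ∧ y.size ≤ S n := by
    rw [List.forall_mem_cons]
    refine ⟨⟨rfl, ?_⟩, fun y hy => ⟨(hr2 y hy).1, (hr2 y hy).2.trans ?_⟩⟩
    · change (encodeGraph G L).size ≤ _
      omega
    · rw [size_nil]
      omega
  have hlen : (x₀ :: tr₁).length * S n ≤ T n := by
    rw [hTn]
    exact Nat.mul_le_mul_right _ (by rw [List.length_cons]; omega)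
  -- The clock does not start at 0: the silent preprocessing has already used time up to T.
  obtain ⟨tr₂, h1, h2, h3, h4⟩ := run_mainLoop hb₂.1 hc₂ (S := S n) (T := T n) (by omega)
    (by rw [hTn]; exact Nat.mul_le_mul_right _ (by omega)) hexec rfl
    (a := (x₀ :: tr₁).length * S n) (by omega) (fun _ _ => hlen)
  have hinit : initStore 0 (encodeGraph G L) = store (encodeGraph G L) :=
    funext fun i => by rw [@Subsingleton.elim (Fin 1) _ i 0]; rfl
  have hassign := Run.assign 0 (.cons (.var 0) .nil) (store (encodeGraph G L))
  rw [update_store, storeSize_store] at hassign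
  refine ⟨out, (x₀ :: tr₁) ++ tr₂, store (.cons .nil .nil), hout, ?_, ?_, ?_, ?_, ?_⟩
  · rw [hinit]
    exact .seq _ _ _ _ _ [x₀] _ hassign (.seq _ _ _ _ _ _ _ hr1 h1)
  · rw [outputs_append, outputs_of_silent hsil, h2, List.nil_append]
  · have h5 := DelayFrom.of_silent (D := 3 * T n) (a := 0) hsil (by omega)
    rw [Nat.zero_add] at h5
    intro u x hu hnone
    exact ((h5.append h3).delayLE u x hu hnone).trans (hp n)
  · rw [List.forall_mem_append]
    exact ⟨fun x hx => (hsil x hx).2.trans (hq n), fun x hx => (h4 x hx).trans (hq n)⟩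
  · rw [storeSize_store, size_cons, size_nil]
    exact le_trans (by omega) (hq n)

end Complexity

end ChordalEnum
open ChordalEnum in
theorem mainTheorem1 :
    -- Correctness, for every finite graph `G` and every order `L` of the pairs of vertices:
    (∀ (V : Type*) [Fintype V] [DecidableEq V] (G : SimpleGraph V) (L : List (Sym2 V)),
      IsPairOrder L →
        -- every minimal completion has a canonical path, and all but the root have a parent,
        (∀ F, IsMinCompletion G F → ∃! p, IsCanonicalPath G L F p) ∧
        (∀ F, IsMinCompletion G F → F ≠ root G L →
          ∃! P, IsParent G L P F) ∧
        -- the children form a spanning arborescence on the minimal completions,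
        IsSpanningArborescence {F | IsMinCompletion G F} (fun F F' => F' ∈ children G L F)
          (root G L) ∧
        -- and the algorithm terminates and outputs every minimal completion exactly once.
        (∃ out, IsAlgorithmOutput G L out) ∧
        (∀ out, IsAlgorithmOutput G L out →
          out.Nodup ∧ ∀ F, F ∈ out ↔ IsMinCompletion G F)) ∧
    -- Complexity: a program carries out the algorithm with polynomial delay and space.
    (∃ (k : ℕ) (c : Prog (Fin (k + 1))) (p q : Polynomial ℕ),
      ∀ (n : ℕ) (G : SimpleGraph (Fin n)) (L : List (Sym2 (Fin n))), IsPairOrder L →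
        ∃ (out : List (Finset (Sym2 (Fin n)))) (tr : List Step) (t : Fin (k + 1) → Data),
          IsAlgorithmOutput G L out ∧
          Run c (initStore k (encodeGraph G L)) tr t ∧
          outputs tr = out.map (encodeCompletion L) ∧
          DelayLE tr (p.eval n) ∧
          SpaceLE tr t (q.eval n)) := by
  refine ⟨fun V _ _ G L hL => ⟨fun F hF => existsUnique_isCanonicalPath hL hF,
    fun F hF hne => existsUnique_isParent hL hF hne, isSpanningArborescence_children hL,
    exists_enumOutput hL _ 0, fun out h => isAlgorithmOutput_spec hL h⟩,
    exists_polynomial_delay_program⟩
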